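/- Let $\mathbb{F}_q$ be a finite field of characteristic $3$, $K$ a function field in one variable over $\mathbb{F}_q$ (a finite extension of a rational function field over $\mathbb{F}_q$), and $L/K$ a separable cubic extension with a generator $y$ whose minimal polynomial is $X^3+aX+a^2$, $a\in K$. Let $\mathfrak{p}$ be a place of $K$, with normalized valuation $v_\mathfrak{p}$ and residue field $k(\mathfrak{p})$, and let $\mathrm{Tr}$ be the trace from $k(\mathfrak{p})$ to its prime field $\mathbb{F}_3$. The signature of $\mathfrak{p}$ in $L$ is the list $(e_1,f_1;\dots;e_r,f_r)$ of the ramification indices and inertia degrees of the distinct places of $L$ above $\mathfrak{p}$, up to order. Call $\mathfrak{p}$ fully ramified if some place above it has ramification index $[L:K]$, inert if there is exactly one place above it and it is unramified, and completely split if there are $[L:K]$ distinct places above it (similarly for places of other fields and extensions). For $j\in\{1,2\}$ and $w\in K$ put $$\alpha_{j,w}=\frac{\left(ja^2+(w^3+aw)\right)^2}{a^3}.$$ Consider the condition $(R)$: there are $j\in\{1,2\}$ and $w\in K$ such that $v_\mathfrak{p}(\alpha_{j,w})<0$ and $(v_\mathfrak{p}(\alpha_{j,w}),3)=1$. There is an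 $x\in K$, transcendental over $\mathbb{F}_q$, with $v_\mathfrak{p}(x)\ge 0$. For every such $x$, the integral closure $\mathcal{O}_{L,x}$ of $\mathbb{F}_q[x]$ in $L$ is a Dedekind domain; identify the places of $L$ above $\mathfrak{p}$ with the corresponding maximal ideals of $\mathcal{O}_{L,x}$, and write $\mathfrak{p}\mathcal{O}_{L,x}$ for the ideal generated in $\mathcal{O}_{L,x}$ by the prime ideal of $\mathcal{O}_{K,x}$ (the integral closure of $\mathbb{F}_q[x]$ in $K$) corresponding to $\mathfrak{p}$. Then: **(1)** The following are equivalent: $\mathfrak{p}$ is fully ramified in $L$; $\mathfrak{p}\mathcal{O}_{L,x}=\mathfrak{P}^3$ for a place $\mathfrak{P}$ of $L$ above $\mathfrak{p}$; $(R)$; there is a generator $z$ of $L/K$ with minimal polynomial $X^3+\alpha X+\alpha^2$, where $\alpha\in K$, $v_\mathfrak{p}(\alpha)<0$ and $(v_\mathfrak{p}(\alpha),3)=1$. In this case the signature of $\mathfrak{p}$ is $(3,1)$. If $(R)$ fails, there is a generator $z$ of $L/K$ with minimal polynomial $X^3+cX+c^2$, where $c\in K$ and $v_\mathfrak{p}(c)\geq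 0$. Let $z$ be any such generator, and let $b\in\overline{K}$ satisfy $b^2=-c$. **(2)** Suppose $v_\mathfrak{p}(c)=0$. (a) $\mathfrak{p}$ is inert in $L$ if and only if $-c$ is a square modulo $\mathfrak{p}$ and $\mathrm{Tr}(\bar b)\neq 0$, where $\bar b\in k(\mathfrak{p})$ is a square root of $-c \bmod \mathfrak{p}$. In this case $f(\mathfrak{P}|\mathfrak{p})=3$ for the place $\mathfrak{P}$ above $\mathfrak{p}$, and the signature is $(1,3)$. (b) $\mathfrak{p}$ is completely split in $L$ if and only if $-c$ is a square modulo $\mathfrak{p}$ and $\mathrm{Tr}(\bar b)=0$, with $\bar b$ as in (a). In this case the signature is $(1,1;1,1;1,1)$. (c) $\mathfrak{p}\mathcal{O}_{L,x}=\mathfrak{P}_1\mathfrak{P}_2$ with distinct places $\mathfrak{P}_1,\mathfrak{P}_2$ of $L$ above $\mathfrak{p}$ if and only if $-c$ is not a square modulo $\mathfrak{p}$. In this case $[L(b):L]=2$ and, up to relabelling, $f(\mathfrak{P}_1|\mathfrak{p})=1$ and $\mathfrak{P}_1$ is inert in $L(b)$, whereas $f(\mathfrak{P}_2|\mathfrak{p})=2$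 and $\mathfrak{P}_2$ splits in $L(b)$; the signature is $(1,1;1,2)$. **(3)** Suppose $v_\mathfrak{p}(c)>0$. (a) $\mathfrak{p}$ is completely split in $L$ if and only if $2\mid v_\mathfrak{p}(c)$ and $-s^2c$ is a square modulo $\mathfrak{p}$ for some $s\in K^*$ with $v_\mathfrak{p}(s^2c)=0$. In this case the signature is $(1,1;1,1;1,1)$. (b) $\mathfrak{p}\mathcal{O}_{L,x}=\mathfrak{P}_1\mathfrak{P}_2$ with distinct places $\mathfrak{P}_1,\mathfrak{P}_2$ of $L$ above $\mathfrak{p}$ if and only if $2\mid v_\mathfrak{p}(c)$ and $-s^2c$ is not a square modulo $\mathfrak{p}$ for some $s\in K^*$ with $v_\mathfrak{p}(s^2c)=0$. In this case $[L(b):L]=2$ and, up to relabelling, $f(\mathfrak{P}_1|\mathfrak{p})=1$ and $\mathfrak{P}_1$ is inert in $L(b)$, whereas $f(\mathfrak{P}_2|\mathfrak{p})=2$ and $\mathfrak{P}_2$ splits in $L(b)$; the signature is $(1,1;1,2)$. (c) $\mathfrak{p}\mathcal{O}_{L,x}=\mathfrak{P}_1^2\mathfrak{P}_2$ with distinct places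 $\mathfrak{P}_1,\mathfrak{P}_2$ of $L$ above $\mathfrak{p}$ if and only if $v_\mathfrak{p}(c)$ is odd. In this case $[L(b):L]=2$, $f(\mathfrak{P}_1|\mathfrak{p})=f(\mathfrak{P}_2|\mathfrak{p})=1$, $\mathfrak{P}_1$ splits in $L(b)$ and $\mathfrak{P}_2$ is ramified in $L(b)$; the signature is $(2,1;1,1)$. -/

import Mathlib

open Polynomial IntermediateField

/-- A place of a field `F`, given by its valuation ring: a discrete valuation ring with
fraction field `F`.  In a function field with finite constant field these are exactly the
nontrivial valuation rings (and they automatically contain the constants). -/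
@[ext]
structure Place (F : Type*) [Field F] where
  /-- The valuation ring of the place. -/
  ring : ValuationSubring F
  isDVR : IsDiscreteValuationRing ring

attribute [instance] Place.isDVR

namespace Place

/-- The normalized (surjective onto `ℤ`) valuation `v_𝔭(x)` of a nonzero `x`.
The value at `0` is the default value `0`. -/
noncomputable def ord {F : Type*} [Field F] (p : Place F) (x : F) : ℤ :=
  -WithZero.log ((IsDiscreteValuationRing.maximalIdeal p.ring).valuation F x)

/-- The residue field `k(𝔭)`. -/
abbrev ResidueField {F : Type*} [Field F] (p : Place F) : Type _ :=
  IsLocalRing.ResidueField p.ring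

open scoped Classical in
/-- The reduction modulo `𝔭` of an element integral at `𝔭` (default value `0` for the other
elements). -/
noncomputable def res {F : Type*} [Field F] (p : Place F) (t : F) : p.ResidueField :=
  if h : t ∈ p.ring then IsLocalRing.residue p.ring ⟨t, h⟩ else 0

/-- The trace map from the residue field `k(𝔭)` to its prime field. -/
noncomputable def tr {F : Type*} [Field F] (p : Place F) (β : p.ResidueField) :
    (⊥ : Subfield p.ResidueField) :=
  Algebra.trace (⊥ : Subfield p.ResidueField) p.ResidueField β

section Extension

variable (K : Type*) {L : Type*} [Field K] [Field L] [Algebra K L]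

/-- For a place `𝔓` of `L`, its valuation ring is an algebra over its intersection with `K`. -/
noncomputable instance algebraUnder (P : Place L) :
    Algebra (P.ring.comap (algebraMap K L)) P.ring :=
  ((algebraMap K L).restrict (P.ring.comap (algebraMap K L)) P.ring (fun _ h => h)).toAlgebra

/-- The ramification index of the place `𝔓` of `L` over the place of `K` below it. -/
noncomputable def e (P : Place L) : ℕ :=
  (IsLocalRing.maximalIdeal P.ring).ramificationIdx (P.ring.comap (algebraMap K L))

/-- The inertia degree of the place `𝔓` of `L` over the place of `K` below it. -/
noncomputable def f (P : Place L) : ℕ :=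
  (IsLocalRing.maximalIdeal P.ring).inertiaDeg (P.ring.comap (algebraMap K L))

variable {K} (L)

/-- The set of places of `L` above the place `𝔭` of `K`. -/
def above (p : Place K) : Set (Place L) :=
  {P | P.ring.comap (algebraMap K L) = p.ring}

/-- `𝔭` has signature `(e₁, f₁; …; e_r, f_r)` in `L`: the places of `L` above `𝔭` can be
enumerated without repetition as `𝔓₁, …, 𝔓_r` with `e(𝔓ᵢ|𝔭) = eᵢ` and `f(𝔓ᵢ|𝔭) = fᵢ`. -/
def HasSignature (p : Place K) (s : List (ℕ × ℕ)) : Prop :=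
  ∃ l : List (Place L), l.Nodup ∧ (∀ P, P ∈ l ↔ P ∈ p.above L) ∧
    l.map (fun P => (P.e K, P.f K)) = s

/-- `𝔭` is fully ramified in `L`. -/
def FullyRamified (p : Place K) : Prop :=
  ∃ P ∈ p.above L, P.e K = Module.finrank K L

/-- `𝔭` is ramified in `L`. -/
def Ramified (p : Place K) : Prop :=
  ∃ P ∈ p.above L, 1 < P.e K

/-- `𝔭` is inert in `L`: there is only one place above it, and it is unramified. -/
def Inert (p : Place K) : Prop :=
  ∃ P, p.above L = {P} ∧ P.e K = 1

/-- `𝔭` is completely split in `L`: there are `[L : K]` distinct places above it. -/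
def CompletelySplit (p : Place K) : Prop :=
  (p.above L).ncard = Module.finrank K L

end Extension

end Place

/-- `𝒪_{F,x}`, for `x ∈ K` and an extension `F` of `K`: the integral closure of `k[x]`
in `F`. -/
abbrev holRing (k : Type*) {K : Type*} [Field k] [Field K] [Algebra k K] (x : K)
    (F : Type*) [Field F] [Algebra K F] : Subalgebra (Algebra.adjoin k {x}) F :=
  integralClosure (Algebra.adjoin k {x}) F

section Ideals

variable (k : Type*) {K : Type*} [Field k] [Field K] [Algebra k K] (x : K)

/-- The ideal of `𝒪_{F,x}` attached to a place `𝔓` of `F`: the elements of `𝒪_{F,x}` which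
vanish at `𝔓`.  (When `𝔓` is not above the pole of `x` these elements already form
an ideal.) -/
def Place.toIdeal {F : Type*} [Field F] [Algebra K F] (P : Place F) : Ideal (holRing k x F) :=
  Ideal.span {t | (t : F) ∈ P.ring.nonunits}

/-- The inclusion `𝒪_{K,x} → 𝒪_{L,x}`. -/
def holRingMap (L : Type*) [Field L] [Algebra K L] :
    holRing k x K →ₐ[Algebra.adjoin k {x}] holRing k x L :=
  (IsScalarTower.toAlgHom (Algebra.adjoin k {x}) K L).mapIntegralClosure

/-- The extended ideal `𝔭 𝒪_{L,x}` for a place `𝔭` of `K`. -/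
def Place.extIdeal (p : Place K) (L : Type*) [Field L] [Algebra K L] :
    Ideal (holRing k x L) :=
  (p.toIdeal k x).map (holRingMap k x L)

end Ideals

/-- `z` is a generator of `L / K` with minimal polynomial `X³ + cX + c²`. -/
def IsCubicGen {K L : Type*} [Field K] [Field L] [Algebra K L] (z : L) (c : K) : Prop :=
  K⟮z⟯ = ⊤ ∧ minpoly K z = X ^ 3 + C c * X + C (c ^ 2)

/-- The transformed parameter `(j a² + (w³ + a w))² / a³`. -/
def transParam {K : Type*} [Field K] (a : K) (j : ℕ) (w : K) : K :=
  ((j : K) * a ^ 2 + (w ^ 3 + a * w)) ^ 2 / a ^ 3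

/-- Some transformed parameter `α` of `a` has `v_𝔭(α) < 0` and `(v_𝔭(α), 3) = 1`. -/
def HasRamifiedParam {K : Type*} [Field K] (p : Place K) (a : K) : Prop :=
  ∃ j : ℕ, (j = 1 ∨ j = 2) ∧ ∃ w : K,
    p.ord (transParam a j w) < 0 ∧ IsCoprime (p.ord (transParam a j w)) 3

/-! In characteristic 3 every generator `u = jy - w` with `j = ±1` again satisfies `u³ + au + g =
0`, where `g = ja² + w³ + aw`; multiplying by `g/a²` restores the shape `X³ + αX + α²` with `α =
g²/a³` (`IsCubicGen.exists_transParam`). Hence `v(α) = 2v(g) - 3v(a)`.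

If `v(α) < 0` is prime to 3, balancing the terms of the equation at a place above `𝔭` gives `3v(z) =
2e·v(α)`, so `3 ∣ e` (`hasSignature_of_isCoprime_ord`). If no such parameter exists, either some
`v(α)` is nonnegative, or every one with `j = 1` is negative and divisible by 3. In the latter case
extracting a cube root in the finite residue field yields a better `w` (`IsCubicGen.exists_ord_lt`);
since `v(g)` is bounded, this is impossible.

For integral `c` the decomposition is read off modulo `𝔭`. If `v(c) = 0`, the reduced cubic is
separable. When `-c = β²`, setting `X = -βT` turns it into `T³ - T = β`, decided by the trace;
otherwise it has exactly one root. If `v(c) > 0` is even, rescaling by `s` with `s²c` a unit gives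
the reduction `X(X² + d)`. If `v(c)` is odd, `r = -c/z` satisfies `r³ - r² = c`, which reduces to
`r²(r - 1)`, and parity forces ramification at the zero of `r`.

Two general tools replace completions: a polynomial not coprime to the minimal polynomial modulo `𝔭`
vanishes at some place above (`exists_above_of_not_isCoprime`), and lower bounds for `e` and `f`
that exhaust `∑ ef = 3` are sharp (`signature_of_le`). Splitting in `L(b)` follows by multiplying
`-c` by squares of `L`. Since the resulting signatures are different and the cases exhaustive, all
equivalences follow. Ideal factorizations translate into multiplicities of places once `𝒪_{L,x}` is
known to be Dedekind, also when `L` is inseparable over `𝔽_q(x)`. -/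

namespace Place

/-! ### Orders and residues at a single place. -/

section Ord

variable {F : Type*} [Field F] (p : Place F)

/-- The height one prime of the valuation ring of a place. -/
noncomputable abbrev prime : IsDedekindDomain.HeightOneSpectrum p.ring :=
  IsDiscreteValuationRing.maximalIdeal p.ring

lemma ord_def (x : F) : p.ord x = -WithZero.log (p.prime.valuation F x) := rfl

lemma val_ne_zero {x : F} (hx : x ≠ 0) : p.prime.valuation F x ≠ 0 :=
  (Valuation.ne_zero_iff _).2 hx

@[simp] lemma ord_one : p.ord 1 = 0 := by simp [ord_def]

@[simp] lemma ord_zero : p.ord 0 = 0 := by simp [ord_def]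

lemma ord_mul {x y : F} (hx : x ≠ 0) (hy : y ≠ 0) : p.ord (x * y) = p.ord x + p.ord y := by
  rw [ord_def, map_mul, WithZero.log_mul (p.val_ne_zero hx) (p.val_ne_zero hy), ord_def, ord_def]
  ring

@[simp] lemma ord_pow (x : F) (n : ℕ) : p.ord (x ^ n) = n * p.ord x := by
  simp [ord_def, WithZero.log_pow]

@[simp] lemma ord_inv (x : F) : p.ord x⁻¹ = -p.ord x := by
  simp [ord_def, WithZero.log_inv]

lemma ord_div {x y : F} (hx : x ≠ 0) (hy : y ≠ 0) : p.ord (x / y) = p.ord x - p.ord y := by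
  rw [div_eq_mul_inv, p.ord_mul hx (inv_ne_zero hy), ord_inv, sub_eq_add_neg]

@[simp] lemma ord_neg (x : F) : p.ord (-x) = p.ord x := by
  simp [ord_def, Valuation.map_neg]

lemma mem_ring_iff_val {x : F} : x ∈ p.ring ↔ p.prime.valuation F x ≤ 1 := by
  constructor
  · intro h
    exact p.prime.valuation_le_one (K := F) ⟨x, h⟩
  · intro h
    obtain ⟨a, ha⟩ := IsDiscreteValuationRing.exists_lift_of_le_one h
    rw [← ha]; exact a.2

lemma mem_nonunits_iff_val {x : F} : x ∈ p.ring.nonunits ↔ p.prime.valuation F x < 1 := by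
  rw [ValuationSubring.mem_nonunits_iff_or]
  rcases eq_or_ne x 0 with rfl | hx
  · simp
  · rw [mem_ring_iff_val, map_inv₀]
    have := p.val_ne_zero hx
    simp only [hx, false_or, not_le]
    rw [one_lt_inv₀ (zero_lt_iff.2 this)]

lemma mem_ring_iff {x : F} (hx : x ≠ 0) : x ∈ p.ring ↔ 0 ≤ p.ord x := by
  rw [mem_ring_iff_val, ord_def, neg_nonneg, WithZero.log_le_iff_le_exp (p.val_ne_zero hx)]
  simp

lemma mem_nonunits_iff {x : F} (hx : x ≠ 0) : x ∈ p.ring.nonunits ↔ 0 < p.ord x := by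
  rw [mem_nonunits_iff_val, ord_def, neg_pos, WithZero.log_lt_iff_lt_exp (p.val_ne_zero hx)]
  simp

lemma mem_ring_of_ord {x : F} (h : 0 ≤ p.ord x) : x ∈ p.ring := by
  rcases eq_or_ne x 0 with rfl | hx
  · exact zero_mem _
  · exact (p.mem_ring_iff hx).2 h

lemma exists_ord_eq (n : ℤ) : ∃ x : F, x ≠ 0 ∧ p.ord x = n := by
  obtain ⟨x, hx⟩ := p.prime.valuation_surjective F (WithZero.exp (-n))
  refine ⟨x, ?_, ?_⟩
  · rintro rfl
    simp at hx
    exact WithZero.exp_ne_zero hx.symm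
  · rw [ord_def, hx, WithZero.log_exp, neg_neg]

/-- A strictly dominant term cannot cancel: after division by `x`, the unit `-1` would lie in the
maximal ideal. Zero terms are listed separately because `ord 0` has the default value `0`, not
infinity. -/
lemma ord_ne_zero_of_sum_eq_zero {x y z : F} (hx : x ≠ 0) (hy : y = 0 ∨ p.ord x < p.ord y)
    (hz : z = 0 ∨ p.ord x < p.ord z) : x + y + z ≠ 0 := by
  have key : ∀ t : F, t = 0 ∨ p.ord x < p.ord t → t / x ∈ p.ring.nonunits := by
    rintro t (rfl | h)
    · rw [zero_div]; exact zero_mem _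
    · rcases eq_or_ne t 0 with rfl | ht
      · rw [zero_div]; exact zero_mem _
      rw [p.mem_nonunits_iff (div_ne_zero ht hx), p.ord_div ht hx]; omega
  intro h
  have h1 : (-1 : F) = y / x + z / x := by
    field_simp; linear_combination -h
  have h2 : (-1 : F) ∈ p.ring.nonunits := h1 ▸ add_mem (key y hy) (key z hz)
  rw [p.mem_nonunits_iff (by simp), ord_neg, ord_one] at h2
  exact lt_irrefl _ h2

lemma ring_ne_top : p.ring ≠ ⊤ := by
  intro h
  obtain ⟨x, hx, h1⟩ := p.exists_ord_eq (-1)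
  have : x ∈ p.ring := h ▸ ValuationSubring.mem_top x
  rw [p.mem_ring_iff hx] at this
  omega

lemma res_of_mem {t : F} (h : t ∈ p.ring) : p.res t = IsLocalRing.residue p.ring ⟨t, h⟩ := dif_pos h

lemma res_eq_zero_iff {t : F} (h : t ∈ p.ring) : p.res t = 0 ↔ t ∈ p.ring.nonunits := by
  rw [p.res_of_mem h, IsLocalRing.residue_eq_zero_iff,
    ← ValuationSubring.coe_mem_nonunits_iff]

lemma res_surjective (β : p.ResidueField) : ∃ t ∈ p.ring, p.res t = β := by
  obtain ⟨⟨t, ht⟩, rfl⟩ := IsLocalRing.residue_surjective β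
  exact ⟨t, ht, p.res_of_mem ht⟩

lemma res_add {s t : F} (hs : s ∈ p.ring) (ht : t ∈ p.ring) :
    p.res (s + t) = p.res s + p.res t := by
  rw [p.res_of_mem hs, p.res_of_mem ht, p.res_of_mem (add_mem hs ht), ← map_add]; rfl

lemma res_mul {s t : F} (hs : s ∈ p.ring) (ht : t ∈ p.ring) :
    p.res (s * t) = p.res s * p.res t := by
  rw [p.res_of_mem hs, p.res_of_mem ht, p.res_of_mem (mul_mem hs ht), ← map_mul]; rfl

lemma res_neg {s : F} (hs : s ∈ p.ring) : p.res (-s) = -p.res s := by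
  rw [p.res_of_mem hs, p.res_of_mem (neg_mem hs), ← map_neg]; rfl

lemma res_pow {s : F} (hs : s ∈ p.ring) (n : ℕ) : p.res (s ^ n) = p.res s ^ n := by
  rw [p.res_of_mem hs, p.res_of_mem (pow_mem hs n), ← map_pow]; rfl

lemma res_sub {s t : F} (hs : s ∈ p.ring) (ht : t ∈ p.ring) :
    p.res (s - t) = p.res s - p.res t := by
  rw [sub_eq_add_neg, p.res_add hs (neg_mem ht), p.res_neg ht, sub_eq_add_neg]

lemma res_sum {ι : Type*} (s : Finset ι) {t : ι → F} (ht : ∀ i, t i ∈ p.ring) :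
    p.res (∑ i ∈ s, t i) = ∑ i ∈ s, p.res (t i) := by
  classical
  induction s using Finset.induction_on with
  | empty =>
    rw [Finset.sum_empty, Finset.sum_empty, p.res_eq_zero_iff (zero_mem _)]
    exact zero_mem _
  | insert i s hi ih =>
    rw [Finset.sum_insert hi, Finset.sum_insert hi, p.res_add (ht i) (sum_mem fun i _ => ht i), ih]

lemma res_eq_res_iff {s t : F} (hs : s ∈ p.ring) (ht : t ∈ p.ring) :
    p.res s = p.res t ↔ s - t ∈ p.ring.nonunits := by
  rw [← sub_eq_zero, ← p.res_sub hs ht, p.res_eq_zero_iff (sub_mem hs ht)]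

lemma isSquare_res_iff {u : F} (hu : u ∈ p.ring) :
    IsSquare (p.res u) ↔ ∃ r ∈ p.ring, r ^ 2 - u ∈ p.ring.nonunits := by
  constructor
  · rintro ⟨ρ, hρ⟩
    obtain ⟨r, hr, rfl⟩ := p.res_surjective ρ
    refine ⟨r, hr, ?_⟩
    rw [← p.res_eq_res_iff (pow_mem hr 2) hu, p.res_pow hr, hρ, sq]
  · rintro ⟨r, hr, h⟩
    rw [← p.res_eq_res_iff (pow_mem hr 2) hu, p.res_pow hr] at h
    exact ⟨p.res r, by rw [← h, sq]⟩

lemma mul_mem_nonunits {s t : F} (hs : s ∈ p.ring.nonunits) (ht : t ∈ p.ring) :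
    s * t ∈ p.ring.nonunits := by
  have hs' := ValuationSubring.nonunits_subset hs
  rw [← p.res_eq_zero_iff (mul_mem hs' ht), p.res_mul hs' ht, (p.res_eq_zero_iff hs').2 hs, zero_mul]

lemma res_ne_zero_iff {t : F} (h : t ≠ 0) (ht : t ∈ p.ring) : p.res t ≠ 0 ↔ p.ord t = 0 := by
  have h1 := (p.mem_ring_iff h).1 ht
  rw [Ne, p.res_eq_zero_iff ht, p.mem_nonunits_iff h]
  omega

end Ord

/-! ### Places and height one primes of a Dedekind domain. -/

section Center

variable {F : Type*} [Field F] (P : Place F) {O : Type*} [CommRing O] [Algebra O F]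

/-- A ring mapping into the valuation ring of a place acts on this valuation ring. -/
@[reducible] def algebraOfLe (h : ∀ a : O, algebraMap O F a ∈ P.ring) : Algebra O P.ring :=
  ((algebraMap O F).codRestrict P.ring.toSubring h).toAlgebra

variable [IsDedekindDomain O] [IsFractionRing O F]

/-- The centre of a nontrivial valuation ring on a Dedekind domain contained in it. -/
noncomputable def valCenter (V : ValuationSubring F) (hV : V ≠ ⊤)
    (h : ∀ a : O, algebraMap O F a ∈ V) : IsDedekindDomain.HeightOneSpectrum O where
  asIdeal := (IsLocalRing.maximalIdeal V).comap ((algebraMap O F).codRestrict V.toSubring h)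
  isPrime := Ideal.comap_isPrime _ _
  ne_bot := by
    intro h0
    apply hV
    rw [eq_top_iff]
    rintro x -
    obtain ⟨a, b, hb, rfl⟩ := IsFractionRing.div_surjective (A := O) x
    have hb0 : b ≠ 0 := nonZeroDivisors.ne_zero hb
    have : b ∉ (IsLocalRing.maximalIdeal V).comap
        ((algebraMap O F).codRestrict V.toSubring h) := by
      rw [h0]; simpa using hb0
    rw [Ideal.mem_comap, ← ValuationSubring.coe_mem_nonunits_iff,
      ValuationSubring.mem_nonunits_iff_or] at this
    push Not at this
    rw [div_eq_mul_inv]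
    exact mul_mem (h a) this.2

lemma mem_valCenter {V : ValuationSubring F} (hV : V ≠ ⊤)
    (h : ∀ a : O, algebraMap O F a ∈ V) (a : O) :
    a ∈ (valCenter V hV h).asIdeal ↔ algebraMap O F a ∈ V.nonunits := by
  change (algebraMap O F).codRestrict V.toSubring h a ∈ IsLocalRing.maximalIdeal V ↔ _
  rw [← ValuationSubring.coe_mem_nonunits_iff]; rfl

lemma valuationSubringAtPrime_valCenter {V : ValuationSubring F} (hV : V ≠ ⊤)
    (h : ∀ a : O, algebraMap O F a ∈ V) :
    (valCenter V hV h).valuationSubringAtPrime F = V := by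
  -- The localization at the centre is a discrete valuation ring, so it has no overring other than
  -- itself and the field.
  apply ValuationSubring.eq_of_le_of_ne_top _ _ hV
  rintro x ⟨a, s, hs, rfl⟩
  have : s ∉ (valCenter V hV h).asIdeal := hs
  rw [mem_valCenter, ValuationSubring.mem_nonunits_iff_or] at this
  push Not at this
  exact mul_mem (h a) this.2

/-- The centre of a place on a Dedekind domain contained in its valuation ring. -/
noncomputable def center (h : ∀ a : O, algebraMap O F a ∈ P.ring) :
    IsDedekindDomain.HeightOneSpectrum O := valCenter P.ring P.ring_ne_top h

lemma mem_center (h : ∀ a : O, algebraMap O F a ∈ P.ring) (a : O) :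
    a ∈ (P.center h).asIdeal ↔ algebraMap O F a ∈ P.ring.nonunits := mem_valCenter _ h a

lemma valuationSubringAtPrime_center (h : ∀ a : O, algebraMap O F a ∈ P.ring) :
    (P.center h).valuationSubringAtPrime F = P.ring := valuationSubringAtPrime_valCenter _ h

/-- The place attached to a height one prime of a Dedekind domain. -/
noncomputable def ofPrime (v : IsDedekindDomain.HeightOneSpectrum O) : Place F where
  ring := v.valuationSubringAtPrime F
  isDVR := IsLocalization.AtPrime.isDiscreteValuationRing_of_dedekind_domain O v.ne_bot _

lemma isDVR_of_le {V : ValuationSubring F} (hV : V ≠ ⊤) (h : ∀ a : O, algebraMap O F a ∈ V) :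
    IsDiscreteValuationRing V :=
  valuationSubringAtPrime_valCenter hV h ▸ (ofPrime (valCenter V hV h)).isDVR

lemma mem_ofPrime (v : IsDedekindDomain.HeightOneSpectrum O) (a : O) :
    algebraMap O F a ∈ (ofPrime (F := F) v).ring :=
  (algebraMap O (v.valuationSubringAtPrime F) a).2

lemma center_ofPrime (v : IsDedekindDomain.HeightOneSpectrum O) :
    (ofPrime (F := F) v).center (mem_ofPrime v) = v := by
  set w := (ofPrime (F := F) v).center (mem_ofPrime v)
  have h : w.valuationSubringAtPrime F = v.valuationSubringAtPrime F :=
    valuationSubringAtPrime_center _ _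
  rw [IsDedekindDomain.HeightOneSpectrum.valuationSubringAtPrime_eq_valuationSubring,
    IsDedekindDomain.HeightOneSpectrum.valuationSubringAtPrime_eq_valuationSubring] at h
  exact IsDedekindDomain.HeightOneSpectrum.eq_of_valuation_isEquiv_valuation (K := F)
    (Valuation.isEquiv_iff_valuationSubring _ _ |>.2 h)

lemma center_injective {P Q : Place F} (h : ∀ a : O, algebraMap O F a ∈ P.ring)
    (h' : ∀ a : O, algebraMap O F a ∈ Q.ring) (e : P.center h = Q.center h') : P = Q := by
  apply Place.ext
  rw [← P.valuationSubringAtPrime_center h, e, Q.valuationSubringAtPrime_center h']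

lemma isLocalization_center (h : ∀ a : O, algebraMap O F a ∈ P.ring) :
    letI := P.algebraOfLe h
    IsLocalization.AtPrime P.ring (P.center h).asIdeal := by
  let := P.algebraOfLe h
  let e : (P.center h).valuationSubringAtPrime F ≃ₐ[O] P.ring :=
    AlgEquiv.ofRingEquiv (f := RingEquiv.subringCongr
      (congrArg ValuationSubring.toSubring (P.valuationSubringAtPrime_center h)))
      (fun a => Subtype.ext rfl)
  exact IsLocalization.isLocalization_of_algEquiv _ e

/-- The valuation ring is the localization of `O` at the centre, hence unramified over it. With the
analogous fact for residue fields, this moves `e` and `f` between valuation rings and Dedekind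
domains. -/
lemma ramificationIdx_eq_one_of_center (h : ∀ a : O, algebraMap O F a ∈ P.ring) :
    letI := P.algebraOfLe h
    (IsLocalRing.maximalIdeal P.ring).ramificationIdx O = 1 := by
  let := P.algebraOfLe h
  have := P.isLocalization_center h
  have : Algebra.FormallyUnramified O P.ring :=
    Algebra.FormallyUnramified.of_isLocalization (P.center h).asIdeal.primeCompl
  have : Algebra.EssFiniteType O P.ring :=
    Algebra.EssFiniteType.of_isLocalization _ (P.center h).asIdeal.primeCompl
  exact Ideal.ramificationIdx_eq_one _ _

lemma inertiaDeg_eq_one_of_center (h : ∀ a : O, algebraMap O F a ∈ P.ring) :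
    letI := P.algebraOfLe h
    (IsLocalRing.maximalIdeal P.ring).inertiaDeg O = 1 := by
  let := P.algebraOfLe h
  have := P.isLocalization_center h
  have : (P.center h).asIdeal.IsMaximal := (P.center h).isMaximal
  have : (IsLocalRing.maximalIdeal P.ring).LiesOver (P.center h).asIdeal := ⟨rfl⟩
  rw [Ideal.inertiaDeg_eq_of_isMaximal (P.center h).asIdeal]
  have hb : Function.Bijective (Algebra.linearMap (O ⧸ (P.center h).asIdeal)
      (P.ring ⧸ IsLocalRing.maximalIdeal P.ring)) := by
    convert (IsLocalization.AtPrime.equivQuotMaximalIdeal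
      (P.center h).asIdeal P.ring).bijective using 1
    ext x
    obtain ⟨x, rfl⟩ := Ideal.Quotient.mk_surjective x
    rw [IsLocalization.AtPrime.equivQuotMaximalIdeal_apply_mk]
    rfl
  rw [← (LinearEquiv.ofBijective _ hb).finrank_eq, Module.finrank_self]

end Center

end Place

/-! ### Places above a given place, and the fundamental identity. -/

namespace Place

variable {F E : Type*} [Field F] [Field E] [Algebra F E]

lemma mem_above {p : Place F} {P : Place E} (h : P ∈ p.above E) (x : F) :
    algebraMap F E x ∈ P.ring ↔ x ∈ p.ring := by
  rw [← ValuationSubring.mem_comap]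
  exact SetLike.ext_iff.1 h x

lemma algebraMap_mem_nonunits {p : Place F} {P : Place E} (h : P ∈ p.above E) (x : F) :
    algebraMap F E x ∈ P.ring.nonunits ↔ x ∈ p.ring.nonunits := by
  rw [ValuationSubring.mem_nonunits_iff_or, ValuationSubring.mem_nonunits_iff_or, ← map_inv₀,
    mem_above h, map_eq_zero]

instance (P : Place E) : IsScalarTower (P.ring.comap (algebraMap F E)) P.ring E :=
  IsScalarTower.of_algebraMap_eq (fun _ => rfl)

instance (P : Place E) : FaithfulSMul (P.ring.comap (algebraMap F E)) P.ring := by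
  rw [faithfulSMul_iff_algebraMap_injective]
  intro x y h
  exact Subtype.ext ((algebraMap F E).injective (congrArg Subtype.val h))

lemma liesOver_above {p : Place F} {P : Place E} (h : P ∈ p.above E) :
    letI := h.symm ▸ p.isDVR
    (IsLocalRing.maximalIdeal P.ring).LiesOver
      (IsLocalRing.maximalIdeal (P.ring.comap (algebraMap F E))) := by
  obtain ⟨R, hR⟩ := p
  change _ = R at h
  subst h
  refine ⟨?_⟩
  ext x
  rw [Ideal.mem_comap, ← ValuationSubring.coe_mem_nonunits_iff,
    ← ValuationSubring.coe_mem_nonunits_iff]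
  exact (algebraMap_mem_nonunits (p := ⟨_, hR⟩) (P := P) rfl x).symm

lemma ord_algebraMap {p : Place F} {P : Place E} (h : P ∈ p.above E) (x : F) :
    P.ord (algebraMap F E x) = P.e F * p.ord x := by
  have hl := liesOver_above h
  obtain ⟨R, hR⟩ := p
  change _ = R at h
  subst h
  have := (P.prime.isPrime)
  have : P.prime.asIdeal.LiesOver (IsDiscreteValuationRing.maximalIdeal
    (P.ring.comap (algebraMap F E))).asIdeal := hl
  have h1 : (IsDiscreteValuationRing.maximalIdeal
      (P.ring.comap (algebraMap F E))).asIdeal.ramificationIdx' P.prime.asIdeal = P.e F :=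
    Ideal.ramificationIdx'_eq_ramificationIdx _ _
      (IsDiscreteValuationRing.maximalIdeal (P.ring.comap (algebraMap F E))).ne_bot
  rw [ord_def, ← IsDedekindDomain.HeightOneSpectrum.valuation_liesOver E
    (IsDiscreteValuationRing.maximalIdeal (P.ring.comap (algebraMap F E))) P.prime, h1,
    WithZero.log_pow, ord_def]
  simp

section Tower

variable {O₁ O₂ : Type*} [CommRing O₁] [CommRing O₂] [IsDedekindDomain O₁] [IsDedekindDomain O₂]
  [Algebra O₁ F] [IsFractionRing O₁ F] [Algebra O₂ E] [IsFractionRing O₂ E] [Algebra O₁ O₂]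
  [Algebra O₁ E] [IsScalarTower O₁ O₂ E] [IsScalarTower O₁ F E]

lemma center_liesOver {p : Place F} {P : Place E} (h : P ∈ p.above E)
    (hp : ∀ a : O₁, algebraMap O₁ F a ∈ p.ring) (hP : ∀ a : O₂, algebraMap O₂ E a ∈ P.ring) :
    (P.center hP).asIdeal.LiesOver (p.center hp).asIdeal := by
  refine ⟨?_⟩
  ext a
  rw [Ideal.mem_comap, mem_center, mem_center, ← algebraMap_mem_nonunits h,
    ← IsScalarTower.algebraMap_apply, ← IsScalarTower.algebraMap_apply]

/-- Multiplicativity is applied to the two towers `O₁ → 𝒪_𝔭 → 𝒪_𝔓` and `O₁ → O₂ → 𝒪_𝔓`; the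
localization steps contribute 1. -/
lemma ramificationIdx_center {p : Place F} {P : Place E} (h : P ∈ p.above E)
    (hp : ∀ a : O₁, algebraMap O₁ F a ∈ p.ring) (hP : ∀ a : O₂, algebraMap O₂ E a ∈ P.ring) :
    (P.center hP).asIdeal.ramificationIdx O₁ = P.e F ∧
    (P.center hP).asIdeal.inertiaDeg O₁ = P.f F := by
  have hl := liesOver_above h
  have hE : ∀ a : O₁, algebraMap O₁ E a ∈ P.ring := fun a => by
    rw [IsScalarTower.algebraMap_apply O₁ F E, mem_above h]; exact hp a
  obtain ⟨R, hR⟩ := p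
  change _ = R at h
  subst h
  let p : Place F := ⟨P.ring.comap (algebraMap F E), hR⟩
  have e1 := p.ramificationIdx_eq_one_of_center hp
  have f1 := p.inertiaDeg_eq_one_of_center hp
  have e2 := P.ramificationIdx_eq_one_of_center hP
  have f2 := P.inertiaDeg_eq_one_of_center hP
  let := p.algebraOfLe hp
  let := P.algebraOfLe hP
  let := P.algebraOfLe hE
  have hcl : (IsLocalRing.maximalIdeal P.ring).LiesOver (P.center hP).asIdeal := ⟨rfl⟩
  have : IsScalarTower O₁ p.ring P.ring := IsScalarTower.of_algebraMap_eq fun a =>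
    Subtype.ext (IsScalarTower.algebraMap_apply O₁ F E a)
  have : IsScalarTower O₁ O₂ P.ring := IsScalarTower.of_algebraMap_eq fun a =>
    Subtype.ext (IsScalarTower.algebraMap_apply O₁ O₂ E a)
  have : FaithfulSMul O₂ P.ring := by
    rw [faithfulSMul_iff_algebraMap_injective]
    intro x y h
    exact IsFractionRing.injective O₂ E (congrArg Subtype.val h)
  have := liesOver_above (p := p) (P := P) rfl
  constructor
  · have t1 := Ideal.ramificationIdx_tower (R := O₁) (S := P.ring.comap (algebraMap F E))
      (IsLocalRing.maximalIdeal _) (IsLocalRing.maximalIdeal P.ring)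
    have t2 := Ideal.ramificationIdx_tower (R := O₁)
      (P.center hP).asIdeal (IsLocalRing.maximalIdeal P.ring)
    rw [e2, mul_one] at t2
    rw [← t2, t1]
    exact (congrArg (· * P.e F) e1).trans (one_mul _)
  · have t1 := Ideal.inertiaDeg_tower (R := O₁) (S := P.ring.comap (algebraMap F E))
      (IsLocalRing.maximalIdeal _) (IsLocalRing.maximalIdeal P.ring)
    have t2 := Ideal.inertiaDeg_tower (R := O₁)
      (P.center hP).asIdeal (IsLocalRing.maximalIdeal P.ring)
    rw [f2, mul_one] at t2
    rw [← t2, t1]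
    exact (congrArg (· * P.f F) f1).trans (one_mul _)

omit [IsDedekindDomain O₁] [IsDedekindDomain O₂] [IsFractionRing O₁ F] [IsFractionRing O₂ E] in
lemma algebraMap_mem_of_above [Algebra.IsIntegral O₁ O₂] {p : Place F} {P : Place E}
    (h : P ∈ p.above E) (hp : ∀ a : O₁, algebraMap O₁ F a ∈ p.ring) (a : O₂) :
    algebraMap O₂ E a ∈ P.ring := by
  have hE : ∀ a : O₁, algebraMap O₁ E a ∈ P.ring := fun a => by
    rw [IsScalarTower.algebraMap_apply O₁ F E, mem_above h]; exact hp a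
  have : IsIntegral P.ring (algebraMap O₂ E a) := by
    let := P.algebraOfLe hE
    have : IsScalarTower O₁ P.ring E := IsScalarTower.of_algebraMap_eq fun a => rfl
    exact ((Algebra.IsIntegral.isIntegral (R := O₁) a).map
      (IsScalarTower.toAlgHom O₁ O₂ E)).tower_top
  obtain ⟨b, hb⟩ := IsIntegrallyClosed.isIntegral_iff.1 this
  exact hb ▸ b.2

lemma ofPrime_mem_above {p : Place F} (hp : ∀ a : O₁, algebraMap O₁ F a ∈ p.ring)
    (v : IsDedekindDomain.HeightOneSpectrum O₂) [hv : v.asIdeal.LiesOver (p.center hp).asIdeal] :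
    ofPrime v ∈ p.above E := by
  have key : ∀ a : O₁, a ∈ (p.center hp).asIdeal ↔
      algebraMap O₁ E a ∈ (ofPrime (F := E) v).ring.nonunits := fun a => by
    rw [hv.over, Ideal.mem_comap, IsScalarTower.algebraMap_apply O₁ O₂ E,
      ← mem_center _ (mem_ofPrime v), center_ofPrime]
  refine (ValuationSubring.eq_of_le_of_ne_top _ ?_ ?_).symm
  · intro x hx
    rw [← p.valuationSubringAtPrime_center hp] at hx
    obtain ⟨a, s, hs, rfl⟩ := hx
    have h1 : s ∉ (p.center hp).asIdeal := hs
    rw [key, ValuationSubring.mem_nonunits_iff_or] at h1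
    push Not at h1
    rw [ValuationSubring.mem_comap, map_mul, map_inv₀, ← IsScalarTower.algebraMap_apply,
      ← IsScalarTower.algebraMap_apply, IsScalarTower.algebraMap_apply O₁ O₂ E]
    exact mul_mem (mem_ofPrime v _) h1.2
  · obtain ⟨a, ha, ha0⟩ := Submodule.exists_mem_ne_zero_of_ne_bot (p.center hp).ne_bot
    rw [key, ValuationSubring.mem_nonunits_iff_or] at ha
    intro htop
    have h2 : (algebraMap O₁ F a)⁻¹ ∈ (ofPrime (F := E) v).ring.comap (algebraMap F E) :=
      htop ▸ ValuationSubring.mem_top _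
    rw [ValuationSubring.mem_comap, map_inv₀, ← IsScalarTower.algebraMap_apply] at h2
    refine ha.elim (fun h0 => ha0 ?_) (fun h => h h2)
    rw [IsScalarTower.algebraMap_apply O₁ F E, map_eq_zero] at h0
    exact IsFractionRing.injective O₁ F (h0.trans (map_zero _).symm)

variable (E O₂) in
/-- The places above `p` correspond to the primes above the centre of `p`. -/
noncomputable def aboveEquiv [Algebra.IsIntegral O₁ O₂] (p : Place F)
    (hp : ∀ a : O₁, algebraMap O₁ F a ∈ p.ring) [Module.IsTorsionFree O₁ O₂] :
    p.above E ≃ (p.center hp).asIdeal.primesOver O₂ where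
  toFun P := ⟨(P.1.center fun a : O₂ => algebraMap_mem_of_above P.2 hp a).asIdeal,
    (P.1.center _).isPrime, center_liesOver P.2 hp _⟩
  invFun := fun q =>
    haveI := q.2.2
    ⟨ofPrime (⟨q.1, q.2.1, Ideal.ne_bot_of_liesOver_of_ne_bot (p.center hp).ne_bot q.1⟩ :
      IsDedekindDomain.HeightOneSpectrum O₂), ofPrime_mem_above hp _⟩
  left_inv P := Subtype.ext (center_injective (O := O₂) (mem_ofPrime _)
    (fun a : O₂ => algebraMap_mem_of_above P.2 hp a) (center_ofPrime _))
  right_inv _ := Subtype.ext (congrArg IsDedekindDomain.HeightOneSpectrum.asIdeal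
    (center_ofPrime _))

end Tower

section Sum

/-- The fundamental identity `∑ e f = [E : F]` for the places above `p`. -/
theorem exists_finset_above (p : Place F) (E : Type*) [Field E] [Algebra F E]
    [FiniteDimensional F E] [Algebra.IsSeparable F E] :
    ∃ S : Finset (Place E), (∀ P, P ∈ S ↔ P ∈ p.above E) ∧
      (∀ P ∈ S, 0 < P.e F ∧ 0 < P.f F) ∧ ∑ P ∈ S, P.e F * P.f F = Module.finrank F E := by
  -- The base Dedekind domain is the valuation ring itself. Separability makes its integral closure
  -- finite, hence free of rank `[E : F]`.
  let B := integralClosure p.ring E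
  have hD : IsDedekindDomain B := integralClosure.isDedekindDomain p.ring F E
  have : IsFractionRing B E := integralClosure.isFractionRing_of_finite_extension F E
  have : Module.Finite p.ring B := IsIntegralClosure.finite p.ring F E B
  have hrank : Module.finrank p.ring B = Module.finrank F E :=
    IsIntegralClosure.rank p.ring F E B
  have hp : ∀ a : p.ring, algebraMap p.ring F a ∈ p.ring := fun a => a.2
  let φ := aboveEquiv E B p hp
  have hfin : Finite ((p.center hp).asIdeal.primesOver B) :=
    (Algebra.QuasiFinite.finite_primesOver _).to_subtype
  have : Module.Free p.ring B := IsIntegralClosure.module_free p.ring F E B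
  have : Finite (p.above E) := Finite.of_equiv _ φ.symm
  let := Fintype.ofFinite (p.above E)
  let := Fintype.ofFinite ((p.center hp).asIdeal.primesOver B)
  have key : ∀ P : p.above E, (φ P).1.ramificationIdx p.ring = P.1.e F ∧
      (φ P).1.inertiaDeg p.ring = P.1.f F := fun P => ramificationIdx_center P.2 hp _
  refine ⟨(p.above E).toFinset, by simp, ?_, ?_⟩
  · intro P hP
    rw [Set.mem_toFinset] at hP
    obtain ⟨h1, h2⟩ := key ⟨P, hP⟩
    have := (φ ⟨P, hP⟩).2.1
    rw [← h1, ← h2]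
    exact ⟨Ideal.ramificationIdx_pos _ _, Ideal.inertiaDeg_pos _ _⟩
  · rw [← hrank, ← Ideal.sum_ramification_inertia_eq_finrank (p.center hp).asIdeal B,
      ← Finset.sum_set_coe]
    exact Fintype.sum_equiv φ _ _ fun P => by rw [(key P).1, (key P).2]

end Sum

end Place

/-! ### Counting places and producing them from factors modulo the place. -/

namespace Place

variable {F E : Type*} [Field F] [Field E] [Algebra F E] [FiniteDimensional F E]
  [Algebra.IsSeparable F E]

/-- If lower bounds for the ramification indices and inertia degrees of some places above `p`
already exhaust the degree, these are all places above `p` and the bounds are attained. -/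
theorem signature_of_le {p : Place F} (l : List (Place E × ℕ × ℕ)) (hnd : (l.map Prod.fst).Nodup)
    (hab : ∀ q ∈ l, q.1 ∈ p.above E ∧ 0 < q.2.1 ∧ q.2.1 ≤ q.1.e F ∧ 0 < q.2.2 ∧ q.2.2 ≤ q.1.f F)
    (hn : Module.finrank F E ≤ (l.map fun q => q.2.1 * q.2.2).sum) :
    p.HasSignature E (l.map Prod.snd) ∧ (∀ P, P ∈ p.above E ↔ P ∈ l.map Prod.fst) ∧
      ∀ q ∈ l, q.1.e F = q.2.1 ∧ q.1.f F = q.2.2 := by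
  classical
  obtain ⟨S, hS, hpos, hsum⟩ := p.exists_finset_above E
  have hT : (l.map Prod.fst).toFinset ⊆ S := by
    intro P hP
    rw [List.mem_toFinset, List.mem_map] at hP
    obtain ⟨q, hq, rfl⟩ := hP
    exact (hS _).2 (hab q hq).1
  have hTsum : ∑ P ∈ (l.map Prod.fst).toFinset, P.e F * P.f F =
      (l.map fun q => q.1.e F * q.1.f F).sum := by
    rw [List.sum_toFinset _ hnd, List.map_map]; rfl
  have hle : ∀ q ∈ l, q.2.1 * q.2.2 ≤ q.1.e F * q.1.f F := fun q hq =>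
    Nat.mul_le_mul (hab q hq).2.2.1 (hab q hq).2.2.2.2
  have h1 : (l.map fun q => q.2.1 * q.2.2).sum ≤ (l.map fun q => q.1.e F * q.1.f F).sum :=
    List.sum_le_sum hle
  -- A place missing from the list would add a positive term to a sum that already reaches the
  -- degree.
  have hTS : (l.map Prod.fst).toFinset = S := by
    by_contra hne
    have hlt := Finset.ssubset_iff_subset_ne.2 ⟨hT, hne⟩
    obtain ⟨P, hPS, hPT⟩ := Finset.exists_of_ssubset hlt
    have : ∑ P ∈ (l.map Prod.fst).toFinset, P.e F * P.f F < ∑ P ∈ S, P.e F * P.f F :=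
      Finset.sum_lt_sum_of_subset hT hPS hPT
        (Nat.mul_pos (hpos P hPS).1 (hpos P hPS).2) (fun _ _ _ => Nat.zero_le _)
    omega
  have hall : ∀ P, P ∈ p.above E ↔ P ∈ l.map Prod.fst := fun P => by
    rw [← hS, ← hTS, List.mem_toFinset]
  have heq : ∀ q ∈ l, q.1.e F = q.2.1 ∧ q.1.f F = q.2.2 := by
    intro q hq
    have h2 : q.1.e F * q.1.f F ≤ q.2.1 * q.2.2 := by
      by_contra hlt
      have : (l.map fun q => q.2.1 * q.2.2).sum < (l.map fun q => q.1.e F * q.1.f F).sum :=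
        List.sum_lt_sum _ _ hle ⟨q, hq, not_le.1 hlt⟩
      rw [← hTsum, hTS] at this
      omega
    obtain ⟨-, a1, a2, b1, b2⟩ := hab q hq
    constructor <;> nlinarith
  refine ⟨⟨l.map Prod.fst, hnd, fun P => (hall P).symm, ?_⟩, hall, heq⟩
  rw [List.map_map]
  apply List.map_congr_left
  intro q hq
  exact Prod.ext (heq q hq).1 (heq q hq).2

/-- A valuation ring dominating that of `p` is not the whole field, as it omits the inverse of a
uniformizer. It contains the integral closure of `p.ring`, which is Dedekind, and is therefore
discrete. -/
lemma exists_above_of_valuationSubring {p : Place F} {V : ValuationSubring E}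
    (h : ∀ x ∈ p.ring, algebraMap F E x ∈ V) (h' : ∀ x ∈ p.ring.nonunits,
      algebraMap F E x ∈ V.nonunits) : ∃ P ∈ p.above E, P.ring = V := by
  let B := integralClosure p.ring E
  have hD : IsDedekindDomain B := integralClosure.isDedekindDomain p.ring F E
  have : IsFractionRing B E := integralClosure.isFractionRing_of_finite_extension F E
  obtain ⟨π, hπ, hπ'⟩ := p.exists_ord_eq 1
  have hπm : algebraMap F E π ∈ V.nonunits := h' _ ((p.mem_nonunits_iff hπ).2 (by omega))
  rw [ValuationSubring.mem_nonunits_iff_or, map_eq_zero, ← map_inv₀] at hπm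
  have hV : V.comap (algebraMap F E) ≠ ⊤ := by
    intro htop
    have : π⁻¹ ∈ V.comap (algebraMap F E) := htop ▸ ValuationSubring.mem_top _
    exact hπm.elim hπ (fun h => h this)
  have hVt : V ≠ ⊤ := by
    rintro rfl
    exact hV (by ext; simp)
  have hB : ∀ b : B, algebraMap B E b ∈ V := by
    intro b
    have h1 : IsIntegral p.ring (b : E) := b.2
    let : Algebra p.ring V :=
      ((algebraMap p.ring E).codRestrict V.toSubring fun a => h _ a.2).toAlgebra
    have : IsScalarTower p.ring V E := IsScalarTower.of_algebraMap_eq fun _ => rfl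
    obtain ⟨c, hc⟩ := IsIntegrallyClosed.isIntegral_iff.1 (h1.tower_top (A := V))
    exact (show (b : E) ∈ V from hc ▸ c.2)
  exact ⟨⟨V, isDVR_of_le hVt hB⟩, (ValuationSubring.eq_of_le_of_ne_top _ h hV).symm, rfl⟩

/-- If `w` is a root of the monic irreducible polynomial `g` and `H` is not coprime to `g`
modulo `p`, then `H(w)` vanishes at some place above `p`. -/
theorem exists_above_of_not_isCoprime {p : Place F} {w : E} {g H : p.ring[X]} (hg : g.Monic)
    (hmin : minpoly F w = g.map (algebraMap p.ring F))
    (hH : ¬ IsCoprime (H.map (IsLocalRing.residue p.ring)) (g.map (IsLocalRing.residue p.ring))) :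
    ∃ P ∈ p.above E, w ∈ P.ring ∧ aeval w H ∈ P.ring.nonunits := by
  let φ : p.ring[X] →ₐ[p.ring] (aeval (R := p.ring) w).range := (aeval w).rangeRestrict
  have hφ : Function.Surjective φ := (aeval w).rangeRestrict_surjective
  let J : Ideal p.ring[X] := (IsLocalRing.maximalIdeal p.ring).map C ⊔ Ideal.span {H}
  -- If `𝔭` and `H(w)` generated the unit ideal of `p.ring[w]`, then `1 = m + sH + ug` with `m`
  -- having coefficients in `𝔭`; reduction would make `H` and `g` coprime.
  have hJ : J.map φ ≠ ⊤ := by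
    rw [Ne, Ideal.eq_top_iff_one, Ideal.mem_map_iff_of_surjective _ hφ]
    rintro ⟨j, hj, hj1⟩
    apply hH
    have h0 : aeval w (1 - j) = 0 := by
      rw [map_sub, map_one, sub_eq_zero]; exact (congrArg Subtype.val hj1).symm
    have h1 : g ∣ 1 - j := by
      rw [← map_dvd_map _ (IsFractionRing.injective p.ring F) hg, ← hmin]
      apply minpoly.dvd
      rw [aeval_map_algebraMap, h0]
    obtain ⟨m, hm, t, ht, rfl⟩ := Submodule.mem_sup.1 hj
    obtain ⟨s, rfl⟩ := Ideal.mem_span_singleton'.1 ht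
    obtain ⟨u, hu⟩ := h1
    have hm0 : m.map (IsLocalRing.residue p.ring) = 0 := by
      rw [Ideal.mem_map_C_iff] at hm
      ext n
      rw [coeff_map, coeff_zero, IsLocalRing.residue_eq_zero_iff]
      exact hm n
    refine ⟨s.map (IsLocalRing.residue p.ring), u.map (IsLocalRing.residue p.ring), ?_⟩
    have := congrArg (Polynomial.map (IsLocalRing.residue p.ring)) hu
    simp only [Polynomial.map_sub, Polynomial.map_one, Polynomial.map_add, Polynomial.map_mul,
      hm0, zero_add] at this
    linear_combination -this
  -- Existence of a valuation ring that contains a given ring and has a given proper ideal among its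
  -- nonunits.
  obtain ⟨V, hV1, hV2⟩ := Ideal.image_subset_nonunits_valuationSubring
    (A := (aeval (R := p.ring) w).range.toSubring) (J.map φ) hJ
  have hφV : ∀ j ∈ J, aeval w j ∈ V.nonunits := fun j hj =>
    hV2 ⟨φ j, Ideal.mem_map_of_mem _ hj, rfl⟩
  have hAV : ∀ j : p.ring[X], aeval w j ∈ V := fun j => hV1 (φ j).2
  obtain ⟨P, hP, rfl⟩ := exists_above_of_valuationSubring (p := p) (V := V)
    (fun x hx => by simpa using! hAV (C ⟨x, hx⟩))
    (fun x hx => by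
      have hx' := ValuationSubring.nonunits_subset hx
      have := hφV (C ⟨x, hx'⟩) (Ideal.mem_sup_left (Ideal.mem_map_of_mem _
        (ValuationSubring.coe_mem_nonunits_iff.1 hx)))
      simpa using! this)
  exact ⟨P, hP, by simpa using hAV X, hφV _ (Ideal.mem_sup_right (Ideal.mem_span_singleton_self _))⟩

end Place

open scoped IntermediateField.algebraAdjoinAdjoin

/-! ### Integral closures of `k[x]`, including the inseparable case. -/

section OneVariable

variable {k F : Type*} [Field k] [Field F] [Algebra k F]

lemma isDedekindDomain_adjoin_singleton {x : F} (hx : Transcendental k x) :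
    IsDedekindDomain (Algebra.adjoin k {x}) := by
  let e := Polynomial.algEquivOfTranscendental k x hx
  have : IsPrincipalIdealRing (Algebra.adjoin k {x}) :=
    IsPrincipalIdealRing.of_surjective e e.surjective
  infer_instance

lemma isDedekindDomain_of_ringEquiv {A B : Type*} [CommRing A] [CommRing B] [IsDedekindDomain A]
    (e : A ≃+* B) : IsDedekindDomain B := by
  have : IsDomain B := e.symm.toMulEquiv.isDomain A
  let := e.toRingHom.toAlgebra
  have : IsLocalization (⊥ : Submonoid A) A := IsLocalization.self bot_le
  have : IsLocalization (⊥ : Submonoid A) B :=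
    IsLocalization.isLocalization_of_algEquiv ⊥ (AlgEquiv.ofRingEquiv (f := e) fun _ => rfl)
  exact IsLocalization.isDedekindDomain A (bot_le : (⊥ : Submonoid A) ≤ _) B

lemma integralClosure_eq_of_isIntegral (A B F : Type*) [CommRing A] [CommRing B] [CommRing F]
    [Algebra A B] [Algebra A F] [Algebra B F] [IsScalarTower A B F] [Algebra.IsIntegral A B] :
    (integralClosure B F).toSubring = (integralClosure A F).toSubring := by
  ext a
  exact ⟨fun h => isIntegral_trans (R := A) a h, fun h => IsIntegral.tower_top (R := A) h⟩

lemma integralClosure_eq_of_le {A B : Subalgebra k F} (hle : A ≤ B)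
    (hint : ∀ b ∈ B, IsIntegral A b) :
    (integralClosure B F).toSubring = (integralClosure A F).toSubring := by
  let := (Subalgebra.inclusion hle).toAlgebra
  have : IsScalarTower A B F := IsScalarTower.of_algebraMap_eq fun _ => rfl
  have : Algebra.IsIntegral A B :=
    ⟨fun a => (isIntegral_algHom_iff (IsScalarTower.toAlgHom A B F)
      Subtype.val_injective).1 (hint a a.2)⟩
  exact integralClosure_eq_of_isIntegral A B F

lemma isIntegral_of_mem_adjoin {A : Subalgebra k F} {t : F} (ht : IsIntegral A t) :
    ∀ a ∈ Algebra.adjoin k {t}, IsIntegral A a := by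
  intro a ha
  induction ha using Algebra.adjoin_induction with
  | mem y hy => rw [Set.mem_singleton_iff] at hy; exact hy ▸ ht
  | algebraMap r => exact isIntegral_algebraMap (R := A) (A := F) (x := algebraMap k A r)
  | add a b _ _ ha hb => exact ha.add hb
  | mul a b _ _ ha hb => exact ha.mul hb

lemma isIntegral_of_pow_mem {A : Subalgebra k F} {t : F} {n : ℕ} (hn : n ≠ 0) (ht : t ^ n ∈ A) :
    IsIntegral A t :=
  IsIntegral.of_pow (Nat.pos_of_ne_zero hn)
    (isIntegral_algebraMap (R := A) (A := F) (x := ⟨t ^ n, ht⟩))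

lemma integralClosure_adjoin_eq_of_pow {t : F} {n : ℕ} (hn : n ≠ 0) :
    (integralClosure (Algebra.adjoin k {t}) F).toSubring =
      (integralClosure (Algebra.adjoin k {t ^ n}) F).toSubring :=
  integralClosure_eq_of_le
    (Algebra.adjoin_singleton_le (pow_mem (Algebra.self_mem_adjoin_singleton k t) n))
    (isIntegral_of_mem_adjoin
      (isIntegral_of_pow_mem hn (Algebra.self_mem_adjoin_singleton k (t ^ n))))

lemma essFiniteType_of_finiteDimensional_adjoin (x : F) [FiniteDimensional k⟮x⟯ F] :
    Algebra.EssFiniteType k F := by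
  have : Algebra.EssFiniteType k k⟮x⟯ :=
    IntermediateField.essFiniteType_iff.2 (IntermediateField.fg_adjoin_of_finite (Set.finite_singleton x))
  exact Algebra.EssFiniteType.comp k k⟮x⟯ F

lemma isTranscendenceBasis_of_isAlgebraic_adjoin {x : F} (hx : Transcendental k x)
    [Algebra.IsAlgebraic k⟮x⟯ F] : IsTranscendenceBasis k (fun _ : Unit => x) := by
  rw [isTranscendenceBasis_iff_algebraicIndependent_isAlgebraic,
    algebraicIndependent_unique_type_iff]
  refine ⟨hx, ?_⟩
  rw [Set.range_const]
  exact IsFractionRing.comap_isAlgebraic_iff (K := k⟮x⟯).2 inferInstance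

/-- A function field in one variable is finite over `k(x)` for every transcendental `x`. -/
theorem finiteDimensional_adjoin_of_transcendental {t x : F} (ht : Transcendental k t)
    [FiniteDimensional k⟮t⟯ F] (hx : Transcendental k x) : FiniteDimensional k⟮x⟯ F := by
  have hbt := isTranscendenceBasis_of_isAlgebraic_adjoin ht
  have hx' : AlgebraicIndependent k (fun _ : Unit => x) := by
    rwa [algebraicIndependent_unique_type_iff]
  -- The transcendence degree is 1, so a single transcendental element is already a transcendence
  -- basis.
  have hbx := hx'.isTranscendenceBasis_of_lift_trdeg_le_of_finite
    (by rw [← hbt.lift_cardinalMk_eq_trdeg])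
  have := hbx.isAlgebraic_field
  rw [Set.range_const] at this
  have := essFiniteType_of_finiteDimensional_adjoin (k := k) t
  have : Algebra.EssFiniteType k⟮x⟯ F := Algebra.EssFiniteType.of_comp k k⟮x⟯ F
  exact Algebra.finite_of_essFiniteType_of_isAlgebraic

variable (p : ℕ) [hp : Fact p.Prime] [CharP F p]

omit [CharP F p] in
lemma finrank_adjoin_simple_le (E : Subfield F) (t : F) (ht : t ^ p ∈ E) :
    IsIntegral E t ∧ Module.finrank E E⟮t⟯ ≤ p := by
  have hm : (X ^ p - C (⟨t ^ p, ht⟩ : E)).Monic := monic_X_pow_sub_C _ hp.out.ne_zero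
  have h0 : aeval t (X ^ p - C (⟨t ^ p, ht⟩ : E)) = 0 := by
    rw [map_sub, map_pow, aeval_X, aeval_C]; exact sub_self _
  have hi : IsIntegral E t := ⟨_, hm, h0⟩
  refine ⟨hi, ?_⟩
  rw [adjoin.finrank hi]
  exact (natDegree_le_of_dvd (minpoly.dvd _ _ h0) hm.ne_zero).trans
    (natDegree_X_pow_sub_C).le

lemma finrank_adjoin_simple_eq {x : F} (hx : x ∉ (frobenius F p).fieldRange) :
    Module.finrank (frobenius F p).fieldRange (frobenius F p).fieldRange⟮x⟯ = p := by
  set E := (frobenius F p).fieldRange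
  have ht : x ^ p ∈ E := ⟨x, rfl⟩
  have hirr : Irreducible (X ^ p - C (⟨x ^ p, ht⟩ : E)) := by
    refine X_pow_sub_C_irreducible_of_prime hp.out fun b hb => hx ?_
    have h1 : frobenius F p b = frobenius F p x := congrArg Subtype.val hb
    rw [← frobenius_inj F p h1]
    exact b.2
  have h0 : aeval x (X ^ p - C (⟨x ^ p, ht⟩ : E)) = 0 := by
    rw [map_sub, map_pow, aeval_X, aeval_C]; exact sub_self _
  rw [adjoin.finrank (finrank_adjoin_simple_le p E x ht).1,
    ← minpoly.eq_of_irreducible_of_monic hirr h0 (monic_X_pow_sub_C _ hp.out.ne_zero),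
    natDegree_X_pow_sub_C]

variable [PerfectField k]

include hp in
lemma algebraMap_mem_fieldRange_frobenius (a : k) :
    algebraMap k F a ∈ (frobenius F p).fieldRange := by
  have : CharP k p := (algebraMap k F).charP (algebraMap k F).injective p
  obtain ⟨b, rfl⟩ := surjective_frobenius k p a
  exact ⟨algebraMap k F b, by simp [frobenius_def]⟩

/-- A separable extension `F` of `k(t)` is generated by its `p`-th powers. As `k` is perfect, its
elements are `p`-th powers too, so `F = Fᵖ(t)`. -/
lemma adjoin_fieldRange_eq_top {t : F} [Algebra.IsSeparable k⟮t⟯ F] :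
    (frobenius F p).fieldRange⟮t⟯ = ⊤ := by
  set E := (frobenius F p).fieldRange
  have h1 : (E⟮t⟯.toSubfield : Set F) = Set.univ := by
    let T₀ : IntermediateField k F :=
      { E⟮t⟯.toSubfield with
        algebraMap_mem' := fun a => E⟮t⟯.algebraMap_mem
          ⟨_, algebraMap_mem_fieldRange_frobenius p a⟩ }
    have hT₀ : k⟮t⟯ ≤ T₀ := by
      rw [adjoin_simple_le_iff]
      exact mem_adjoin_simple_self E t
    let T : IntermediateField k⟮t⟯ F :=
      { E⟮t⟯.toSubfield with algebraMap_mem' := fun a => hT₀ a.2 }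
    have : CharP k⟮t⟯ p :=
      (algebraMap k⟮t⟯ F).charP (algebraMap k⟮t⟯ F).injective p
    have hT : T = ⊤ := by
      rw [eq_top_iff, ← IntermediateField.adjoin_univ,
        adjoin_eq_adjoin_pow_expChar_of_isSeparable' k⟮t⟯ F Set.univ p, adjoin_le_iff]
      rintro _ ⟨a, -, rfl⟩
      exact E⟮t⟯.algebraMap_mem ⟨a ^ p, a, rfl⟩
    ext y
    simp only [Set.mem_univ, iff_true]
    have : y ∈ T := hT ▸ mem_top
    exact this
  rw [eq_top_iff]
  intro y _
  have : y ∈ (E⟮t⟯.toSubfield : Set F) := h1 ▸ Set.mem_univ y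
  exact this

omit [PerfectField k] in
-- The universal `k(x)`-derivation kills `x` and all `p`-th powers, hence all of `F`. So the
-- differentials vanish, and the extension is formally unramified, that is, separable.
lemma isSeparable_of_adjoin_fieldRange_eq_top {x : F} [FiniteDimensional k⟮x⟯ F]
    (h : (frobenius F p).fieldRange⟮x⟯ = ⊤) : Algebra.IsSeparable k⟮x⟯ F := by
  rw [← Algebra.FormallyUnramified.iff_isSeparable, Algebra.formallyUnramified_iff]
  set D := KaehlerDifferential.D k⟮x⟯ F
  set E := (frobenius F p).fieldRange
  have hDp : ∀ a ∈ E, D a = 0 := by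
    rintro _ ⟨a, rfl⟩
    rw [frobenius_def, Derivation.leibniz_pow, ← Nat.cast_smul_eq_nsmul F, CharP.cast_eq_zero,
      zero_smul]
  have hD : ∀ y : F, D y = 0 := by
    have hx : IsIntegral E x := (finrank_adjoin_simple_le p E x ⟨x, rfl⟩).1
    intro y
    have hy : y ∈ E⟮x⟯.toSubalgebra := by rw [h]; exact mem_top (F := E)
    rw [adjoin_simple_toSubalgebra_of_isAlgebraic hx.isAlgebraic] at hy
    induction hy using Algebra.adjoin_induction with
    | mem y hy =>
      rw [Set.mem_singleton_iff] at hy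
      subst hy
      exact D.map_algebraMap (⟨y, mem_adjoin_simple_self k y⟩ : k⟮y⟯)
    | algebraMap r => exact hDp _ r.2
    | add a b _ _ ha hb => rw [map_add, ha, hb, add_zero]
    | mul a b _ _ ha hb => rw [Derivation.leibniz, ha, hb, smul_zero, smul_zero, add_zero]
  rw [← Submodule.subsingleton_iff F, ← subsingleton_iff_bot_eq_top,
    ← KaehlerDifferential.span_range_derivation, eq_comm, Submodule.span_eq_bot]
  rintro _ ⟨y, rfl⟩
  exact hD y

/-- In a function field in one variable over a perfect field, an element which is not a `p`-th
power is separating. -/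
theorem isSeparable_adjoin_of_not_mem_fieldRange {x : F} (ht : Transcendental k x)
    [FiniteDimensional k⟮x⟯ F] (hx : x ∉ (frobenius F p).fieldRange) :
    Algebra.IsSeparable k⟮x⟯ F := by
  have := essFiniteType_of_finiteDimensional_adjoin (k := k) x
  obtain ⟨s, hs, hsep⟩ := exists_isTranscendenceBasis_and_isSeparable_of_perfectField k F
  have hcard := (isTranscendenceBasis_of_isAlgebraic_adjoin ht).lift_cardinalMk_eq hs
  have hcard : s.card = 1 := by simpa using hcard.symm
  obtain ⟨t, rfl⟩ := Finset.card_eq_one.1 hcard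
  rw [Finset.coe_singleton] at hsep
  apply isSeparable_of_adjoin_fieldRange_eq_top p
  -- The separating element `t` shows `[F : Fᵖ] ≤ p`, while `x ∉ Fᵖ` has degree exactly `p` over
  -- `Fᵖ`; hence `Fᵖ(x) = F`.
  have htop : (frobenius F p).fieldRange⟮t⟯ = ⊤ := adjoin_fieldRange_eq_top (k := k) p
  obtain ⟨hi, hle⟩ := finrank_adjoin_simple_le p (frobenius F p).fieldRange t ⟨t, rfl⟩
  have hfin := adjoin.finiteDimensional hi
  rw [htop] at hle hfin
  refine eq_of_le_of_finrank_le le_top ?_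
  rwa [finrank_adjoin_simple_eq p hx]

omit [PerfectField k] [CharP F p] in
-- Raising `t = r(tᵖ)/s(tᵖ)` to the `p`-th power gives the polynomial identity `X·sᵖ = rᵖ`, whose
-- degrees differ modulo `p`.
lemma pow_not_mem_adjoin {t : F} (ht : Transcendental k (t ^ p)) : t ∉ k⟮t ^ p⟯ := by
  rw [mem_adjoin_simple_iff]
  rintro ⟨r, s, h⟩
  have hs : aeval (t ^ p) s ≠ 0 := by
    intro h0
    rw [h0, div_zero] at h
    apply ht
    rw [h, zero_pow hp.out.ne_zero]
    exact isAlgebraic_zero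
  have h1 : aeval (t ^ p) (X * s ^ p - r ^ p) = 0 := by
    have h2 : t * aeval (t ^ p) s = aeval (t ^ p) r := by
      rw [eq_div_iff hs] at h; exact h
    rw [map_sub, map_mul, map_pow, map_pow, aeval_X, ← h2, mul_pow, sub_self]
  have h3 : X * s ^ p = r ^ p := sub_eq_zero.1 ((transcendental_iff.1 ht) _ h1)
  have hs0 : s ≠ 0 := by rintro rfl; simp at hs
  have h4 := congrArg natDegree h3
  rw [natDegree_X_mul (pow_ne_zero _ hs0), natDegree_pow, natDegree_pow] at h4
  have : p ∣ 1 := (Nat.dvd_add_right (Dvd.intro _ rfl)).1 (Dvd.intro _ h4.symm)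
  exact hp.out.one_lt.ne' (Nat.dvd_one.1 this)

include hp in
/-- The integral closure of `k[x]` in a function field in one variable over a perfect field is a
Dedekind domain, even if the function field is inseparable over `k(x)`. -/
theorem isDedekindDomain_integralClosure_adjoin {x : F} (hx : Transcendental k x)
    [hfin : FiniteDimensional k⟮x⟯ F] :
    IsDedekindDomain (integralClosure (Algebra.adjoin k {x}) F) := by
  by_cases hmem : x ∈ (frobenius F p).fieldRange
  -- For `x = tᵖ` the rings `k[x]` and `k[t]` have the same integral closure, and `[F : k(t)] < [F :
  -- k(x)]`, so the recursion terminates at an `x` that is not a `p`-th power and is therefore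
  -- separating.
  · obtain ⟨t, rfl⟩ := hmem
    rw [frobenius_def] at hx hfin ⊢
    have ht : Transcendental k t := fun h => hx (h.pow p)
    have hle : k⟮t ^ p⟯ < k⟮t⟯ := by
      refine lt_of_le_of_ne ?_ fun h => pow_not_mem_adjoin p hx (h ▸ mem_adjoin_simple_self k t)
      rw [adjoin_simple_le_iff]
      exact pow_mem (mem_adjoin_simple_self k t) p
    have hft : FiniteDimensional k⟮t⟯ F := finiteDimensional_adjoin_of_transcendental hx ht
    have hlt : Module.finrank k⟮t⟯ F < Module.finrank k⟮t ^ p⟯ F := by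
      rw [← relfinrank_mul_finrank_top hle.le]
      have h0 : 0 < Module.finrank k⟮t⟯ F := Module.finrank_pos
      have h1 : relfinrank k⟮t ^ p⟯ k⟮t⟯ ≠ 1 := fun h => hle.not_ge (relfinrank_eq_one_iff.1 h)
      have h2 : relfinrank k⟮t ^ p⟯ k⟮t⟯ ≠ 0 := fun h => by
        have := relfinrank_mul_finrank_top hle.le
        rw [h, zero_mul] at this
        exact Module.finrank_pos.ne this
      have h3 : 2 ≤ relfinrank k⟮t ^ p⟯ k⟮t⟯ := by omega
      nlinarith
    have IH := isDedekindDomain_integralClosure_adjoin (x := t) ht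
    have hle' : Algebra.adjoin k {t ^ p} ≤ Algebra.adjoin k {t} :=
      Algebra.adjoin_singleton_le (pow_mem (Algebra.self_mem_adjoin_singleton k t) p)
    have heq : (integralClosure (Algebra.adjoin k {t}) F).toSubring =
        (integralClosure (Algebra.adjoin k {t ^ p}) F).toSubring :=
      integralClosure_adjoin_eq_of_pow hp.out.ne_zero
    exact isDedekindDomain_of_ringEquiv (RingEquiv.subringCongr heq)
  · have := isSeparable_adjoin_of_not_mem_fieldRange p hx hmem
    have := isDedekindDomain_adjoin_singleton hx
    exact integralClosure.isDedekindDomain _ k⟮x⟯ F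
termination_by Module.finrank k⟮x⟯ F

end OneVariable

/-! ### The rings `𝒪_{F,x}`. -/

section HolRing

variable {k K : Type*} [Field k] [Field K] [Algebra k K] {x : K}
  (F : Type*) [Field F] [Algebra K F]

lemma isFractionRing_holRing [FiniteDimensional k⟮x⟯ K] [FiniteDimensional K F] :
    IsFractionRing (holRing k x F) F := by
  have : Algebra.IsAlgebraic (Algebra.adjoin k {x}) K :=
    IsFractionRing.comap_isAlgebraic_iff (K := k⟮x⟯).2 inferInstance
  have : Algebra.IsAlgebraic (Algebra.adjoin k {x}) F := Algebra.IsAlgebraic.trans _ K _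
  refine integralClosure.isFractionRing_of_algebraic fun a ha => ?_
  rw [IsScalarTower.algebraMap_apply _ K F, map_eq_zero] at ha
  exact Subtype.ext ha

include K in
lemma finiteDimensional_adjoin_algebraMap [Algebra k F] [IsScalarTower k K F]
    [FiniteDimensional k⟮x⟯ K] [FiniteDimensional K F] :
    FiniteDimensional k⟮algebraMap K F x⟯ F := by
  have h : ∀ a : k⟮x⟯, algebraMap K F a ∈ k⟮algebraMap K F x⟯ := fun a => by
    have h1 := IntermediateField.adjoin_map k {x} (IsScalarTower.toAlgHom k K F)
    rw [Set.image_singleton] at h1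
    exact h1.le ⟨a, a.2, rfl⟩
  let : Algebra k⟮x⟯ k⟮algebraMap K F x⟯ :=
    ((algebraMap k⟮x⟯ F).codRestrict k⟮algebraMap K F x⟯.toSubring h).toAlgebra
  have : IsScalarTower k⟮x⟯ k⟮algebraMap K F x⟯ F := IsScalarTower.of_algebraMap_eq fun _ => rfl
  have : FiniteDimensional k⟮x⟯ F := FiniteDimensional.trans _ K _
  exact Module.Finite.of_restrictScalars_finite k⟮x⟯ k⟮algebraMap K F x⟯ F

/-- The ring `𝒪_{F,x}` is a Dedekind domain. -/
theorem isDedekindDomain_holRing (p : ℕ) [hp : Fact p.Prime] [CharP k p] [PerfectField k]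
    (hx : Transcendental k x) [FiniteDimensional k⟮x⟯ K] [FiniteDimensional K F] :
    IsDedekindDomain (holRing k x F) := by
  let : Algebra k F := ((algebraMap K F).comp (algebraMap k K)).toAlgebra
  have : IsScalarTower k K F := IsScalarTower.of_algebraMap_eq fun _ => rfl
  have : CharP F p := charP_of_injective_algebraMap (algebraMap k F).injective p
  have := finiteDimensional_adjoin_algebraMap (k := k) (x := x) F
  have hx' : Transcendental k (algebraMap K F x) :=
    (transcendental_algebraMap_iff (algebraMap K F).injective).2 hx
  have hD := isDedekindDomain_integralClosure_adjoin p hx'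
  -- The preceding result concerns `k[x]` inside `F`; it is transferred from the image of `k[x]` to
  -- `k[x] ⊆ K` itself.
  have hmap : (Algebra.adjoin k {x}).map (IsScalarTower.toAlgHom k K F) =
      Algebra.adjoin k {algebraMap K F x} := by
    rw [AlgHom.map_adjoin, Set.image_singleton]; rfl
  have h : ∀ a : Algebra.adjoin k {x}, algebraMap K F a ∈ Algebra.adjoin k {algebraMap K F x} :=
    fun a => hmap.le ⟨a, a.2, rfl⟩
  let : Algebra (Algebra.adjoin k {x}) (Algebra.adjoin k {algebraMap K F x}) :=
    ((algebraMap (Algebra.adjoin k {x}) F).codRestrict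
      (Algebra.adjoin k {algebraMap K F x}).toSubring h).toAlgebra
  have : IsScalarTower (Algebra.adjoin k {x}) (Algebra.adjoin k {algebraMap K F x}) F :=
    IsScalarTower.of_algebraMap_eq fun _ => rfl
  have hint : Algebra.IsIntegral (Algebra.adjoin k {x}) (Algebra.adjoin k {algebraMap K F x}) := by
    refine ⟨fun b => ?_⟩
    obtain ⟨a, ha, hab⟩ := hmap.ge b.2
    have : b = algebraMap (Algebra.adjoin k {x}) _ ⟨a, ha⟩ := Subtype.ext hab.symm
    rw [this]
    exact isIntegral_algebraMap
  exact isDedekindDomain_of_ringEquiv (RingEquiv.subringCongr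
    (integralClosure_eq_of_isIntegral (Algebra.adjoin k {x})
      (Algebra.adjoin k {algebraMap K F x}) F))

end HolRing

namespace Place

/-! ### Constants and integrality at a place. -/

section Const

variable {k K : Type*} [Field k] [Finite k] [Field K] [Algebra k K] (p : Place K)

lemma algebraMap_mem (a : k) : algebraMap k K a ∈ p.ring := by
  rcases eq_or_ne a 0 with rfl | ha
  · rw [map_zero]; exact zero_mem _
  have := Fintype.ofFinite k
  apply p.mem_ring_of_ord
  -- A nonzero constant is a root of unity, so its order is 0.
  have h : p.ord ((algebraMap k K a) ^ (Fintype.card k - 1)) = 0 := by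
    rw [← map_pow, FiniteField.pow_card_sub_one_eq_one a ha, map_one, ord_one]
  rw [ord_pow] at h
  have : Fintype.card k - 1 ≠ 0 := by have := Fintype.one_lt_card (α := k); omega
  have h2 : ((Fintype.card k - 1 : ℕ) : ℤ) ≠ 0 := by exact_mod_cast this
  exact ((mul_eq_zero.1 h).resolve_left h2).ge

lemma adjoin_le {x : K} (hx : x ∈ p.ring) : ∀ a ∈ Algebra.adjoin k {x}, a ∈ p.ring := by
  intro a ha
  induction ha using Algebra.adjoin_induction with
  | mem y hy => rw [Set.mem_singleton_iff] at hy; exact hy ▸ hx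
  | algebraMap r => exact p.algebraMap_mem r
  | add a b _ _ ha hb => exact add_mem ha hb
  | mul a b _ _ ha hb => exact mul_mem ha hb

lemma holRing_le {L : Type*} [Field L] [Algebra K L] {P : Place L} (hP : P ∈ p.above L) {x : K}
    (hx : x ∈ p.ring) (a : holRing k x L) : (a : L) ∈ P.ring := by
  let : Algebra (Algebra.adjoin k {x}) P.ring :=
    ((algebraMap (Algebra.adjoin k {x}) L).codRestrict P.ring.toSubring
      fun a => (mem_above hP a.1).2 (p.adjoin_le hx a a.2)).toAlgebra
  have : IsScalarTower (Algebra.adjoin k {x}) P.ring L := IsScalarTower.of_algebraMap_eq fun _ => rfl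
  have h1 : IsIntegral (Algebra.adjoin k {x}) (a : L) := a.2
  obtain ⟨c, hc⟩ := IsIntegrallyClosed.isIntegral_iff.1 (h1.tower_top (A := P.ring))
  exact hc ▸ c.2

lemma self_mem_above : p ∈ p.above K := by
  ext; rfl

/-- If `π` were algebraic over `k`, its inverse would be integral over `k` and so lie in the
valuation ring. -/
lemma transcendental_of_ord_pos {π : K} (h : 0 < p.ord π) : Transcendental k π := by
  intro ha
  have hπ : π ≠ 0 := by rintro rfl; simp at h
  let : Algebra k p.ring := ((algebraMap k K).codRestrict p.ring.toSubring p.algebraMap_mem).toAlgebra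
  have : IsScalarTower k p.ring K := IsScalarTower.of_algebraMap_eq fun _ => rfl
  have h1 : IsIntegral k π⁻¹ := ha.isIntegral.inv
  obtain ⟨c, hc⟩ := IsIntegrallyClosed.isIntegral_iff.1 (h1.tower_top (A := p.ring))
  have h2 : π⁻¹ ∈ p.ring := hc ▸ c.2
  rw [p.mem_ring_iff (inv_ne_zero hπ), ord_inv] at h2
  omega

end Const

/-! ### Factorization of the extended ideal. -/

section ExtIdeal

/-- The family `c` keeps `center`, which carries a proof that `O₂` lies in the valuation ring, out
of the product; it is later taken to be `toIdeal`. -/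
theorem map_center_eq_prod {F E : Type*} [Field F] [Field E] [Algebra F E]
    (O₁ O₂ : Type*) [CommRing O₁] [CommRing O₂] [IsDedekindDomain O₁] [IsDedekindDomain O₂]
    [Algebra O₁ F] [IsFractionRing O₁ F] [Algebra O₂ E] [IsFractionRing O₂ E] [Algebra O₁ O₂]
    [Algebra O₁ E] [IsScalarTower O₁ O₂ E] [IsScalarTower O₁ F E] [Algebra.IsIntegral O₁ O₂]
    {p : Place F} (hp : ∀ a : O₁, algebraMap O₁ F a ∈ p.ring) {S : Finset (Place E)}
    (hS : ∀ P, P ∈ S ↔ P ∈ p.above E) (c : Place E → Ideal O₂)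
    (hc : ∀ P ∈ p.above E, ∀ hP : ∀ a : O₂, algebraMap O₂ E a ∈ P.ring,
      c P = (P.center hP).asIdeal) :
    (p.center hp).asIdeal.map (algebraMap O₁ O₂) = ∏ P ∈ S, c P ^ P.e F := by
  have : FaithfulSMul O₁ O₂ := by
    rw [faithfulSMul_iff_algebraMap_injective]
    have h : Function.Injective (algebraMap O₁ E) := by
      rw [IsScalarTower.algebraMap_eq O₁ F E]
      exact (algebraMap F E).injective.comp (IsFractionRing.injective O₁ F)
    rw [IsScalarTower.algebraMap_eq O₁ O₂ E, RingHom.coe_comp] at h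
    exact h.of_comp
  let φ := aboveEquiv E O₂ p hp
  have : (p.center hp).asIdeal.IsMaximal := (p.center hp).isMaximal
  rw [Ideal.map_algebraMap_eq_finsetProd_pow (p.center hp).ne_bot]
  symm
  refine Finset.prod_bij' (fun P hP => (φ ⟨P, (hS P).1 hP⟩).1)
    (fun q hq => (φ.symm ⟨q, Set.mem_toFinset.1 hq⟩).1) (fun P hP => by simp [(φ _).2]) ?_ ?_ ?_ ?_
  · intro q hq; exact (hS _).2 (φ.symm _).2
  · intro P hP; simp
  · intro q hq; simp
  · intro P hP
    have hP' := (hS P).1 hP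
    have h1 : ∀ a : O₂, algebraMap O₂ E a ∈ P.ring := fun a => algebraMap_mem_of_above hP' hp a
    rw [← (ramificationIdx_center hP' hp h1).1, hc P hP' h1]
    rfl

variable {k K L : Type*} [Field k] [Field K] [Algebra k K] {x : K}

lemma toIdeal_eq_center {F : Type*} [Field F] [Algebra K F] [IsDedekindDomain (holRing k x F)]
    [IsFractionRing (holRing k x F) F] (P : Place F)
    (h : ∀ a : holRing k x F, algebraMap (holRing k x F) F a ∈ P.ring) :
    P.toIdeal k x = (P.center h).asIdeal := by
  have : {t : holRing k x F | (t : F) ∈ P.ring.nonunits} = (P.center h).asIdeal := by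
    ext a
    exact (P.mem_center h a).symm
  rw [toIdeal, this, Ideal.span_eq]

variable [Finite k] (ℓ : ℕ) [Fact ℓ.Prime] [CharP k ℓ]
  (hx : Transcendental k x) [FiniteDimensional k⟮x⟯ K]
  [Field L] [Algebra K L] [FiniteDimensional K L]

include ℓ hx in
theorem extIdeal_eq_prod {p : Place K} (hxp : x ∈ p.ring) {S : Finset (Place L)}
    (hS : ∀ P, P ∈ S ↔ P ∈ p.above L) :
    p.extIdeal k x L = ∏ P ∈ S, P.toIdeal k x ^ P.e K := by
  have := isDedekindDomain_holRing K ℓ hx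
  have := isDedekindDomain_holRing L ℓ hx
  have : IsFractionRing (holRing k x K) K := isFractionRing_holRing (k := k) (x := x) K
  have : IsFractionRing (holRing k x L) L := isFractionRing_holRing (k := k) (x := x) L
  let : Algebra (holRing k x K) (holRing k x L) := (holRingMap k x L).toRingHom.toAlgebra
  have : IsScalarTower (holRing k x K) (holRing k x L) L :=
    IsScalarTower.of_algebraMap_eq fun _ => rfl
  have : IsScalarTower (Algebra.adjoin k {x}) (holRing k x K) (holRing k x L) :=
    IsScalarTower.of_algebraMap_eq fun a => ((holRingMap k x L).commutes a).symm
  have : Algebra.IsIntegral (holRing k x K) (holRing k x L) := Algebra.IsIntegral.tower_top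
    (Algebra.adjoin k {x})
  have hp : ∀ a : holRing k x K, algebraMap (holRing k x K) K a ∈ p.ring :=
    p.holRing_le p.self_mem_above hxp
  rw [extIdeal, p.toIdeal_eq_center hp]
  exact map_center_eq_prod (holRing k x K) (holRing k x L) hp hS _
    fun P _ h => P.toIdeal_eq_center h

include ℓ hx in
-- Unique factorization of ideals, with distinct places giving distinct primes. Multisets of places
-- treat all the required shapes of factorization at once.
theorem extIdeal_eq_prod_iff {p : Place K} (hxp : x ∈ p.ring) [Algebra.IsSeparable K L]
    [DecidableEq (p.above L)] (T : Multiset (p.above L)) :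
    p.extIdeal k x L = (T.map fun P => P.1.toIdeal k x).prod ↔
      ∀ P : p.above L, T.count P = P.1.e K := by
  have := isDedekindDomain_holRing L ℓ hx
  have : IsFractionRing (holRing k x L) L := isFractionRing_holRing (k := k) (x := x) L
  obtain ⟨S, hS, -⟩ := p.exists_finset_above L
  have hprime : ∀ P : p.above L, Prime (P.1.toIdeal k x) := fun P => by
    rw [P.1.toIdeal_eq_center (p.holRing_le P.2 hxp)]
    exact (P.1.center (p.holRing_le P.2 hxp)).prime
  have hinj : Function.Injective fun P : p.above L => P.1.toIdeal k x := fun P Q h => by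
    dsimp only at h
    rw [P.1.toIdeal_eq_center (p.holRing_le P.2 hxp),
      Q.1.toIdeal_eq_center (p.holRing_le Q.2 hxp)] at h
    exact Subtype.ext (center_injective _ _ (IsDedekindDomain.HeightOneSpectrum.ext h))
  have hfin : Finite (p.above L) := by
    refine Set.Finite.to_subtype (S.finite_toSet.subset fun P hP => (hS P).2 hP)
  let := Fintype.ofFinite (p.above L)
  let T₀ : Multiset (p.above L) := ∑ P : p.above L, P.1.e K • {P}
  have hT₀ : ∀ P : p.above L, T₀.count P = P.1.e K := fun P => by
    simp [T₀, Multiset.count_sum', Multiset.count_singleton]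
  have hext : p.extIdeal k x L = (T₀.map fun P => P.1.toIdeal k x).prod := by
    rw [extIdeal_eq_prod ℓ hx hxp (S := (p.above L).toFinset) (fun P => Set.mem_toFinset),
      ← Finset.prod_set_coe]
    simp only [T₀]
    rw [← Multiset.coe_mapAddMonoidHom, map_sum, Multiset.prod_sum]
    refine Finset.prod_congr rfl fun P _ => ?_
    simp [Multiset.map_nsmul, Multiset.prod_nsmul]
  have hnf : ∀ T : Multiset (p.above L), UniqueFactorizationMonoid.normalizedFactors
      (T.map fun P => P.1.toIdeal k x).prod = T.map fun P => P.1.toIdeal k x := fun T =>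
    UniqueFactorizationMonoid.normalizedFactors_prod_of_prime fun I hI => by
      obtain ⟨P, -, rfl⟩ := Multiset.mem_map.1 hI
      exact hprime P
  rw [hext]
  constructor
  · intro h P
    have h1 := congrArg UniqueFactorizationMonoid.normalizedFactors h
    rw [hnf, hnf] at h1
    rw [← Multiset.map_injective hinj h1, hT₀]
  · intro h
    rw [Multiset.ext.2 fun P => (hT₀ P).trans (h P).symm]

include ℓ hx in
theorem extIdeal_eq_pow_iff {p : Place K} (hxp : x ∈ p.ring) [Algebra.IsSeparable K L]
    {P : Place L} (hP : P ∈ p.above L) (a : ℕ) :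
    p.extIdeal k x L = P.toIdeal k x ^ a ↔ (∀ Q ∈ p.above L, Q = P) ∧ P.e K = a := by
  classical
  obtain ⟨S, hS, hpos, -⟩ := p.exists_finset_above L
  have h := extIdeal_eq_prod_iff ℓ hx hxp (Multiset.replicate a ⟨P, hP⟩)
  rw [Multiset.map_replicate, Multiset.prod_replicate] at h
  rw [h]
  simp only [Multiset.count_replicate]
  constructor
  · intro h1
    refine ⟨fun Q hQ => ?_, ?_⟩
    · by_contra hne
      have := h1 ⟨Q, hQ⟩
      rw [if_neg (fun h => hne (congrArg Subtype.val h).symm)] at this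
      exact (hpos Q ((hS Q).2 hQ)).1.ne this
    · simpa using (h1 ⟨P, hP⟩).symm
  · rintro ⟨h1, h2⟩ ⟨Q, hQ⟩
    obtain rfl := h1 Q hQ
    simp [h2]

include ℓ hx in
theorem extIdeal_eq_pow_mul_pow_iff {p : Place K} (hxp : x ∈ p.ring) [Algebra.IsSeparable K L]
    {P Q : Place L} (hP : P ∈ p.above L) (hQ : Q ∈ p.above L) (hPQ : P ≠ Q) (a b : ℕ) :
    p.extIdeal k x L = P.toIdeal k x ^ a * Q.toIdeal k x ^ b ↔
      (∀ R ∈ p.above L, R = P ∨ R = Q) ∧ P.e K = a ∧ Q.e K = b := by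
  classical
  obtain ⟨S, hS, hpos, -⟩ := p.exists_finset_above L
  have h := extIdeal_eq_prod_iff ℓ hx hxp
    (Multiset.replicate a ⟨P, hP⟩ + Multiset.replicate b ⟨Q, hQ⟩)
  rw [Multiset.map_add, Multiset.prod_add, Multiset.map_replicate, Multiset.prod_replicate,
    Multiset.map_replicate, Multiset.prod_replicate] at h
  rw [h]
  simp only [Multiset.count_add, Multiset.count_replicate]
  constructor
  · intro h1
    refine ⟨fun R hR => ?_, ?_, ?_⟩
    · by_contra! hne
      have := h1 ⟨R, hR⟩
      simp only [Subtype.mk.injEq, if_neg hne.1.symm, if_neg hne.2.symm, add_zero] at this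
      exact (hpos R ((hS R).2 hR)).1.ne this
    · simpa [hPQ.symm] using (h1 ⟨P, hP⟩).symm
    · simpa [hPQ] using (h1 ⟨Q, hQ⟩).symm
  · rintro ⟨h1, h2, h3⟩ ⟨R, hR⟩
    rcases h1 R hR with rfl | rfl
    · simp [h2, hPQ.symm]
    · simp [h3, hPQ]

end ExtIdeal

end Place

namespace Place

/-! ### Finiteness of the residue field. -/

section ResidueField

variable {k K : Type*} [Field k] [Finite k] [Field K] [Algebra k K] (p : Place K)

/-- The residue field of a place of a function field contains the constants. -/
noncomputable def constMap : k →+* p.ResidueField :=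
  (IsLocalRing.residue p.ring).comp ((algebraMap k K).codRestrict p.ring.toSubring p.algebraMap_mem)

lemma constMap_apply (a : k) : p.constMap a = p.res (algebraMap k K a) :=
  (p.res_of_mem (p.algebraMap_mem a)).symm

variable {p} in
-- Lifts of `k`-independent residues are independent over `k[π]`: reducing a relation kills the
-- constant coefficients, after which it can be divided by `π`. The induction is on a bound for the
-- degrees.
lemma eq_zero_of_sum_aeval_mul_eq_zero {ι : Type*} [Fintype ι] {π : K} (hπ : 0 < p.ord π)
    {t : ι → K} (ht : ∀ i, t i ∈ p.ring)
    (hli : ∀ a : ι → k, ∑ i, p.constMap (a i) * p.res (t i) = 0 → a = 0)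
    (n : ℕ) : ∀ f : ι → k[X], (∀ i, (f i).degree < n) → ∑ i, aeval π (f i) * t i = 0 → f = 0 := by
  have hπ0 : π ≠ 0 := by rintro rfl; simp at hπ
  have hπm := (p.mem_nonunits_iff hπ0).2 hπ
  have hπr := ValuationSubring.nonunits_subset hπm
  induction n with
  | zero =>
    intro f hf _
    funext i
    simpa using hf i
  | succ n ih =>
    intro f hf h0
    have hmem : ∀ g : k[X], aeval π g ∈ p.ring := fun g =>
      p.adjoin_le hπr _ (aeval_mem_adjoin_singleton k π)
    have hdecomp : ∀ i, aeval π (f i) =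
        π * aeval π (f i).divX + algebraMap k K ((f i).coeff 0) := fun i => by
      have h := congrArg (aeval π) (divX_mul_X_add (f i))
      rw [map_add, map_mul, aeval_X, aeval_C] at h
      rw [← h, mul_comm]
    have h1 : ∑ i, algebraMap k K ((f i).coeff 0) * t i ∈ p.ring.nonunits := by
      have : ∑ i, algebraMap k K ((f i).coeff 0) * t i =
          -(π * ∑ i, aeval π (f i).divX * t i) := by
        rw [eq_neg_iff_add_eq_zero, ← h0, Finset.mul_sum, ← Finset.sum_add_distrib]
        refine Finset.sum_congr rfl fun i _ => ?_
        rw [hdecomp i]; ring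
      have hs : ∑ i, aeval π (f i).divX * t i ∈ p.ring :=
        sum_mem fun i _ => mul_mem (hmem _) (ht i)
      rw [this]
      exact neg_mem (p.mul_mem_nonunits hπm hs)
    have h2 : ∀ i, (f i).coeff 0 = 0 := by
      refine fun i => congrFun (hli (fun i => (f i).coeff 0) ?_) i
      have hm : ∀ i, algebraMap k K ((f i).coeff 0) * t i ∈ p.ring := fun i =>
        mul_mem (p.algebraMap_mem _) (ht i)
      rw [← p.res_eq_zero_iff (sum_mem fun i _ => hm i), p.res_sum _ hm] at h1
      rw [← h1]
      refine Finset.sum_congr rfl fun i _ => ?_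
      rw [p.constMap_apply, p.res_mul (p.algebraMap_mem _) (ht i)]
    have h3 : ∑ i, aeval π (f i).divX * t i = 0 := by
      have : π * ∑ i, aeval π (f i).divX * t i = 0 := by
        rw [← h0, Finset.mul_sum]
        refine Finset.sum_congr rfl fun i _ => ?_
        rw [hdecomp i, h2 i]; simp [mul_assoc]
      exact (mul_eq_zero.1 this).resolve_left hπ0
    have h4 := ih (fun i => (f i).divX) (fun i => ?_) h3
    · funext i
      rw [← divX_mul_X_add (f i), congrFun h4 i, h2 i]
      simp
    · rcases eq_or_ne (f i) 0 with h | h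
      · rw [h, divX_zero, degree_zero]; exact WithBot.bot_lt_coe _
      · have h5 := degree_divX_lt h
        have h6 := hf i
        rw [degree_eq_natDegree h] at h5 h6
        refine lt_of_lt_of_le h5 ?_
        have : (f i).natDegree < n + 1 := by exact_mod_cast h6
        exact_mod_cast Nat.lt_succ_iff.1 this

/-- For a uniformizer `π` one gets `[k(𝔭) : k] ≤ [K : k(π)]`, which is finite. -/
theorem finite_residueField {x : K} (hx : Transcendental k x) [FiniteDimensional k⟮x⟯ K] :
    Finite p.ResidueField := by
  obtain ⟨π, hπ0, hπ⟩ := p.exists_ord_eq 1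
  have hπ : 0 < p.ord π := by omega
  have := finiteDimensional_adjoin_of_transcendental hx (p.transcendental_of_ord_pos (k := k) hπ)
  let : Algebra k p.ResidueField := p.constMap.toAlgebra
  have hrank : Module.rank k p.ResidueField ≤ Module.finrank k⟮π⟯ K := by
    refine rank_le fun s hs => ?_
    choose t ht hts using fun i : s => p.res_surjective i.1
    have hli : ∀ a : s → k, ∑ i, p.constMap (a i) * p.res (t i) = 0 → a = 0 := by
      intro a ha
      rw [Fintype.linearIndependent_iff] at hs
      funext i
      refine hs a ?_ i
      simpa only [hts] using! ha
    have hA : LinearIndependent (Algebra.adjoin k {π}) t := by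
      rw [Fintype.linearIndependent_iff]
      intro g hg
      have : ∀ i, ∃ f : k[X], aeval π f = (g i : K) := fun i => by
        exact (Algebra.adjoin_singleton_eq_range_aeval k π).le (g i).2
      choose f hf using this
      obtain ⟨n, hn⟩ : ∃ n : ℕ, ∀ i, (f i).degree < n := by
        refine ⟨(Finset.univ.sup fun i => (f i).natDegree) + 1, fun i => ?_⟩
        refine lt_of_le_of_lt degree_le_natDegree ?_
        exact_mod_cast Nat.lt_succ_iff.2 (Finset.le_sup (f := fun i => (f i).natDegree)
          (Finset.mem_univ i))
      have h0 := eq_zero_of_sum_aeval_mul_eq_zero hπ ht hli n f hn (by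
        rw [← hg]
        refine Finset.sum_congr rfl fun i _ => ?_
        rw [hf]; rfl)
      intro i
      refine Subtype.ext ?_
      rw [← hf i, h0]
      simp
    have := (LinearIndependent.iff_fractionRing (Algebra.adjoin k {π}) k⟮π⟯).1 hA
    simpa using this.fintype_card_le_finrank
  have : FiniteDimensional k p.ResidueField :=
    Module.rank_lt_aleph0_iff.1 (hrank.trans_lt (Cardinal.natCast_lt_aleph0))
  exact Module.finite_of_finite k

end ResidueField

end Place

/-! ### Artin–Schreier theory over a finite field of characteristic 3. -/

section ArtinSchreier

variable {κ : Type*} [Field κ] [CharP κ 3]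

lemma pow_three_of_mem_bot {a : κ} (ha : a ∈ (⊥ : Subfield κ)) : a ^ 3 = a := by
  have h : (⊥ : Subfield κ) ≤ (frobenius κ 3).eqLocusField (RingHom.id κ) := bot_le
  exact h ha

omit [CharP κ 3] in
lemma mem_bot_of_pow_three {a : κ} (ha : a ^ 3 = a) : a ∈ (⊥ : Subfield κ) := by
  have h : a * ((a - 1) * (a + 1)) = 0 := by linear_combination ha
  rcases mul_eq_zero.1 h with h | h
  · rw [h]; exact zero_mem _
  rcases mul_eq_zero.1 h with h | h
  · rw [sub_eq_zero.1 h]; exact one_mem _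
  · rw [eq_neg_of_add_eq_zero_left h]; exact neg_mem (one_mem _)

/-- The Artin--Schreier operator in characteristic three. -/
def artinSchreier (κ : Type*) [Field κ] [CharP κ 3] : κ →ₗ[(⊥ : Subfield κ)] κ where
  toFun γ := γ ^ 3 - γ
  map_add' a b := by rw [add_pow_char]; ring
  map_smul' a b := by
    have : (a • b : κ) = a * b := rfl
    simp only [this, RingHom.id_apply, mul_pow, pow_three_of_mem_bot a.2]
    change _ = (a : κ) * (b ^ 3 - b)
    ring

/-- Additive Hilbert 90 by a dimension count. The trace is invariant under Frobenius, so it kills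
every `γ³ - γ`; that map has the prime field as kernel, so its image has codimension 1, as does the
kernel of the surjective trace. -/
theorem trace_eq_zero_iff [Finite κ] (β : κ) :
    Algebra.trace (⊥ : Subfield κ) κ β = 0 ↔ ∃ γ : κ, γ ^ 3 - γ = β := by
  have hle : LinearMap.range (artinSchreier κ) ≤ LinearMap.ker (Algebra.trace (⊥ : Subfield κ) κ) := by
    rintro _ ⟨γ, rfl⟩
    rw [LinearMap.mem_ker]
    change Algebra.trace (⊥ : Subfield κ) κ (γ ^ 3 - γ) = 0
    let e : κ ≃ₐ[(⊥ : Subfield κ)] κ := AlgEquiv.ofBijective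
      { frobenius κ 3 with commutes' := fun a => pow_three_of_mem_bot a.2 }
      (Finite.injective_iff_bijective.1 (frobenius_inj κ 3))
    rw [map_sub, sub_eq_zero]
    exact Algebra.trace_eq_of_algEquiv e γ
  have hker : LinearMap.ker (artinSchreier κ) = Submodule.span (⊥ : Subfield κ) {(1 : κ)} := by
    ext a
    rw [LinearMap.mem_ker, Submodule.mem_span_singleton]
    constructor
    · intro h
      exact ⟨⟨a, mem_bot_of_pow_three (sub_eq_zero.1 h)⟩, mul_one a⟩
    · rintro ⟨b, rfl⟩
      have : (b • (1 : κ)) = b := mul_one (b : κ)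
      rw [this]
      exact sub_eq_zero.2 (pow_three_of_mem_bot b.2)
  have h1 := LinearMap.finrank_range_add_finrank_ker (artinSchreier κ)
  have h2 := LinearMap.finrank_range_add_finrank_ker (Algebra.trace (⊥ : Subfield κ) κ)
  rw [hker, finrank_span_singleton one_ne_zero] at h1
  rw [LinearMap.range_eq_top.2 (Algebra.trace_surjective (⊥ : Subfield κ) κ), finrank_top,
    Module.finrank_self] at h2
  have heq := Submodule.eq_of_le_of_finrank_eq hle (by omega)
  rw [← LinearMap.mem_ker, ← heq]
  rfl

end ArtinSchreier

/-! ### Roots and irreducible factors modulo a place. -/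

namespace Place

section Local

variable {F E : Type*} [Field F] [Field E] [Algebra F E] [FiniteDimensional F E]
  [Algebra.IsSeparable F E]

lemma e_pos {p : Place F} {P : Place E} (h : P ∈ p.above E) : 0 < P.e F := by
  obtain ⟨S, hS, hpos, -⟩ := p.exists_finset_above E
  exact (hpos P ((hS P).2 h)).1

lemma f_pos {p : Place F} {P : Place E} (h : P ∈ p.above E) : 0 < P.f F := by
  obtain ⟨S, hS, hpos, -⟩ := p.exists_finset_above E
  exact (hpos P ((hS P).2 h)).2

variable (E) in
lemma above_nonempty (p : Place F) : (p.above E).Nonempty := by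
  obtain ⟨S, hS, -, hsum⟩ := p.exists_finset_above E
  by_contra h
  have : S = ∅ := Finset.eq_empty_of_forall_notMem fun P hP => h ⟨P, (hS P).1 hP⟩
  rw [this, Finset.sum_empty] at hsum
  exact Module.finrank_pos.ne hsum

/-- The residue of `w` at `P` has the reduction of `H` as its minimal polynomial, so the residue
extension has at least that degree. -/
lemma natDegree_le_f {p : Place F} {P : Place E} (h : P ∈ p.above E) {w : E} (hw : w ∈ P.ring)
    {H : p.ring[X]} (hm : H.Monic) (hirr : Irreducible (H.map (IsLocalRing.residue p.ring)))
    (h0 : aeval w H ∈ P.ring.nonunits) : H.natDegree ≤ P.f F := by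
  have hf := f_pos h
  have hl := liesOver_above h
  obtain ⟨R, hR⟩ := p
  change _ = R at h
  subst h
  let m := IsLocalRing.maximalIdeal (P.ring.comap (algebraMap F E))
  let M := IsLocalRing.maximalIdeal P.ring
  have : M.LiesOver m := hl
  let : Field ((P.ring.comap (algebraMap F E)) ⧸ m) := Ideal.Quotient.field m
  let : Field (P.ring ⧸ M) := Ideal.Quotient.field M
  have hfd : P.f F = Module.finrank ((P.ring.comap (algebraMap F E)) ⧸ m) (P.ring ⧸ M) :=
    Ideal.inertiaDeg_eq_of_isMaximal m M
  rw [hfd] at hf ⊢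
  have : FiniteDimensional ((P.ring.comap (algebraMap F E)) ⧸ m) (P.ring ⧸ M) :=
    Module.finite_of_finrank_pos hf
  let H' : (P.ring.comap (algebraMap F E))[X] := H
  have hz : aeval (⟨w, hw⟩ : P.ring) H' ∈ M := by
    rw [← ValuationSubring.coe_mem_nonunits_iff]
    have : ((aeval (⟨w, hw⟩ : P.ring) H' : P.ring) : E) = aeval w H' :=
      (aeval_algebraMap_apply E (⟨w, hw⟩ : P.ring) H').symm
    rw [this]; exact h0
  have hz' : aeval (Ideal.Quotient.mk M ⟨w, hw⟩) (H'.map (Ideal.Quotient.mk m)) = 0 := by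
    rw [← Ideal.Quotient.eq_zero_iff_mem] at hz
    rw [← hz, ← Ideal.Quotient.algebraMap_eq m, ← Ideal.Quotient.algebraMap_eq M,
      aeval_map_algebraMap, aeval_algebraMap_apply]
  have hmin := minpoly.eq_of_irreducible_of_monic (p := H'.map (Ideal.Quotient.mk m)) hirr hz'
    (hm.map _)
  have hd := minpoly.natDegree_le (A := (P.ring.comap (algebraMap F E)) ⧸ m)
    (Ideal.Quotient.mk M ⟨w, hw⟩)
  rw [← hmin] at hd
  have h5 : (H'.map (Ideal.Quotient.mk m)).natDegree = H'.natDegree := hm.natDegree_map _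
  rw [h5] at hd
  exact hd

lemma exists_above_of_root {p : Place F} {w : E} {g : p.ring[X]} (hg : g.Monic)
    (hmin : minpoly F w = g.map (algebraMap p.ring F)) {r : F} (hr : r ∈ p.ring)
    (h0 : (g.map (IsLocalRing.residue p.ring)).eval (p.res r) = 0) :
    ∃ P ∈ p.above E, w ∈ P.ring ∧ w - algebraMap F E r ∈ P.ring.nonunits := by
  obtain ⟨P, hP, hw, h⟩ := exists_above_of_not_isCoprime (p := p) hg hmin (H := X - C ⟨r, hr⟩)
    (by
      intro hc
      rw [Polynomial.map_sub, map_X, map_C, ← p.res_of_mem hr] at hc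
      have h1 : (X - C (p.res r)) ∣ g.map (IsLocalRing.residue p.ring) := dvd_iff_isRoot.2 h0
      exact not_isUnit_X_sub_C _ (hc.isUnit_of_dvd' dvd_rfl h1))
  refine ⟨P, hP, hw, ?_⟩
  rw [map_sub, aeval_X, aeval_C] at h
  exact h

omit [FiniteDimensional F E] [Algebra.IsSeparable F E] in
lemma res_eq_of_sub_mem {p : Place F} {P : Place E} (h : P ∈ p.above E) {w : E} {r s : F}
    (hr : r ∈ p.ring) (hs : s ∈ p.ring) (h1 : w - algebraMap F E r ∈ P.ring.nonunits)
    (h2 : w - algebraMap F E s ∈ P.ring.nonunits) : p.res r = p.res s := by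
  rw [p.res_eq_res_iff hr hs, ← algebraMap_mem_nonunits h, map_sub]
  have := sub_mem h2 h1
  rwa [show w - algebraMap F E s - (w - algebraMap F E r) =
    algebraMap F E r - algebraMap F E s by ring] at this

end Local

end Place

/-! ### Cubic generators. -/

section Generators

variable {K L : Type*} [Field K] [Field L] [Algebra K L]

lemma minpoly_eq_of_natDegree_eq_finrank {w : L} (hw : K⟮w⟯ = ⊤) {q : K[X]} (hm : q.Monic)
    (hd : q.natDegree = Module.finrank K L) (h0 : aeval w q = 0) : minpoly K w = q := by
  have hi : IsIntegral K w := ⟨q, hm, h0⟩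
  have h1 := adjoin.finrank hi
  rw [hw, finrank_top'] at h1
  exact (eq_of_monic_of_dvd_of_natDegree_le (minpoly.monic hi) hm (minpoly.dvd _ _ h0)
    (by omega)).symm

lemma adjoin_eq_top_of_mem {z w : L} (hz : K⟮z⟯ = ⊤) (h : z ∈ K⟮w⟯) : K⟮w⟯ = ⊤ := by
  rw [eq_top_iff, ← hz, adjoin_simple_le_iff]
  exact h

namespace IsCubicGen

variable {z : L} {c : K}

lemma eq_zero (h : IsCubicGen z c) :
    z ^ 3 + algebraMap K L c * z + algebraMap K L c ^ 2 = 0 := by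
  have := minpoly.aeval K z
  rw [h.2] at this
  simpa using this

lemma ne_zero (h : IsCubicGen z c) : c ≠ 0 := by
  rintro rfl
  have h1 := h.eq_zero
  have h2 : z = 0 := by simpa using h1
  have h3 := h.2
  rw [h2, minpoly.zero] at h3
  have := congrArg natDegree h3
  simp at this

lemma gen_ne_zero (h : IsCubicGen z c) : z ≠ 0 := by
  rintro rfl
  have := h.eq_zero
  have h2 := h.ne_zero
  simp [h2] at this

lemma finrank_eq (h : IsCubicGen z c) : Module.finrank K L = 3 := by
  have hi : IsIntegral K z := by
    by_contra hi
    have h1 := h.2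
    rw [minpoly.eq_zero hi] at h1
    have := congrArg (fun q => coeff q 3) h1
    rw [coeff_zero, coeff_add, coeff_add, coeff_X_pow, coeff_C_mul, coeff_X, coeff_C] at this
    simp at this
  have h1 := adjoin.finrank hi
  rw [h.1, finrank_top', h.2] at h1
  rw [h1]
  compute_degree!

end IsCubicGen

end Generators

/-! ### Decomposition of integral cubics by their reduction. -/

namespace Place

lemma charP_residueField {F : Type*} [Field F] [CharP F 3] (p : Place F) :
    CharP p.ResidueField 3 := by
  rw [CharP.charP_iff_prime_eq_zero Nat.prime_three]
  have h : ((3 : ℕ) : p.ring) = 0 := by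
    apply Subtype.ext
    rw [ZeroMemClass.coe_zero, SubringClass.coe_natCast]
    exact CharP.cast_eq_zero F 3
  rw [← map_natCast (IsLocalRing.residue p.ring), h, map_zero]

section Cubic

variable {K L : Type*} [Field K] [Field L] [Algebra K L]

/-- The cubic `X³ + dX + g` over the valuation ring of a place. -/
noncomputable def cubic {p : Place K} (d g : p.ring) : p.ring[X] := X ^ 3 + C d * X + C g

lemma cubic_monic {p : Place K} (d g : p.ring) : (cubic d g).Monic := by
  unfold cubic; monicity!

lemma natDegree_cubic {p : Place K} (d g : p.ring) : (cubic d g).natDegree = 3 := by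
  unfold cubic; compute_degree!

lemma minpoly_eq_cubic {p : Place K} (h3 : Module.finrank K L = 3) {w : L} (hw : K⟮w⟯ = ⊤)
    {d g : p.ring}
    (h0 : w ^ 3 + algebraMap K L d * w + algebraMap K L g = 0) :
    minpoly K w = (cubic d g).map (algebraMap p.ring K) := by
  apply minpoly_eq_of_natDegree_eq_finrank hw ((cubic_monic d g).map _)
  · rw [(cubic_monic d g).natDegree_map, natDegree_cubic, h3]
  · simpa [cubic] using h0

variable [FiniteDimensional K L] [Algebra.IsSeparable K L] {p : Place K}
  (h3 : Module.finrank K L = 3) {w : L} (hw : K⟮w⟯ = ⊤) {d g : K} (hd : d ∈ p.ring)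
  (hg : g ∈ p.ring) (h0 : w ^ 3 + algebraMap K L d * w + algebraMap K L g = 0)

include h3 hw hd hg h0

lemma exists_above_of_cubic_root {r : K} (hr : r ∈ p.ring)
    (hroot : p.res r ^ 3 + p.res d * p.res r + p.res g = 0) :
    ∃ P ∈ p.above L, w ∈ P.ring ∧ w - algebraMap K L r ∈ P.ring.nonunits := by
  apply exists_above_of_root (cubic_monic ⟨d, hd⟩ ⟨g, hg⟩)
    (minpoly_eq_cubic h3 hw (d := ⟨d, hd⟩) (g := ⟨g, hg⟩) h0) hr
  simpa [cubic, p.res_of_mem hd, p.res_of_mem hg] using hroot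

lemma hasSignature_of_cubic_splits {r₁ r₂ r₃ : K} (hr₁ : r₁ ∈ p.ring) (hr₂ : r₂ ∈ p.ring)
    (hr₃ : r₃ ∈ p.ring)
    (h₁ : p.res r₁ ^ 3 + p.res d * p.res r₁ + p.res g = 0)
    (h₂ : p.res r₂ ^ 3 + p.res d * p.res r₂ + p.res g = 0)
    (h₃ : p.res r₃ ^ 3 + p.res d * p.res r₃ + p.res g = 0)
    (h₁₂ : p.res r₁ ≠ p.res r₂) (h₁₃ : p.res r₁ ≠ p.res r₃) (h₂₃ : p.res r₂ ≠ p.res r₃) :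
    p.HasSignature L [(1, 1), (1, 1), (1, 1)] := by
  obtain ⟨P₁, hP₁, -, hm₁⟩ := exists_above_of_cubic_root h3 hw hd hg h0 hr₁ h₁
  obtain ⟨P₂, hP₂, -, hm₂⟩ := exists_above_of_cubic_root h3 hw hd hg h0 hr₂ h₂
  obtain ⟨P₃, hP₃, -, hm₃⟩ := exists_above_of_cubic_root h3 hw hd hg h0 hr₃ h₃
  have n₁₂ : P₁ ≠ P₂ := by
    rintro rfl; exact h₁₂ (res_eq_of_sub_mem hP₁ hr₁ hr₂ hm₁ hm₂)
  have n₁₃ : P₁ ≠ P₃ := by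
    rintro rfl; exact h₁₃ (res_eq_of_sub_mem hP₁ hr₁ hr₃ hm₁ hm₃)
  have n₂₃ : P₂ ≠ P₃ := by
    rintro rfl; exact h₂₃ (res_eq_of_sub_mem hP₂ hr₂ hr₃ hm₂ hm₃)
  refine (signature_of_le (p := p) [(P₁, 1, 1), (P₂, 1, 1), (P₃, 1, 1)] ?_ ?_ ?_).1
  · simp [n₁₂, n₁₃, n₂₃]
  · simp [hP₁, hP₂, hP₃, Nat.succ_le_iff, e_pos hP₁, e_pos hP₂, e_pos hP₃, f_pos hP₁, f_pos hP₂,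
      f_pos hP₃]
  · simp [h3]

/-- If `X³ + dX + g` has no root in the residue field, the place is inert. -/
lemma hasSignature_of_cubic_irreducible
    (hno : ∀ ρ : p.ResidueField, ρ ^ 3 + p.res d * ρ + p.res g ≠ 0) :
    p.HasSignature L [(1, 3)] := by
  obtain ⟨P, hP, hwP, hm⟩ := exists_above_of_not_isCoprime
    (cubic_monic ⟨d, hd⟩ ⟨g, hg⟩)
    (minpoly_eq_cubic h3 hw (d := ⟨d, hd⟩) (g := ⟨g, hg⟩) h0) (H := cubic ⟨d, hd⟩ ⟨g, hg⟩)
    (by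
      rw [isCoprime_self]
      intro hu
      have := natDegree_eq_zero_of_isUnit hu
      rw [(cubic_monic _ _).natDegree_map, natDegree_cubic] at this
      omega)
  have hirr : Irreducible ((cubic ⟨d, hd⟩ ⟨g, hg⟩).map (IsLocalRing.residue p.ring)) := by
    have hmon := (cubic_monic (p := p) ⟨d, hd⟩ ⟨g, hg⟩).map (IsLocalRing.residue p.ring)
    have hdeg : ((cubic ⟨d, hd⟩ ⟨g, hg⟩).map (IsLocalRing.residue p.ring)).natDegree = 3 := by
      rw [(cubic_monic _ _).natDegree_map, natDegree_cubic]
    rw [hmon.irreducible_iff_roots_eq_zero_of_degree_le_three (by omega) (by omega)]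
    refine Multiset.eq_zero_of_forall_notMem fun ρ hρ => hno ρ ?_
    have := (mem_roots'.1 hρ).2
    simpa [cubic, p.res_of_mem hd, p.res_of_mem hg] using this
  have hf := natDegree_le_f hP hwP (cubic_monic _ _) hirr hm
  rw [natDegree_cubic] at hf
  refine (signature_of_le (p := p) [(P, 1, 3)] ?_ ?_ ?_).1
  · simp
  · simpa [hP, Nat.succ_le_iff, hf] using e_pos hP
  · simp [h3]

/-- If `-d` is not a square in the residue field, then `X³ + dX + g` has exactly one root there. -/
lemma exists_above_of_cubic_not_isSquare [CharP K 3] [Finite p.ResidueField]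
    (hdu : p.res d ≠ 0) (hsq : ¬ IsSquare (-p.res d)) :
    ∃ P₁ P₂ : Place L, P₁ ≠ P₂ ∧ (∀ P, P ∈ p.above L ↔ P = P₁ ∨ P = P₂) ∧
      P₁.e K = 1 ∧ P₁.f K = 1 ∧ P₂.e K = 1 ∧ P₂.f K = 2 ∧
      p.HasSignature L [(1, 1), (1, 2)] ∧
      ∃ v ∈ P₂.ring, v ^ 2 + algebraMap K L d ∈ P₂.ring.nonunits := by
  have := p.charP_residueField
  have : CharP L 3 := charP_of_injective_algebraMap (algebraMap K L).injective 3
  have k3 : (3 : p.ResidueField) = 0 := by exact_mod_cast CharP.cast_eq_zero p.ResidueField 3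
  have L3 : (3 : L) = 0 := by exact_mod_cast CharP.cast_eq_zero L 3
  -- This map is additive in characteristic 3, and a nonzero kernel element would be a square root
  -- of `-d`. On a finite field it is then bijective, which gives the root.
  have hinj : Function.Injective fun ρ : p.ResidueField => ρ ^ 3 + p.res d * ρ := by
    intro s t hst
    have h1 : (s - t) * ((s - t) ^ 2 + p.res d) = 0 := by
      linear_combination hst + (s * t ^ 2 - s ^ 2 * t) * k3
    rcases mul_eq_zero.1 h1 with h | h
    · exact sub_eq_zero.1 h
    · exact absurd ⟨s - t, by linear_combination -h⟩ hsq
  obtain ⟨ρ, hρ⟩ := (Finite.injective_iff_surjective.1 hinj) (-p.res g)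
  obtain ⟨r, hr, rfl⟩ := p.res_surjective ρ
  simp only at hρ
  obtain ⟨P₁, hP₁, -, hm₁⟩ := exists_above_of_cubic_root h3 hw hd hg h0 hr
    (by rw [hρ]; ring)
  -- The cofactor of `X - r` in the reduced cubic. In characteristic 3 it equals `(X - r)² + d`, so
  -- `w - r` becomes a square root of `-d` modulo `P₂`.
  let H : p.ring[X] := X ^ 2 + C ⟨r, hr⟩ * X + C (⟨r, hr⟩ ^ 2 + ⟨d, hd⟩)
  have hH : H.Monic := by unfold H; monicity!
  have hHd : H.natDegree = 2 := by unfold H; compute_degree!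
  have hmon := hH.map (IsLocalRing.residue p.ring)
  have hdeg : (H.map (IsLocalRing.residue p.ring)).natDegree = 2 := by
    rw [hH.natDegree_map, hHd]
  obtain ⟨P₂, hP₂, hwP, hm₂⟩ := exists_above_of_not_isCoprime
    (cubic_monic ⟨d, hd⟩ ⟨g, hg⟩)
    (minpoly_eq_cubic h3 hw (d := ⟨d, hd⟩) (g := ⟨g, hg⟩) h0) (H := H)
    (by
      intro hc
      have hdvd : H.map (IsLocalRing.residue p.ring) ∣
          (cubic ⟨d, hd⟩ ⟨g, hg⟩).map (IsLocalRing.residue p.ring) := by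
        refine ⟨X - C (p.res r), ?_⟩
        have hg' : IsLocalRing.residue p.ring ⟨g, hg⟩ =
            -(p.res r ^ 3 + p.res d * p.res r) := by
          rw [hρ, neg_neg, p.res_of_mem hg]
        simp only [H, cubic, Polynomial.map_add, Polynomial.map_mul, Polynomial.map_pow, map_X,
          map_C, hg', map_add, map_pow, ← p.res_of_mem hd, ← p.res_of_mem hr, C_neg, C_mul]
        ring
      have hu := hc.isUnit_of_dvd' dvd_rfl hdvd
      have := natDegree_eq_zero_of_isUnit hu
      omega)
  have hm₂' : w ^ 2 + algebraMap K L r * w + (algebraMap K L r ^ 2 + algebraMap K L d) ∈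
      P₂.ring.nonunits := by
    simp only [H, map_add, map_mul, map_pow, aeval_X, aeval_C] at hm₂
    exact hm₂
  have hirr : Irreducible (H.map (IsLocalRing.residue p.ring)) := by
    rw [hmon.irreducible_iff_roots_eq_zero_of_degree_le_three (by omega) (by omega)]
    refine Multiset.eq_zero_of_forall_notMem fun ρ hρ => hsq ⟨ρ - p.res r, ?_⟩
    have := (mem_roots'.1 hρ).2
    simp only [IsRoot.def, H, Polynomial.map_add, Polynomial.map_mul, Polynomial.map_pow, map_X,
      map_C, map_add, map_pow, eval_add, eval_mul, eval_pow, eval_X, eval_C,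
      ← p.res_of_mem hd, ← p.res_of_mem hr] at this
    linear_combination -this + ρ * p.res r * k3
  have hf := natDegree_le_f hP₂ hwP hH hirr hm₂
  rw [hHd] at hf
  -- At a common place both `w - r` and `(w - r)² + d` would vanish, hence also the unit `d`.
  have hne : P₁ ≠ P₂ := by
    rintro rfl
    apply hdu
    rw [p.res_eq_zero_iff hd, ← algebraMap_mem_nonunits hP₁]
    have hmem := sub_mem hwP ((mem_above hP₁ r).2 hr)
    have := sub_mem hm₂' (P₁.mul_mem_nonunits hm₁ hmem)
    convert this using 1
    linear_combination -(w * algebraMap K L r) * L3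
  obtain ⟨hsig, hall, hef⟩ := signature_of_le (p := p) [(P₁, 1, 1), (P₂, 1, 2)] (by simp [hne])
    (by simp [hP₁, hP₂, Nat.succ_le_iff, e_pos hP₁, e_pos hP₂, f_pos hP₁, hf])
    (by simp [h3])
  refine ⟨P₁, P₂, hne, fun P => by simpa using hall P, ?_⟩
  simp only [List.mem_cons, List.not_mem_nil, or_false, forall_eq_or_imp, forall_eq] at hef
  refine ⟨hef.1.1, hef.1.2, hef.2.1, hef.2.2, by simpa using hsig, w - algebraMap K L r,
    sub_mem hwP ((mem_above hP₂ r).2 hr), ?_⟩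
  convert hm₂' using 1
  linear_combination -(w * algebraMap K L r) * L3

/-- The splitting of `X³ + dX + g` when `-d = β²` in the residue field. -/
lemma hasSignature_of_cubic_isSquare [CharP K 3] [Finite p.ResidueField] {β : p.ResidueField}
    (hβ0 : β ≠ 0) (hβ : β ^ 2 = -p.res d) :
    (p.tr (p.res g / β ^ 3) = 0 → p.HasSignature L [(1, 1), (1, 1), (1, 1)]) ∧
    (p.tr (p.res g / β ^ 3) ≠ 0 → p.HasSignature L [(1, 3)]) := by
  have := p.charP_residueField
  have k3 : (3 : p.ResidueField) = 0 := by exact_mod_cast CharP.cast_eq_zero p.ResidueField 3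
  have hd' : p.res d = -β ^ 2 := by rw [hβ, neg_neg]
  constructor
  · intro htr
    obtain ⟨γ, hγ⟩ := (trace_eq_zero_iff _).1 htr
    have hg' : p.res g = β ^ 3 * (γ ^ 3 - γ) := by rw [hγ]; field_simp
    -- With `X = -βT` the reduced cubic becomes `T³ - T = g/β³`; its solutions `γ`, `γ ± 1` give
    -- these three roots.
    obtain ⟨r₁, hr₁, h₁⟩ := p.res_surjective (-γ * β)
    obtain ⟨r₂, hr₂, h₂⟩ := p.res_surjective (-γ * β + β)
    obtain ⟨r₃, hr₃, h₃⟩ := p.res_surjective (-γ * β - β)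
    refine hasSignature_of_cubic_splits h3 hw hd hg h0 hr₁ hr₂ hr₃ ?_ ?_ ?_ ?_ ?_ ?_
    · rw [h₁, hd', hg']; ring
    · rw [h₂, hd', hg']; linear_combination (γ ^ 2 * β ^ 3 - γ * β ^ 3) * k3
    · rw [h₃, hd', hg']; linear_combination (-γ ^ 2 * β ^ 3 - γ * β ^ 3) * k3
    · rw [h₁, h₂]; intro h; exact hβ0 (by linear_combination -h)
    · rw [h₁, h₃]; intro h; exact hβ0 (by linear_combination h)
    · rw [h₂, h₃]; intro h; exact hβ0 (by linear_combination -h + β * k3)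
  · intro htr
    refine hasSignature_of_cubic_irreducible h3 hw hd hg h0 fun ρ hρ => htr ?_
    refine (trace_eq_zero_iff _).2 ⟨-ρ / β, ?_⟩
    rw [hd'] at hρ
    field_simp
    linear_combination -hρ

end Cubic

end Place

namespace Place

lemma res_zero {F : Type*} [Field F] (p : Place F) : p.res 0 = 0 := by
  rw [p.res_of_mem (zero_mem _)]
  exact map_zero _

lemma res_one {F : Type*} [Field F] (p : Place F) : p.res 1 = 1 := by
  rw [p.res_of_mem (one_mem _)]
  exact map_one _

lemma one_notMem_nonunits {F : Type*} [Field F] (p : Place F) : (1 : F) ∉ p.ring.nonunits := by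
  rw [← p.res_eq_zero_iff (one_mem _), p.res_one]
  exact one_ne_zero

/-! ### The two ramified cases. -/

section Ramified

variable {K L : Type*} [Field K] [Field L] [Algebra K L] [FiniteDimensional K L]
  [Algebra.IsSeparable K L] {p : Place K} {z : L} {c : K}

lemma hasSignature_of_isCoprime_ord (hz : IsCubicGen z c) (hneg : p.ord c < 0)
    (hc : IsCoprime (p.ord c) 3) : p.HasSignature L [(3, 1)] := by
  obtain ⟨P, hP⟩ := p.above_nonempty L
  have hA : algebraMap K L c ≠ 0 := by simpa using hz.ne_zero
  have hz0 := hz.gen_ne_zero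
  have hord := ord_algebraMap hP c
  have he := e_pos hP
  have heq := hz.eq_zero
  have hneg' : (P.e K : ℤ) * p.ord c < 0 := mul_neg_of_pos_of_neg (by exact_mod_cast he) hneg
  have h1 : P.ord (z ^ 3) = 3 * P.ord z := by rw [ord_pow]; norm_num
  have h2 : P.ord (algebraMap K L c * z) = P.e K * p.ord c + P.ord z := by
    rw [P.ord_mul hA hz0, hord]
  have h3 : P.ord (algebraMap K L c ^ 2) = 2 * (P.e K * p.ord c) := by
    rw [ord_pow, hord]; norm_num
  -- Since `v(c) < 0`, the middle term `cz` never has the strictly smallest order when the outer two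
  -- differ: the smaller outer term would dominate both others. So the outer orders agree.
  have key : 3 * P.ord z = 2 * (P.e K * p.ord c) := by
    rcases lt_trichotomy (3 * P.ord z) (2 * (P.e K * p.ord c)) with h | h | h
    · refine absurd heq (P.ord_ne_zero_of_sum_eq_zero (pow_ne_zero 3 hz0) (.inr ?_) (.inr ?_)) <;>
        omega
    · exact h
    · refine absurd (a := algebraMap K L c ^ 2 + z ^ 3 + algebraMap K L c * z = 0) ?_
        (P.ord_ne_zero_of_sum_eq_zero (pow_ne_zero 2 hA) (.inr ?_) (.inr ?_))
      · rw [← heq]; ring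
      all_goals omega
  have hdvd : (3 : ℤ) ∣ P.e K := by
    have h5 : (3 : ℤ) ∣ p.ord c * P.e K := by
      have : (3 : ℤ) ∣ 2 * (P.e K * p.ord c) := ⟨_, key.symm⟩
      rw [mul_comm]
      omega
    exact (hc.symm).dvd_of_dvd_mul_left h5
  have hge : 3 ≤ P.e K := Nat.le_of_dvd he (by exact_mod_cast hdvd)
  exact (signature_of_le (p := p) [(P, 3, 1)] (by simp)
    (by simpa [hP, Nat.succ_le_iff, f_pos hP] using hge) (by simp [hz.finrank_eq])).1

/-- The reduction of the equation of `z` is only `X³`, but `r = -c/z` satisfies `r³ - r² - c = 0`,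
which reduces to `r²(r - 1)`. At the zero of `r`, `e·v(c) = 2v(r)` forces `e` to be even. The
identity for `-c` is kept to study `L(b)`. -/
lemma exists_above_of_odd_ord (hz : IsCubicGen z c) (hpos : 0 < p.ord c)
    (hodd : IsCoprime (p.ord c) 2) :
    ∃ P₁ P₂ : Place L, P₁ ≠ P₂ ∧ (∀ P, P ∈ p.above L ↔ P = P₁ ∨ P = P₂) ∧
      P₁.e K = 2 ∧ P₁.f K = 1 ∧ P₂.e K = 1 ∧ P₂.f K = 1 ∧
      p.HasSignature L [(2, 1), (1, 1)] ∧
      ∃ r : L, r ≠ 0 ∧ r ∈ P₁.ring.nonunits ∧ algebraMap K L (-c) = r ^ 2 * (1 - r) := by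
  have hA : algebraMap K L c ≠ 0 := by simpa using hz.ne_zero
  have hz0 := hz.gen_ne_zero
  have hcm : c ∈ p.ring := (p.mem_ring_iff hz.ne_zero).2 hpos.le
  have hcn : c ∈ p.ring.nonunits := (p.mem_nonunits_iff hz.ne_zero).2 hpos
  obtain ⟨r, hr⟩ : ∃ r : L, r = -algebraMap K L c / z := ⟨_, rfl⟩
  have hr0 : r ≠ 0 := by rw [hr]; exact div_ne_zero (neg_ne_zero.2 hA) hz0
  have hzr : z = -algebraMap K L c / r := by rw [hr]; field_simp
  have hreq : r ^ 3 - r ^ 2 - algebraMap K L c = 0 := by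
    have := hz.eq_zero
    rw [hzr] at this
    field_simp at this
    have h2 : algebraMap K L c ^ 2 * (r ^ 3 - r ^ 2 - algebraMap K L c) = 0 := by
      linear_combination this
    exact (mul_eq_zero.1 h2).resolve_left (pow_ne_zero 2 hA)
  have htop : K⟮r⟯ = ⊤ := by
    refine adjoin_eq_top_of_mem hz.1 ?_
    rw [hzr]
    exact div_mem (neg_mem (K⟮r⟯.algebraMap_mem c)) (mem_adjoin_simple_self K r)
  let g : p.ring[X] := X ^ 3 - X ^ 2 - C ⟨c, hcm⟩
  have hg : g.Monic := by unfold g; monicity!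
  have hgd : g.natDegree = 3 := by unfold g; compute_degree!
  have hmin : minpoly K r = g.map (algebraMap p.ring K) := by
    apply minpoly_eq_of_natDegree_eq_finrank htop (hg.map _)
    · rw [hg.natDegree_map, hgd, hz.finrank_eq]
    · simpa [g] using hreq
  have hc0 : p.res c = 0 := (p.res_eq_zero_iff hcm).2 hcn
  obtain ⟨P₁, hP₁, hrP, hm₁⟩ := exists_above_of_root hg hmin (zero_mem p.ring)
    (by simp [g, p.res_zero, ← p.res_of_mem hcm, hc0])
  obtain ⟨P₂, hP₂, -, hm₂⟩ := exists_above_of_root hg hmin (one_mem p.ring)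
    (by simp [g, p.res_one, ← p.res_of_mem hcm, hc0])
  rw [map_zero, sub_zero] at hm₁
  rw [map_one] at hm₂
  have hne : P₁ ≠ P₂ := by
    rintro rfl
    have := sub_mem hm₁ hm₂
    rw [sub_sub_cancel] at this
    exact P₁.one_notMem_nonunits this
  have hr1 : r - 1 ≠ 0 := by
    intro h
    apply hA
    linear_combination r ^ 2 * h - hreq
  have hu : P₁.ord (r - 1) = 0 := by
    rw [← P₁.res_ne_zero_iff hr1 (sub_mem hrP (one_mem _)), P₁.res_sub hrP (one_mem _),
      (P₁.res_eq_zero_iff hrP).2 hm₁, P₁.res_one]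
    simp
  have hord : P₁.e K * p.ord c = 2 * P₁.ord r := by
    rw [← ord_algebraMap hP₁, show algebraMap K L c = r ^ 2 * (r - 1) by linear_combination -hreq,
      P₁.ord_mul (pow_ne_zero 2 hr0) hr1, hu, ord_pow]
    norm_num
  have hdvd : (2 : ℤ) ∣ P₁.e K := hodd.symm.dvd_of_dvd_mul_right ⟨_, hord⟩
  have hge : 2 ≤ P₁.e K := Nat.le_of_dvd (e_pos hP₁) (by exact_mod_cast hdvd)
  obtain ⟨hsig, hall, hef⟩ := signature_of_le (p := p) [(P₁, 2, 1), (P₂, 1, 1)] (by simp [hne])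
    (by simp [hP₁, hP₂, Nat.succ_le_iff, e_pos hP₂, f_pos hP₂, f_pos hP₁, hge])
    (by simp [hz.finrank_eq])
  refine ⟨P₁, P₂, hne, fun P => by simpa using hall P, ?_⟩
  simp only [List.mem_cons, List.not_mem_nil, or_false, forall_eq_or_imp, forall_eq] at hef
  refine ⟨hef.1.1, hef.1.2, hef.2.1, hef.2.2, by simpa using hsig, r, hr0, hm₁, ?_⟩
  rw [map_neg]
  linear_combination hreq

end Ramified

/-! ### Decomposition in quadratic extensions. -/

section Quadratic

variable {F E : Type*} [Field F] [Field E] [Algebra F E] [FiniteDimensional F E]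
  [Algebra.IsSeparable F E] {p : Place F} {w : E} {u : F}

omit [FiniteDimensional F E] [Algebra.IsSeparable F E] in
lemma minpoly_eq_of_sq (h2 : Module.finrank F E = 2) (hw : F⟮w⟯ = ⊤) (hu : u ∈ p.ring)
    (hwu : w ^ 2 = algebraMap F E u) :
    minpoly F w = (X ^ 2 - C ⟨u, hu⟩ : p.ring[X]).map (algebraMap p.ring F) := by
  have hm : (X ^ 2 - C ⟨u, hu⟩ : p.ring[X]).Monic := monic_X_pow_sub_C _ two_ne_zero
  apply minpoly_eq_of_natDegree_eq_finrank hw (hm.map _)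
  · rw [hm.natDegree_map, natDegree_X_pow_sub_C, h2]
  · simp [hwu]

lemma irreducible_of_not_isSquare {κ : Type*} [Field κ] {β : κ} (h : ¬ IsSquare β) :
    Irreducible (X ^ 2 - C β) := by
  rw [X_pow_sub_C_irreducible_iff_of_prime Nat.prime_two]
  exact fun b hb => h ⟨b, by rw [← hb, sq]⟩

lemma inert_of_not_isSquare (h2 : Module.finrank F E = 2) (hw : F⟮w⟯ = ⊤) (hu : u ∈ p.ring)
    (hwu : w ^ 2 = algebraMap F E u) (hsq : ¬ IsSquare (p.res u)) : p.Inert E := by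
  obtain ⟨g, hg⟩ : ∃ g : p.ring[X], g = X ^ 2 - C ⟨u, hu⟩ := ⟨_, rfl⟩
  have hm : g.Monic := hg ▸ monic_X_pow_sub_C _ two_ne_zero
  have hmin : minpoly F w = g.map (algebraMap p.ring F) := hg ▸ minpoly_eq_of_sq h2 hw hu hwu
  have hd : g.natDegree = 2 := by rw [hg, natDegree_X_pow_sub_C]
  have hirr : Irreducible (g.map (IsLocalRing.residue p.ring)) := by
    have := irreducible_of_not_isSquare hsq
    rw [p.res_of_mem hu] at this
    simpa [hg] using this
  obtain ⟨P, hP, hwP, h0⟩ := exists_above_of_not_isCoprime hm hmin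
    (H := g) (fun h => hirr.not_isUnit (isCoprime_self.1 h))
  have hf := natDegree_le_f hP hwP hm hirr h0
  rw [hd] at hf
  obtain ⟨-, hall, hef⟩ := signature_of_le (p := p) [(P, 1, 2)] (by simp)
    (by simpa [hP, Nat.succ_le_iff, hf] using e_pos hP) (by simp [h2])
  refine ⟨P, Set.ext fun Q => by simpa using hall Q, ?_⟩
  simpa using (hef _ (List.mem_singleton_self _)).1

lemma completelySplit_of_isSquare [CharP F 3] (h2 : Module.finrank F E = 2) (hw : F⟮w⟯ = ⊤)
    (hu : u ∈ p.ring) (hwu : w ^ 2 = algebraMap F E u) (hu0 : p.res u ≠ 0)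
    (hsq : IsSquare (p.res u)) : p.CompletelySplit E := by
  have := p.charP_residueField
  have k3 : (3 : p.ResidueField) = 0 := by exact_mod_cast CharP.cast_eq_zero p.ResidueField 3
  have hm : (X ^ 2 - C ⟨u, hu⟩ : p.ring[X]).Monic := monic_X_pow_sub_C _ two_ne_zero
  obtain ⟨β, hβ⟩ := hsq
  obtain ⟨r, hr, rfl⟩ := p.res_surjective β
  obtain ⟨P₁, hP₁, -, hm₁⟩ := exists_above_of_root hm (minpoly_eq_of_sq h2 hw hu hwu) hr
    (by simp [← p.res_of_mem hu, hβ, sq])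
  obtain ⟨P₂, hP₂, -, hm₂⟩ := exists_above_of_root hm (minpoly_eq_of_sq h2 hw hu hwu) (neg_mem hr)
    (by simp [← p.res_of_mem hu, p.res_neg hr, hβ, sq])
  have hne : P₁ ≠ P₂ := by
    rintro rfl
    have := res_eq_of_sub_mem hP₁ hr (neg_mem hr) hm₁ hm₂
    rw [p.res_neg hr] at this
    apply hu0
    rw [hβ]
    linear_combination -p.res r * this + p.res r ^ 2 * k3
  obtain ⟨-, hall, -⟩ := signature_of_le (p := p) [(P₁, 1, 1), (P₂, 1, 1)] (by simp [hne])
    (by simp [hP₁, hP₂, Nat.succ_le_iff, e_pos hP₁, e_pos hP₂, f_pos hP₁, f_pos hP₂])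
    (by simp [h2])
  have : p.above E = {P₁, P₂} := Set.ext fun Q => by simpa using hall Q
  rw [CompletelySplit, this, Set.ncard_pair hne, h2]

lemma ramified_of_isCoprime_ord (hwu : w ^ 2 = algebraMap F E u) (hodd : IsCoprime (p.ord u) 2) :
    p.Ramified E := by
  obtain ⟨P, hP⟩ := p.above_nonempty E
  refine ⟨P, hP, ?_⟩
  have h := ord_algebraMap hP u
  rw [← hwu, ord_pow] at h
  have hdvd : (2 : ℤ) ∣ P.e F := hodd.symm.dvd_of_dvd_mul_right ⟨P.ord w, by rw [← h]; norm_num⟩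
  exact Nat.le_of_dvd (e_pos hP) (by exact_mod_cast hdvd)

end Quadratic

end Place

section Adjoin

variable {F E Ω : Type*} [Field F] [Field E] [Field Ω] [Algebra F E] [Algebra F Ω]

lemma finrank_adjoin_sqrt {u : F} {b : Ω} (hb : b ^ 2 = algebraMap F Ω u) (hu : ¬ IsSquare u) :
    Module.finrank F F⟮b⟯ = 2 := by
  have h0 : aeval b (X ^ 2 - C u) = 0 := by simp [hb]
  have hmon : (X ^ 2 - C u).Monic := monic_X_pow_sub_C _ two_ne_zero
  rw [adjoin.finrank ⟨_, hmon, h0⟩, ← minpoly.eq_of_irreducible_of_monic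
    (Place.irreducible_of_not_isSquare hu) h0 hmon, natDegree_X_pow_sub_C]

lemma isSeparable_adjoin_sqrt [CharP F 3] {u : F} {b : Ω} (hb : b ^ 2 = algebraMap F Ω u)
    (hu : u ≠ 0) : Algebra.IsSeparable F F⟮b⟯ := by
  rw [isSeparable_adjoin_simple_iff_isSeparable]
  have h2 : ((2 : ℕ) : F) ≠ 0 := by
    rw [Ne, CharP.cast_eq_zero_iff F 3]; decide
  exact (separable_X_pow_sub_C u h2 hu).of_dvd (minpoly.dvd _ _ (by simp [hb]))

/-- A cubic extension has no quadratic subextension. -/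
lemma not_isSquare_algebraMap (h3 : Module.finrank F E = 3) {u : F} (hu : ¬ IsSquare u) :
    ¬ IsSquare (algebraMap F E u) := by
  rintro ⟨t, ht⟩
  have h := finrank_adjoin_sqrt (b := t) (by rw [ht, sq]) hu
  have h' := Module.finrank_mul_finrank F F⟮t⟯ E
  rw [h, h3] at h'
  omega

end Adjoin

/-! ### Changing the generator and reaching a local standard form. -/

section Parameters

variable {K L : Type*} [Field K] [Field L] [Algebra K L]

/-- Scaling by `t` gives the coefficients `t²a` and `t³g`; the second is the square of the first
exactly for `t = g/a²` (when `g ≠ 0`). -/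
lemma isCubicGen_of_root (h3 : Module.finrank K L = 3) {u : L} {a g : K} (hu : K⟮u⟯ = ⊤)
    (ha : a ≠ 0) (h0 : u ^ 3 + algebraMap K L a * u + algebraMap K L g = 0) :
    g ≠ 0 ∧ IsCubicGen (algebraMap K L (g / a ^ 2) * u) (g ^ 2 / a ^ 3) := by
  have hmin : minpoly K u = X ^ 3 + C a * X + C g :=
    minpoly_eq_of_natDegree_eq_finrank hu (by monicity!)
      (by rw [h3]; compute_degree!) (by simpa using h0)
  have hu0 : u ≠ 0 := by
    rintro rfl
    have h := congrArg natDegree hmin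
    rw [minpoly.zero, natDegree_X, show (X ^ 3 + C a * X + C g : K[X]).natDegree = 3 by compute_degree!]
      at h
    omega
  have hi : IsIntegral K u := ⟨X ^ 3 + C a * X + C g, by monicity!, by simpa using h0⟩
  have hg : g ≠ 0 := by
    have := minpoly.coeff_zero_ne_zero hi hu0
    rw [hmin] at this
    simpa using this
  have ht : g / a ^ 2 ≠ 0 := div_ne_zero hg (pow_ne_zero 2 ha)
  have ht' : algebraMap K L (g / a ^ 2) ≠ 0 := by simpa using ht
  have htop : K⟮algebraMap K L (g / a ^ 2) * u⟯ = ⊤ := by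
    refine adjoin_eq_top_of_mem hu ?_
    have := div_mem (mem_adjoin_simple_self K (algebraMap K L (g / a ^ 2) * u))
      (K⟮algebraMap K L (g / a ^ 2) * u⟯.algebraMap_mem (g / a ^ 2))
    rwa [mul_div_cancel_left₀ _ ht'] at this
  refine ⟨hg, htop, minpoly_eq_of_natDegree_eq_finrank htop (by monicity!)
      (by rw [h3]; compute_degree!) ?_⟩
  have ha' : algebraMap K L a ≠ 0 := by simpa using ha
  simp only [map_add, map_mul, map_pow, aeval_X, aeval_C, map_div₀]
  field_simp
  linear_combination algebraMap K L g ^ 3 * h0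

/-- The element `ja² + (w³ + aw)`. -/
def shiftConst (a : K) (j : ℕ) (w : K) : K := (j : K) * a ^ 2 + (w ^ 3 + a * w)

namespace IsCubicGen

variable [CharP K 3] {y : L} {a : K}

/-- The generator `jy - w` has the same linear coefficient `a` and constant term `shiftConst a j w`,
because cubing is additive and `j³ = j` in characteristic 3. -/
lemma exists_transParam (hy : IsCubicGen y a) {j : ℕ} (hj : j = 1 ∨ j = 2) (w : K) :
    shiftConst a j w ≠ 0 ∧ ∃ z : L, IsCubicGen z (transParam a j w) := by
  have : CharP L 3 := charP_of_injective_algebraMap (algebraMap K L).injective 3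
  have L3 : (3 : L) = 0 := by exact_mod_cast CharP.cast_eq_zero L 3
  have hjj : (j : L) * j = 1 ∧ (j : L) ^ 3 = j := by
    rcases hj with rfl | rfl
    · simp
    · constructor
      · push_cast; linear_combination L3
      · push_cast; linear_combination 2 * L3
  have htop : K⟮(j : L) * y - algebraMap K L w⟯ = ⊤ := by
    refine adjoin_eq_top_of_mem hy.1 ?_
    have := mul_mem (_root_.natCast_mem K⟮(j : L) * y - algebraMap K L w⟯ j)
      (add_mem (mem_adjoin_simple_self K ((j : L) * y - algebraMap K L w))
        (K⟮(j : L) * y - algebraMap K L w⟯.algebraMap_mem w))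
    rwa [sub_add_cancel, ← mul_assoc, hjj.1, one_mul] at this
  have h0 : ((j : L) * y - algebraMap K L w) ^ 3 + algebraMap K L a *
      ((j : L) * y - algebraMap K L w) + algebraMap K L (shiftConst a j w) = 0 := by
    simp only [shiftConst, map_add, map_mul, map_pow, map_natCast]
    linear_combination (j : L) * hy.eq_zero + y ^ 3 * hjj.2 +
      ((j : L) * y * algebraMap K L w ^ 2 - (j : L) ^ 2 * y ^ 2 * algebraMap K L w) * L3
  obtain ⟨h1, h2⟩ := isCubicGen_of_root hy.finrank_eq htop hy.ne_zero h0
  exact ⟨h1, _, h2⟩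

lemma ord_transParam (hy : IsCubicGen y a) {j : ℕ} (hj : j = 1 ∨ j = 2) (w : K) (p : Place K) :
    p.ord (transParam a j w) = 2 * p.ord (shiftConst a j w) - 3 * p.ord a := by
  have h := (hy.exists_transParam hj w).1
  change p.ord (shiftConst a j w ^ 2 / a ^ 3) = _
  rw [p.ord_div (pow_ne_zero 2 h) (pow_ne_zero 3 hy.ne_zero), Place.ord_pow, Place.ord_pow]
  norm_num

/-- If `v(α) < 0` is divisible by `3` for a transformed parameter `α`, it can be increased. -/
lemma exists_ord_lt (hy : IsCubicGen y a) (p : Place K) [Finite p.ResidueField] (w : K)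
    (hneg : p.ord (transParam a 1 w) < 0) (hdvd : 3 ∣ p.ord (transParam a 1 w)) :
    ∃ w', p.ord (shiftConst a 1 w) < p.ord (shiftConst a 1 w') := by
  have := p.charP_residueField
  have K3 : (3 : K) = 0 := by exact_mod_cast CharP.cast_eq_zero K 3
  have hg0 := (hy.exists_transParam (.inl rfl) w).1
  rw [hy.ord_transParam (.inl rfl)] at hneg hdvd
  obtain ⟨g, hg⟩ : ∃ g, g = shiftConst a 1 w := ⟨_, rfl⟩
  rw [← hg] at hneg hdvd hg0 ⊢
  -- Divisibility of `2v(g) - 3v(a)` by 3 gives `3 ∣ v(g)`. Then `g/s³` is a unit whose negative is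
  -- a cube modulo `𝔭`.
  obtain ⟨m, hm⟩ : ∃ m, p.ord g = 3 * m := ⟨p.ord g - 2 * ((p.ord g) / 3), by omega⟩
  obtain ⟨s, hs0, hs⟩ := p.exists_ord_eq m
  have hs3 : s ^ 3 ≠ 0 := pow_ne_zero 3 hs0
  have h1 : g / s ^ 3 ∈ p.ring := by
    rw [p.mem_ring_iff (div_ne_zero hg0 hs3), p.ord_div hg0 hs3, p.ord_pow, hm, hs]
    norm_num
  obtain ⟨ρ, hρ⟩ := (Finite.injective_iff_surjective.1 (frobenius_inj p.ResidueField 3))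
    (-p.res (g / s ^ 3))
  obtain ⟨τ, hτ, rfl⟩ := p.res_surjective ρ
  rw [frobenius_def] at hρ
  have h2 : g / s ^ 3 + τ ^ 3 ∈ p.ring.nonunits := by
    rw [← p.res_eq_zero_iff (add_mem h1 (pow_mem hτ 3)), p.res_add h1 (pow_mem hτ 3),
      p.res_pow hτ, hρ, add_neg_cancel]
  -- Negativity of `v(α) = 6m - 3v(a)` means `2m < v(a)`, so the linear term does not disturb the
  -- cancellation of `g` against `(sτ)³`.
  have h3 : a / s ^ 2 ∈ p.ring.nonunits := by
    have ha := hy.ne_zero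
    rw [p.mem_nonunits_iff (div_ne_zero ha (pow_ne_zero 2 hs0)), p.ord_div ha (pow_ne_zero 2 hs0),
      p.ord_pow, hs]
    push_cast
    omega
  have h4 := add_mem h2 (p.mul_mem_nonunits h3 hτ)
  have h5 : g / s ^ 3 + τ ^ 3 + a / s ^ 2 * τ = shiftConst a 1 (w + s * τ) / s ^ 3 := by
    rw [hg, shiftConst, shiftConst]
    field_simp
    linear_combination -(w ^ 2 * s * τ + w * s ^ 2 * τ ^ 2) * K3
  have hg1 := (hy.exists_transParam (.inl rfl) (w + s * τ)).1
  rw [h5, p.mem_nonunits_iff (div_ne_zero hg1 hs3), p.ord_div hg1 hs3, p.ord_pow, hs] at h4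
  refine ⟨w + s * τ, ?_⟩
  push_cast at h4
  omega

/-- If every parameter were negative at `p`, then `2v(g) < 3v(a)` would bound `v(g)`, and
`exists_ord_lt` would contradict a maximal choice. The choice `j = 1` suffices. -/
lemma exists_ord_nonneg (hy : IsCubicGen y a) (p : Place K) [Finite p.ResidueField]
    (h : ¬ HasRamifiedParam p a) : ∃ (z : L) (c : K), IsCubicGen z c ∧ 0 ≤ p.ord c := by
  by_contra! hcon
  have hneg : ∀ w, p.ord (transParam a 1 w) < 0 := fun w => by
    obtain ⟨z, hz⟩ := (hy.exists_transParam (.inl rfl) w).2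
    exact hcon z _ hz
  have hdvd : ∀ w, 3 ∣ p.ord (transParam a 1 w) := fun w => by
    by_contra hd
    refine h ⟨1, .inl rfl, w, hneg w, ?_⟩
    exact ((Int.prime_three.coprime_iff_not_dvd).2 hd).symm
  obtain ⟨n, ⟨w, hw⟩, hmax⟩ := Int.exists_greatest_of_bdd
    (P := fun n => ∃ w, p.ord (shiftConst a 1 w) = n)
    ⟨2 * |p.ord a|, by
      rintro _ ⟨w, rfl⟩
      have := hneg w
      rw [hy.ord_transParam (.inl rfl)] at this
      have := le_abs_self (p.ord a)
      have := abs_nonneg (p.ord a)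
      omega⟩ ⟨_, 0, rfl⟩
  obtain ⟨w', hw'⟩ := hy.exists_ord_lt p w (hneg w) (hdvd w)
  have := hmax _ ⟨w', rfl⟩
  omega

end IsCubicGen

end Parameters

/-! ### Decomposition in `F(b)` for `b² = u`. -/

section SquareRoot

variable {F Ω : Type*} [Field F] [Field Ω] [Algebra F Ω]

lemma adjoin_gen_eq_top (b : Ω) : F⟮AdjoinSimple.gen F b⟯ = ⊤ := by
  apply IntermediateField.lift_injective
  rw [lift_adjoin_simple, lift_top]
  rfl

variable [CharP F 3] {u : F} {b : Ω} (hb : b ^ 2 = algebraMap F Ω u) (hu : ¬ IsSquare u)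

omit [CharP F 3] in
include hb in
-- Multiplying `b` by `t` changes the radicand by a square; this is how a radicand of even order is
-- made a unit.
lemma exists_scaled_gen {t : F} (ht : t ≠ 0) : ∃ w : F⟮b⟯, F⟮w⟯ = ⊤ ∧
    w ^ 2 = algebraMap F F⟮b⟯ (t ^ 2 * u) := by
  have ht' : algebraMap F F⟮b⟯ t ≠ 0 := by simpa using ht
  refine ⟨algebraMap F F⟮b⟯ t * AdjoinSimple.gen F b,
    adjoin_eq_top_of_mem (adjoin_gen_eq_top b) ?_, ?_⟩
  · have := div_mem (mem_adjoin_simple_self F (algebraMap F F⟮b⟯ t * AdjoinSimple.gen F b))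
      (F⟮algebraMap F F⟮b⟯ t * AdjoinSimple.gen F b⟯.algebraMap_mem t)
    rwa [mul_div_cancel_left₀ _ ht'] at this
  · apply Subtype.ext
    simp [mul_pow, hb]

include hb hu

omit [CharP F 3] in
lemma finiteDimensional_adjoin_sqrt : FiniteDimensional F F⟮b⟯ :=
  Module.finite_of_finrank_pos (by rw [finrank_adjoin_sqrt hb hu]; norm_num)

namespace Place

variable {P : Place F}

lemma inert_adjoin_sqrt {t : F} (ht : t ≠ 0) (hm : t ^ 2 * u ∈ P.ring)
    (hsq : ¬ IsSquare (P.res (t ^ 2 * u))) : P.Inert F⟮b⟯ := by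
  have := finiteDimensional_adjoin_sqrt hb hu
  have := isSeparable_adjoin_sqrt hb (by rintro rfl; exact hu ⟨0, by simp⟩)
  obtain ⟨w, hw, hwu⟩ := exists_scaled_gen hb ht
  exact inert_of_not_isSquare (finrank_adjoin_sqrt hb hu) hw hm hwu hsq

lemma completelySplit_adjoin_sqrt {t : F} (ht : t ≠ 0) (hm : t ^ 2 * u ∈ P.ring)
    (h0 : P.res (t ^ 2 * u) ≠ 0) (hsq : IsSquare (P.res (t ^ 2 * u))) :
    P.CompletelySplit F⟮b⟯ := by
  have := finiteDimensional_adjoin_sqrt hb hu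
  have := isSeparable_adjoin_sqrt hb (by rintro rfl; exact hu ⟨0, by simp⟩)
  obtain ⟨w, hw, hwu⟩ := exists_scaled_gen hb ht
  exact completelySplit_of_isSquare (finrank_adjoin_sqrt hb hu) hw hm hwu h0 hsq

lemma ramified_adjoin_sqrt (hodd : IsCoprime (P.ord u) 2) : P.Ramified F⟮b⟯ := by
  have := finiteDimensional_adjoin_sqrt hb hu
  have := isSeparable_adjoin_sqrt hb (by rintro rfl; exact hu ⟨0, by simp⟩)
  obtain ⟨w, -, hwu⟩ := exists_scaled_gen hb one_ne_zero
  exact ramified_of_isCoprime_ord (by rw [hwu, one_pow, one_mul]) hodd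

end Place

end SquareRoot

/-! ### Non-squares at a place and the unramified and ramified types. -/

namespace Place

section Classification

variable {K L : Type*} [Field K] [Field L] [Algebra K L] {p : Place K}

lemma not_isSquare_of_odd_ord {u : K} (h : IsCoprime (p.ord u) 2) : ¬ IsSquare u := by
  rintro ⟨t, rfl⟩
  rw [← sq, ord_pow] at h
  have := h.isUnit_of_dvd' (x := 2) ⟨_, rfl⟩ dvd_rfl
  exact absurd this (by decide)

lemma not_isSquare_of_res {s u : K} (h0 : p.ord (s ^ 2 * u) = 0)
    (h : ¬ IsSquare (p.res (s ^ 2 * u))) : ¬ IsSquare u := by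
  rintro ⟨t, rfl⟩
  apply h
  have h1 : s ^ 2 * (t * t) = (s * t) ^ 2 := by ring
  rw [h1] at h0 ⊢
  rw [ord_pow] at h0
  have hm : s * t ∈ p.ring := p.mem_ring_of_ord (by push_cast at h0; omega)
  exact ⟨p.res (s * t), by rw [p.res_pow hm, sq]⟩

variable [FiniteDimensional K L] [Algebra.IsSeparable K L]

/-- A square root in the residue field of `P` would have degree 2 over that of `p`, against `f = 1`.
-/
lemma not_isSquare_res_algebraMap {P : Place L} (hP : P ∈ p.above L) (hf : P.f K = 1) {u : K}
    (hu : u ∈ p.ring) (h : ¬ IsSquare (p.res u)) : ¬ IsSquare (P.res (algebraMap K L u)) := by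
  rw [P.isSquare_res_iff ((mem_above hP u).2 hu)]
  rintro ⟨v, hv, hvu⟩
  have hirr : Irreducible ((X ^ 2 - C ⟨u, hu⟩ : p.ring[X]).map (IsLocalRing.residue p.ring)) := by
    simpa [← p.res_of_mem hu] using irreducible_of_not_isSquare h
  have := natDegree_le_f hP hv (monic_X_pow_sub_C _ two_ne_zero) hirr
    (by simp only [map_sub, map_pow, aeval_X, aeval_C]; exact hvu)
  rw [natDegree_X_pow_sub_C, hf] at this
  omega

end Classification

end Place

namespace IsCubicGen

variable {K L : Type*} [Field K] [Field L] [Algebra K L] [FiniteDimensional K L]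
  [Algebra.IsSeparable K L] [CharP K 3] {p : Place K} {z : L} {c : K}

omit [FiniteDimensional K L] [Algebra.IsSeparable K L] [CharP K 3] in
lemma scale (hz : IsCubicGen z c) {s : K} (hs : s ≠ 0) :
    K⟮algebraMap K L s * z⟯ = ⊤ ∧ (algebraMap K L s * z) ^ 3 +
      algebraMap K L (s ^ 2 * c) * (algebraMap K L s * z) + algebraMap K L (s ^ 3 * c ^ 2) = 0 := by
  have hs' : algebraMap K L s ≠ 0 := by simpa using hs
  refine ⟨adjoin_eq_top_of_mem hz.1 ?_, ?_⟩
  · have := div_mem (mem_adjoin_simple_self K (algebraMap K L s * z))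
      (K⟮algebraMap K L s * z⟯.algebraMap_mem s)
    rwa [mul_div_cancel_left₀ _ hs'] at this
  · simp only [map_mul, map_pow]
    linear_combination algebraMap K L s ^ 3 * hz.eq_zero

omit [FiniteDimensional K L] [Algebra.IsSeparable K L] [CharP K 3] in
lemma scaled_ord (hz : IsCubicGen z c) {s : K} (hs : s ≠ 0) (h0 : p.ord (s ^ 2 * c) = 0) :
    2 * p.ord s = -p.ord c ∧ 2 * p.ord (s ^ 3 * c ^ 2) = p.ord c := by
  have hc := hz.ne_zero
  rw [p.ord_mul (pow_ne_zero 2 hs) hc, Place.ord_pow] at h0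
  rw [p.ord_mul (pow_ne_zero 3 hs) (pow_ne_zero 2 hc), Place.ord_pow, Place.ord_pow]
  push_cast at h0 ⊢
  constructor <;> omega

variable {Ω : Type*} [Field Ω] [Algebra L Ω] {b : Ω}
  (hb : b ^ 2 = algebraMap L Ω (algebraMap K L (-c)))

include hb in
-- Serves both `v(c) = 0` (with `s = 1`) and `v(c)` positive and even. At `P₁` the residue degree is
-- 1, so `-s²c` stays a non-square; at `P₂` the linear factor's shift `v` supplies its square root.
lemma exists_above_of_not_isSquare [Finite p.ResidueField] (hz : IsCubicGen z c)
    (hc : 0 ≤ p.ord c) {s : K} (hs : s ≠ 0) (h0 : p.ord (s ^ 2 * c) = 0)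
    (hsq : ¬ IsSquare (p.res (-(s ^ 2 * c)))) :
    p.HasSignature L [(1, 1), (1, 2)] ∧ Module.finrank L L⟮b⟯ = 2 ∧
    ∃ P₁ P₂ : Place L, P₁ ≠ P₂ ∧ (∀ P, P ∈ p.above L ↔ P = P₁ ∨ P = P₂) ∧
      P₁.e K = 1 ∧ P₁.f K = 1 ∧ P₂.e K = 1 ∧ P₂.f K = 2 ∧
      P₁.Inert L⟮b⟯ ∧ P₂.CompletelySplit L⟮b⟯ := by
  have : CharP L 3 := charP_of_injective_algebraMap (algebraMap K L).injective 3
  have hd0 : s ^ 2 * c ≠ 0 := mul_ne_zero (pow_ne_zero 2 hs) hz.ne_zero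
  have hd : s ^ 2 * c ∈ p.ring := (p.mem_ring_iff hd0).2 h0.ge
  have hg : s ^ 3 * c ^ 2 ∈ p.ring := p.mem_ring_of_ord (by have := hz.scaled_ord hs h0; omega)
  have hdu := (p.res_ne_zero_iff hd0 hd).2 h0
  have hneg : s ^ 2 * -c = -(s ^ 2 * c) := by ring
  have hnegL : algebraMap K L s ^ 2 * algebraMap K L (-c) = algebraMap K L (-(s ^ 2 * c)) := by
    rw [← hneg, map_mul, map_pow]
  obtain ⟨P₁, P₂, hne, hall, he₁, hf₁, he₂, hf₂, hsig, v, hv, hvd⟩ :=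
    Place.exists_above_of_cubic_not_isSquare hz.finrank_eq (hz.scale hs).1 hd hg (hz.scale hs).2 hdu
      (by rwa [← p.res_neg hd])
  have hP₁ := (hall P₁).2 (.inl rfl)
  have hP₂ := (hall P₂).2 (.inr rfl)
  have hns : ¬ IsSquare (-c) := Place.not_isSquare_of_res (p := p)
    (by rw [hneg, Place.ord_neg, h0]) (by rwa [hneg])
  have hnsL := not_isSquare_algebraMap hz.finrank_eq hns
  have hs' : algebraMap K L s ≠ 0 := by simpa using hs
  refine ⟨hsig, finrank_adjoin_sqrt hb hnsL, P₁, P₂, hne, hall, he₁, hf₁, he₂, hf₂,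
    Place.inert_adjoin_sqrt hb hnsL hs' ?_ ?_, Place.completelySplit_adjoin_sqrt hb hnsL hs' ?_ ?_ ?_⟩
  · rw [hnegL, Place.mem_above hP₁]
    exact neg_mem hd
  · rw [hnegL]
    exact Place.not_isSquare_res_algebraMap hP₁ hf₁ (neg_mem hd) hsq
  · rw [hnegL, Place.mem_above hP₂]
    exact neg_mem hd
  · rw [hnegL, Ne, P₂.res_eq_zero_iff ((Place.mem_above hP₂ _).2 (neg_mem hd)),
      Place.algebraMap_mem_nonunits hP₂, ← p.res_eq_zero_iff (neg_mem hd), p.res_neg hd, neg_eq_zero]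
    exact hdu
  · rw [hnegL, P₂.isSquare_res_iff ((Place.mem_above hP₂ _).2 (neg_mem hd))]
    exact ⟨v, hv, by rwa [map_neg, sub_neg_eq_add]⟩

include hb in
-- Up to the square `r²`, the radicand `-c` is `1 - r`, which reduces to 1 at `P₁`; so `P₁` splits.
-- At `P₂` the order of `-c` is unchanged, hence odd.
lemma exists_above_of_odd (hz : IsCubicGen z c) (hc : 0 < p.ord c)
    (hodd : IsCoprime (p.ord c) 2) :
    p.HasSignature L [(2, 1), (1, 1)] ∧ Module.finrank L L⟮b⟯ = 2 ∧
    ∃ P₁ P₂ : Place L, P₁ ≠ P₂ ∧ (∀ P, P ∈ p.above L ↔ P = P₁ ∨ P = P₂) ∧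
      P₁.e K = 2 ∧ P₁.f K = 1 ∧ P₂.e K = 1 ∧ P₂.f K = 1 ∧
      P₁.CompletelySplit L⟮b⟯ ∧ P₂.Ramified L⟮b⟯ := by
  have : CharP L 3 := charP_of_injective_algebraMap (algebraMap K L).injective 3
  obtain ⟨P₁, P₂, hne, hall, he₁, hf₁, he₂, hf₂, hsig, r, hr0, hr, hcr⟩ :=
    Place.exists_above_of_odd_ord hz hc hodd
  have hns : ¬ IsSquare (-c) := Place.not_isSquare_of_odd_ord (p := p) (by rwa [Place.ord_neg])
  have hnsL := not_isSquare_algebraMap hz.finrank_eq hns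
  have hu : r⁻¹ ^ 2 * algebraMap K L (-c) = 1 - r := by rw [hcr]; field_simp
  have hrm : r ∈ P₁.ring := P₁.ring.nonunits_subset hr
  have hres : P₁.res (1 - r) = 1 := by
    rw [P₁.res_sub (one_mem _) hrm, P₁.res_one, (P₁.res_eq_zero_iff hrm).2 hr, sub_zero]
  refine ⟨hsig, finrank_adjoin_sqrt hb hnsL, P₁, P₂, hne, hall, he₁, hf₁, he₂, hf₂,
    Place.completelySplit_adjoin_sqrt hb hnsL (inv_ne_zero hr0) ?_ ?_ ?_,
    Place.ramified_adjoin_sqrt hb hnsL ?_⟩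
  · rw [hu]; exact sub_mem (one_mem _) hrm
  · rw [hu, hres]; exact one_ne_zero
  · rw [hu, hres]; exact ⟨1, by simp⟩
  · rw [Place.ord_algebraMap ((hall P₂).2 (.inr rfl)), he₂, Place.ord_neg]
    simpa using hodd

omit hb
variable [Finite p.ResidueField] (hz : IsCubicGen z c)
include hz

lemma hasSignature_of_ord_eq_zero (hc : p.ord c = 0) {β : p.ResidueField}
    (hβ : β ^ 2 = p.res (-c)) :
    (p.tr β = 0 → p.HasSignature L [(1, 1), (1, 1), (1, 1)]) ∧
    (p.tr β ≠ 0 → p.HasSignature L [(1, 3)]) := by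
  have hm : c ∈ p.ring := p.mem_ring_of_ord hc.ge
  have hu := (p.res_ne_zero_iff hz.ne_zero hm).2 hc
  rw [p.res_neg hm] at hβ
  have hβ0 : β ≠ 0 := by rintro rfl; exact hu (by simpa using hβ.symm)
  have h := Place.hasSignature_of_cubic_isSquare hz.finrank_eq hz.1 hm (pow_mem hm 2)
    (by rw [map_pow]; exact hz.eq_zero) hβ0 hβ
  -- As `c² ≡ β⁴`, the Artin–Schreier constant is `β` itself.
  have : p.res (c ^ 2) / β ^ 3 = β := by
    rw [p.res_pow hm, ← neg_sq, ← hβ]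
    field_simp
  rwa [this] at h

lemma hasSignature_of_isSquare (hc : 0 < p.ord c) {s : K} (hs : s ≠ 0)
    (h0 : p.ord (s ^ 2 * c) = 0) (hsq : IsSquare (p.res (-(s ^ 2 * c)))) :
    p.HasSignature L [(1, 1), (1, 1), (1, 1)] := by
  have hd0 : s ^ 2 * c ≠ 0 := mul_ne_zero (pow_ne_zero 2 hs) hz.ne_zero
  have hd : s ^ 2 * c ∈ p.ring := (p.mem_ring_iff hd0).2 h0.ge
  have hgo := (hz.scaled_ord hs h0).2
  have hg : s ^ 3 * c ^ 2 ∈ p.ring := p.mem_ring_of_ord (by omega)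
  -- The constant term has order `v(c)/2 > 0`, so the trace condition holds trivially.
  have hg0 : p.res (s ^ 3 * c ^ 2) = 0 := by
    rw [p.res_eq_zero_iff hg, p.mem_nonunits_iff
      (mul_ne_zero (pow_ne_zero 3 hs) (pow_ne_zero 2 hz.ne_zero))]
    omega
  have hdu := (p.res_ne_zero_iff hd0 hd).2 h0
  obtain ⟨β, hβ⟩ := hsq
  rw [p.res_neg hd] at hβ
  have hβ0 : β ≠ 0 := by rintro rfl; exact hdu (by simpa using hβ)
  refine (Place.hasSignature_of_cubic_isSquare hz.finrank_eq (hz.scale hs).1 hd hg (hz.scale hs).2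
    hβ0 (by rw [hβ, sq])).1 ?_
  rw [hg0, zero_div]
  exact map_zero _

end IsCubicGen

/-! ### A transcendental element integral at the place. -/

section FunctionField

lemma exists_transcendental_finiteDimensional (k K : Type*) [Field k] [Field K] [Algebra k K]
    [Algebra (RatFunc k) K] [IsScalarTower k (RatFunc k) K] [FunctionField k K] :
    ∃ t : K, Transcendental k t ∧ FiniteDimensional k⟮t⟯ K := by
  refine ⟨algebraMap (RatFunc k) K RatFunc.X,
    (transcendental_algebraMap_iff (algebraMap (RatFunc k) K).injective).2
      RatFunc.transcendental_X, ?_⟩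
  have hmap : (⊤ : IntermediateField k (RatFunc k)).map (IsScalarTower.toAlgHom k (RatFunc k) K) =
      k⟮algebraMap (RatFunc k) K RatFunc.X⟯ := by
    rw [← RatFunc.adjoin_X, adjoin_map, Set.image_singleton]
    rfl
  have hmem (r : RatFunc k) : algebraMap (RatFunc k) K r ∈
      k⟮algebraMap (RatFunc k) K RatFunc.X⟯ := hmap.le ⟨r, trivial, rfl⟩
  let : Algebra (RatFunc k) k⟮algebraMap (RatFunc k) K RatFunc.X⟯ :=
    ((algebraMap (RatFunc k) K).codRestrict
      k⟮algebraMap (RatFunc k) K RatFunc.X⟯.toSubfield hmem).toAlgebra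
  have : IsScalarTower (RatFunc k) k⟮algebraMap (RatFunc k) K RatFunc.X⟯ K :=
    IsScalarTower.of_algebraMap_eq fun _ => rfl
  have : Module.Finite (RatFunc k) K := ‹FunctionField k K›
  exact Module.Finite.of_restrictScalars_finite (RatFunc k) _ K

lemma Place.exists_transcendental_mem {k K : Type*} [Field k] [Field K] [Algebra k K]
    {t : K} (ht : Transcendental k t) (p : Place K) : ∃ x : K, Transcendental k x ∧ x ∈ p.ring := by
  rcases p.ring.mem_or_inv_mem t with h | h
  · exact ⟨t, ht, h⟩
  · exact ⟨t⁻¹, fun hi => ht (IsAlgebraic.inv_iff.1 hi), h⟩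

end FunctionField

/-! ### Reading decomposition types from signatures. -/

namespace Place.HasSignature

section Types

variable {K L : Type*} [Field K] [Field L] [Algebra K L] {p : Place K} {s : List (ℕ × ℕ)}
  (h : p.HasSignature L s)
include h

lemma fullyRamified_iff : p.FullyRamified L ↔ ∃ q ∈ s, q.1 = Module.finrank K L := by
  obtain ⟨l, -, hall, rfl⟩ := h
  simp [FullyRamified, ← hall]

lemma completelySplit_iff : p.CompletelySplit L ↔ s.length = Module.finrank K L := by
  classical
  obtain ⟨l, hnd, hall, rfl⟩ := h
  have : p.above L = (l.toFinset : Set (Place L)) := Set.ext fun P => by simp [hall]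
  rw [CompletelySplit, this, Set.ncard_coe_finset, List.toFinset_card_of_nodup hnd,
    List.length_map]

lemma inert_iff : p.Inert L ↔ ∃ f, s = [(1, f)] := by
  obtain ⟨l, hnd, hall, rfl⟩ := h
  constructor
  · rintro ⟨P, hP, he⟩
    have : l = [P] := List.perm_singleton.1 ((List.perm_ext_iff_of_nodup hnd (by simp)).2
      fun Q => by simp [hall, hP])
    exact ⟨P.f K, by simp [this, he]⟩
  · rintro ⟨f, hf⟩
    obtain ⟨P, rfl, hP⟩ := List.map_eq_singleton_iff.1 hf
    refine ⟨P, Set.ext fun Q => by simp [← hall], ?_⟩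
    exact congrArg Prod.fst hP

lemma f_eq_of_inert {f : ℕ} (hs : s = [(1, f)]) : ∀ P ∈ p.above L, P.f K = f := by
  obtain ⟨l, hnd, hall, rfl⟩ := h
  obtain ⟨P, rfl, hP⟩ := List.map_eq_singleton_iff.1 hs
  intro Q hQ
  obtain rfl : Q = P := by simpa [← hall] using hQ
  exact congrArg Prod.snd hP

lemma exists_pow_type_iff (a : ℕ) :
    (∃ P ∈ p.above L, (∀ Q ∈ p.above L, Q = P) ∧ P.e K = a) ↔ ∃ f, s = [(a, f)] := by
  obtain ⟨l, hnd, hall, rfl⟩ := h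
  constructor
  · rintro ⟨P, hP, hQ, he⟩
    have : l = [P] := List.perm_singleton.1 ((List.perm_ext_iff_of_nodup hnd (by simp)).2
      fun Q => by rw [hall, List.mem_singleton]; exact ⟨hQ Q, fun h => h ▸ hP⟩)
    exact ⟨P.f K, by simp [this, he]⟩
  · rintro ⟨f, hf⟩
    obtain ⟨P, rfl, hP⟩ := List.map_eq_singleton_iff.1 hf
    exact ⟨P, (hall P).1 (by simp), fun Q hQ => by simpa [← hall] using hQ,
      congrArg Prod.fst hP⟩

/-- Both orders occur because the enumeration underlying a signature is arbitrary. -/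
lemma exists_pow_mul_pow_type_iff (a b : ℕ) :
    (∃ P ∈ p.above L, ∃ Q ∈ p.above L, P ≠ Q ∧
      (∀ R ∈ p.above L, R = P ∨ R = Q) ∧ P.e K = a ∧ Q.e K = b) ↔
    ∃ f g, s = [(a, f), (b, g)] ∨ s = [(b, g), (a, f)] := by
  obtain ⟨l, hnd, hall, rfl⟩ := h
  constructor
  · rintro ⟨P, hP, Q, hQ, hPQ, hR, he, he'⟩
    have hperm : l.Perm [P, Q] := (List.perm_ext_iff_of_nodup hnd (by simp [hPQ])).2
      fun R => by
        rw [hall]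
        constructor
        · intro h; simpa using hR R h
        · intro h
          rcases (by simpa using h : R = P ∨ R = Q) with rfl | rfl
          exacts [hP, hQ]
    refine ⟨P.f K, Q.f K, ?_⟩
    rcases List.perm_pair.1 hperm with rfl | rfl
    · left; simp [he, he']
    · right; simp [he, he']
  · have hlen (x y : ℕ × ℕ) (hs : l.map (fun P => (P.e K, P.f K)) = [x, y]) :
        ∃ P Q, l = [P, Q] := by
      have := congrArg List.length hs
      rw [List.length_map] at this
      exact List.length_eq_two.1 this
    rintro ⟨f, g, hs | hs⟩ <;> obtain ⟨P, Q, rfl⟩ := hlen _ _ hs <;>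
      simp only [List.map_cons, List.map_nil, List.cons.injEq, Prod.mk.injEq, and_true] at hs <;>
      have hPQ : P ≠ Q := by simpa using hnd
    · exact ⟨P, (hall P).1 (by simp), Q, (hall Q).1 (by simp), hPQ,
        fun R hR => by simpa [← hall] using hR, hs.1.1, hs.2.1⟩
    · exact ⟨Q, (hall Q).1 (by simp), P, (hall P).1 (by simp), hPQ.symm,
        fun R hR => by simpa [← hall, or_comm] using hR, hs.2.1, hs.1.1⟩

end Types

end Place.HasSignature

/-! ### Trichotomies and the main theorem. -/

section Main

variable {K L : Type*} [Field K] [Field L] [Algebra K L] [FiniteDimensional K L]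
  [Algebra.IsSeparable K L] [CharP K 3] {p : Place K} {z : L} {c : K}

namespace IsCubicGen

variable [Finite p.ResidueField] (hz : IsCubicGen z c)
include hz

/-- The cases are exhaustive and their signatures pairwise different, so a decomposition type
determines its arithmetic condition by elimination. -/
lemma hasSignature_cases_of_ord_eq_zero (hc : p.ord c = 0) :
    ((∃ β, β ^ 2 = p.res (-c) ∧ p.tr β ≠ 0) ∧ p.HasSignature L [(1, 3)]) ∨
    ((∃ β, β ^ 2 = p.res (-c) ∧ p.tr β = 0) ∧ p.HasSignature L [(1, 1), (1, 1), (1, 1)]) ∨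
    (¬ IsSquare (p.res (-c)) ∧ p.HasSignature L [(1, 1), (1, 2)]) := by
  by_cases hsq : IsSquare (p.res (-c))
  · obtain ⟨β, hβ⟩ := hsq
    rw [← sq] at hβ
    have h := hz.hasSignature_of_ord_eq_zero hc hβ.symm
    by_cases htr : p.tr β = 0
    · exact .inr (.inl ⟨⟨β, hβ.symm, htr⟩, h.1 htr⟩)
    · exact .inl ⟨⟨β, hβ.symm, htr⟩, h.2 htr⟩
  · refine .inr (.inr ⟨hsq, ?_⟩)
    obtain ⟨b, hb⟩ := IsAlgClosed.exists_pow_nat_eq (n := 2)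
      (algebraMap L (AlgebraicClosure L) (algebraMap K L (-c))) (by norm_num)
    exact (hz.exists_above_of_not_isSquare hb hc.ge one_ne_zero (by simpa using hc)
      (by simpa using hsq)).1

lemma hasSignature_cases_of_ord_pos (hc : 0 < p.ord c) :
    ((2 ∣ p.ord c ∧ ∃ s : K, s ≠ 0 ∧ p.ord (-(s ^ 2 * c)) = 0 ∧
      IsSquare (p.res (-(s ^ 2 * c)))) ∧ p.HasSignature L [(1, 1), (1, 1), (1, 1)]) ∨
    ((2 ∣ p.ord c ∧ ∃ s : K, s ≠ 0 ∧ p.ord (s ^ 2 * c) = 0 ∧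
      ¬ IsSquare (p.res (-(s ^ 2 * c)))) ∧ p.HasSignature L [(1, 1), (1, 2)]) ∨
    (IsCoprime (p.ord c) 2 ∧ p.HasSignature L [(2, 1), (1, 1)]) := by
  obtain ⟨b, hb⟩ := IsAlgClosed.exists_pow_nat_eq (n := 2)
    (algebraMap L (AlgebraicClosure L) (algebraMap K L (-c))) (by norm_num)
  by_cases hdvd : 2 ∣ p.ord c
  · obtain ⟨m, hm⟩ := hdvd
    obtain ⟨s, hs, hsm⟩ := p.exists_ord_eq (-m)
    have h0 : p.ord (s ^ 2 * c) = 0 := by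
      rw [p.ord_mul (pow_ne_zero 2 hs) hz.ne_zero, Place.ord_pow, hsm, hm]
      push_cast; ring
    by_cases hsq : IsSquare (p.res (-(s ^ 2 * c)))
    · exact .inl ⟨⟨⟨m, hm⟩, s, hs, by rwa [Place.ord_neg], hsq⟩,
        hz.hasSignature_of_isSquare hc hs h0 hsq⟩
    · exact .inr (.inl ⟨⟨⟨m, hm⟩, s, hs, h0, hsq⟩,
        (hz.exists_above_of_not_isSquare hb hc.le hs h0 hsq).1⟩)
  · have hodd : IsCoprime (p.ord c) 2 := ((Int.prime_two.coprime_iff_not_dvd).2 hdvd).symm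
    exact .inr (.inr ⟨hodd, (hz.exists_above_of_odd hb hc hodd).1⟩)

lemma not_fullyRamified_of_ord_nonneg (hc : 0 ≤ p.ord c) : ¬ p.FullyRamified L := by
  have h3 := hz.finrank_eq
  rcases hc.eq_or_lt with hc | hc
  · rcases hz.hasSignature_cases_of_ord_eq_zero hc.symm with ⟨-, h⟩ | ⟨-, h⟩ | ⟨-, h⟩ <;>
      simp [h.fullyRamified_iff, h3]
  · rcases hz.hasSignature_cases_of_ord_pos hc with ⟨-, h⟩ | ⟨-, h⟩ | ⟨-, h⟩ <;>
      simp [h.fullyRamified_iff, h3]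

end IsCubicGen

end Main

theorem mainTheorem9 {k K L : Type*} [Field k] [Finite k] [CharP k 3]
    [Field K] [Algebra k K] [Algebra (RatFunc k) K] [IsScalarTower k (RatFunc k) K] [FunctionField k K]
    [Field L] [Algebra K L] [Algebra.IsSeparable K L] (hL : Module.finrank K L = 3)
    (y : L) (a : K) (hy : IsCubicGen y a) (p : Place K) :
    -- there is `x` such that `p` is a finite place over `k(x)`
    (∃ x : K, Transcendental k x ∧ x ∈ p.ring) ∧
    -- full ramification, in terms of parameters and of generators
    (p.FullyRamified L ↔ HasRamifiedParam p a) ∧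
    (p.FullyRamified L ↔
      ∃ (z : L) (α : K), IsCubicGen z α ∧ p.ord α < 0 ∧ IsCoprime (p.ord α) 3) ∧
    -- local standard form
    (¬ HasRamifiedParam p a → ∃ (z : L) (c : K), IsCubicGen z c ∧ 0 ≤ p.ord c) ∧
    -- for every `x` such that `p` is a finite place over `k(x)`
    ∀ x : K, Transcendental k x → x ∈ p.ring →
      IsDedekindDomain (holRing k x L) ∧
      -- full ramification, as a factorization
      ((∃ P ∈ p.above L, p.extIdeal k x L = P.toIdeal k x ^ 3) ↔ HasRamifiedParam p a) ∧
      (HasRamifiedParam p a → p.HasSignature L [(3, 1)]) ∧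
      ∀ (z : L) (c : K), IsCubicGen z c → 0 ≤ p.ord c →
      ∀ b : AlgebraicClosure L, b ^ 2 = algebraMap L (AlgebraicClosure L) (algebraMap K L (-c)) →
        -- the case v(c) = 0
        (p.ord c = 0 →
          (p.Inert L ↔ ∃ β, β ^ 2 = p.res (-c) ∧ p.tr β ≠ 0) ∧
          (p.Inert L → (∀ P ∈ p.above L, P.f K = 3) ∧ p.HasSignature L [(1, 3)]) ∧
          (p.CompletelySplit L ↔ ∃ β, β ^ 2 = p.res (-c) ∧ p.tr β = 0) ∧
          (p.CompletelySplit L → p.HasSignature L [(1, 1), (1, 1), (1, 1)]) ∧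
          ((∃ P₁ ∈ p.above L, ∃ P₂ ∈ p.above L, P₁ ≠ P₂ ∧
              p.extIdeal k x L = P₁.toIdeal k x * P₂.toIdeal k x) ↔
            ¬ IsSquare (p.res (-c))) ∧
          (¬ IsSquare (p.res (-c)) →
            Module.finrank L L⟮b⟯ = 2 ∧
            (∃ P₁ ∈ p.above L, ∃ P₂ ∈ p.above L, P₁ ≠ P₂ ∧
              p.extIdeal k x L = P₁.toIdeal k x * P₂.toIdeal k x ∧
              P₁.f K = 1 ∧ P₁.Inert L⟮b⟯ ∧ P₂.f K = 2 ∧ P₂.CompletelySplit L⟮b⟯) ∧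
            p.HasSignature L [(1, 1), (1, 2)])) ∧
        -- the case v(c) > 0
        (0 < p.ord c →
          (p.CompletelySplit L ↔ 2 ∣ p.ord c ∧
            ∃ s : K, s ≠ 0 ∧ p.ord (-(s ^ 2 * c)) = 0 ∧ IsSquare (p.res (-(s ^ 2 * c)))) ∧
          (p.CompletelySplit L → p.HasSignature L [(1, 1), (1, 1), (1, 1)]) ∧
          ((∃ P₁ ∈ p.above L, ∃ P₂ ∈ p.above L, P₁ ≠ P₂ ∧
              p.extIdeal k x L = P₁.toIdeal k x * P₂.toIdeal k x) ↔
            2 ∣ p.ord c ∧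
            ∃ s : K, s ≠ 0 ∧ p.ord (s ^ 2 * c) = 0 ∧ ¬ IsSquare (p.res (-(s ^ 2 * c)))) ∧
          ((2 ∣ p.ord c ∧
            ∃ s : K, s ≠ 0 ∧ p.ord (s ^ 2 * c) = 0 ∧ ¬ IsSquare (p.res (-(s ^ 2 * c)))) →
            Module.finrank L L⟮b⟯ = 2 ∧
            (∃ P₁ ∈ p.above L, ∃ P₂ ∈ p.above L, P₁ ≠ P₂ ∧
              p.extIdeal k x L = P₁.toIdeal k x * P₂.toIdeal k x ∧
              P₁.f K = 1 ∧ P₁.Inert L⟮b⟯ ∧ P₂.f K = 2 ∧ P₂.CompletelySplit L⟮b⟯) ∧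
            p.HasSignature L [(1, 1), (1, 2)]) ∧
          ((∃ P₁ ∈ p.above L, ∃ P₂ ∈ p.above L, P₁ ≠ P₂ ∧
              p.extIdeal k x L = P₁.toIdeal k x ^ 2 * P₂.toIdeal k x) ↔
            IsCoprime (p.ord c) 2) ∧
          (IsCoprime (p.ord c) 2 →
            Module.finrank L L⟮b⟯ = 2 ∧
            (∀ P₁ ∈ p.above L, ∀ P₂ ∈ p.above L, P₁ ≠ P₂ →
              p.extIdeal k x L = P₁.toIdeal k x ^ 2 * P₂.toIdeal k x →
              P₁.f K = 1 ∧ P₂.f K = 1 ∧ P₁.CompletelySplit L⟮b⟯ ∧ P₂.Ramified L⟮b⟯) ∧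
            p.HasSignature L [(2, 1), (1, 1)])) := by
  obtain ⟨t, ht, htK⟩ := exists_transcendental_finiteDimensional k K
  have : CharP K 3 := charP_of_injective_algebraMap (algebraMap k K).injective 3
  have : FiniteDimensional K L := Module.finite_of_finrank_pos (by omega)
  have : Finite p.ResidueField := p.finite_residueField ht
  have : Fact (Nat.Prime 3) := ⟨Nat.prime_three⟩
  have hram : HasRamifiedParam p a → p.HasSignature L [(3, 1)] := by
    rintro ⟨j, hj, w, hneg, hcop⟩
    obtain ⟨z, hz⟩ := (hy.exists_transParam hj w).2
    exact Place.hasSignature_of_isCoprime_ord hz hneg hcop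
  have hfull : p.FullyRamified L ↔ HasRamifiedParam p a := by
    -- One direction goes through the local standard form: if the parameter condition fails, an
    -- integral generator exists, and none of the signatures it allows contains `e = 3`.
    constructor
    · intro h
      by_contra hR
      obtain ⟨z, c, hz, hc⟩ := hy.exists_ord_nonneg p hR
      exact hz.not_fullyRamified_of_ord_nonneg hc h
    · intro h
      simp [(hram h).fullyRamified_iff, hL]
  refine ⟨p.exists_transcendental_mem ht, hfull, ?_, hy.exists_ord_nonneg p, ?_⟩
  · constructor
    · intro h
      obtain ⟨j, hj, w, hneg, hcop⟩ := hfull.1 h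
      obtain ⟨z, hz⟩ := (hy.exists_transParam hj w).2
      exact ⟨z, _, hz, hneg, hcop⟩
    · rintro ⟨z, α, hz, hneg, hcop⟩
      simp [(Place.hasSignature_of_isCoprime_ord hz hneg hcop).fullyRamified_iff, hL]
  intro x hx hxp
  have := finiteDimensional_adjoin_of_transcendental ht hx
  have hpow (a : ℕ) : (∃ P ∈ p.above L, p.extIdeal k x L = P.toIdeal k x ^ a) ↔
      ∃ P ∈ p.above L, (∀ Q ∈ p.above L, Q = P) ∧ P.e K = a :=
    exists_congr fun P => and_congr_right fun hP => Place.extIdeal_eq_pow_iff 3 hx hxp hP a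
  have hmulpow (a b : ℕ) : (∃ P₁ ∈ p.above L, ∃ P₂ ∈ p.above L, P₁ ≠ P₂ ∧
      p.extIdeal k x L = P₁.toIdeal k x ^ a * P₂.toIdeal k x ^ b) ↔
      ∃ P ∈ p.above L, ∃ Q ∈ p.above L, P ≠ Q ∧
        (∀ R ∈ p.above L, R = P ∨ R = Q) ∧ P.e K = a ∧ Q.e K = b :=
    exists_congr fun P => and_congr_right fun hP => exists_congr fun Q =>
      and_congr_right fun hQ => and_congr_right fun hPQ =>
        Place.extIdeal_eq_pow_mul_pow_iff 3 hx hxp hP hQ hPQ a b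
  have hmul := hmulpow 1 1
  have hmul' := hmulpow 2 1
  simp only [pow_one] at hmul hmul'
  refine ⟨isDedekindDomain_holRing L 3 hx, ?_, hram, ?_⟩
  · rw [hpow, ← hfull]
    constructor
    · rintro ⟨P, hP, -, he⟩
      exact ⟨P, hP, by rw [he, hL]⟩
    · intro h
      rw [(hram (hfull.1 h)).exists_pow_type_iff]
      exact ⟨1, rfl⟩
  intro z c hz hc b hb
  rw [hmul, hmul']
  have htwo : ∀ s : K, s ≠ 0 → p.ord (s ^ 2 * c) = 0 → ¬ IsSquare (p.res (-(s ^ 2 * c))) →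
      Module.finrank L L⟮b⟯ = 2 ∧
      (∃ P₁ ∈ p.above L, ∃ P₂ ∈ p.above L, P₁ ≠ P₂ ∧
        p.extIdeal k x L = P₁.toIdeal k x * P₂.toIdeal k x ∧
        P₁.f K = 1 ∧ P₁.Inert L⟮b⟯ ∧ P₂.f K = 2 ∧ P₂.CompletelySplit L⟮b⟯) ∧
      p.HasSignature L [(1, 1), (1, 2)] := by
    intro s hs h0 hsq
    obtain ⟨hsig, hfin, P₁, P₂, hne, hall, he₁, hf₁, he₂, hf₂, hin, hsp⟩ :=
      hz.exists_above_of_not_isSquare hb hc hs h0 hsq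
    have hP₁ := (hall P₁).2 (.inl rfl)
    have hP₂ := (hall P₂).2 (.inr rfl)
    have := (Place.extIdeal_eq_pow_mul_pow_iff 3 hx hxp hP₁ hP₂ hne 1 1).2
      ⟨fun R => (hall R).1, he₁, he₂⟩
    rw [pow_one, pow_one] at this
    exact ⟨hfin, ⟨P₁, hP₁, P₂, hP₂, hne, this, hf₁, hin, hf₂, hsp⟩, hsig⟩
  constructor
  · intro hc0
    -- From decomposition type to condition, the other signatures are excluded; conversely the
    -- criterion is applied to the given witness `β`, whichever square root it is.
    have hcases := hz.hasSignature_cases_of_ord_eq_zero hc0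
    have hinert : p.Inert L → p.HasSignature L [(1, 3)] := fun hi => by
      rcases hcases with ⟨-, h⟩ | ⟨-, h⟩ | ⟨-, h⟩
      · exact h
      all_goals simp [h.inert_iff] at hi
    refine ⟨⟨fun hi => ?_, ?_⟩, fun hi => ⟨(hinert hi).f_eq_of_inert rfl, hinert hi⟩,
      ⟨fun hi => ?_, ?_⟩, fun hi => ?_, ⟨fun hi => ?_, fun hsq => ?_⟩, fun hsq => ?_⟩
    · rcases hcases with ⟨h, -⟩ | ⟨-, h⟩ | ⟨-, h⟩
      · exact h
      all_goals simp [h.inert_iff] at hi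
    · rintro ⟨β, hβ, htr⟩
      simp [((hz.hasSignature_of_ord_eq_zero hc0 hβ).2 htr).inert_iff]
    · rcases hcases with ⟨-, h⟩ | ⟨h, -⟩ | ⟨-, h⟩
      · simp [h.completelySplit_iff, hL] at hi
      · exact h
      · simp [h.completelySplit_iff, hL] at hi
    · rintro ⟨β, hβ, htr⟩
      simp [((hz.hasSignature_of_ord_eq_zero hc0 hβ).1 htr).completelySplit_iff, hL]
    · rcases hcases with ⟨-, h⟩ | ⟨-, h⟩ | ⟨-, h⟩
      · simp [h.completelySplit_iff, hL] at hi
      · exact h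
      · simp [h.completelySplit_iff, hL] at hi
    · rcases hcases with ⟨-, h⟩ | ⟨-, h⟩ | ⟨h, -⟩
      · simp [h.exists_pow_mul_pow_type_iff] at hi
      · simp [h.exists_pow_mul_pow_type_iff] at hi
      · exact h
    · have h := (htwo 1 one_ne_zero (by simpa using hc0) (by simpa using hsq)).2.2
      rw [h.exists_pow_mul_pow_type_iff]
      exact ⟨1, 2, .inl rfl⟩
    · exact htwo 1 one_ne_zero (by simpa using hc0) (by simpa using hsq)
  · intro hcpos
    have hcases := hz.hasSignature_cases_of_ord_pos hcpos
    refine ⟨⟨fun hi => ?_, ?_⟩, fun hi => ?_, ⟨fun hi => ?_, ?_⟩, ?_, ⟨fun hi => ?_, fun ho => ?_⟩,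
      fun ho => ?_⟩
    · rcases hcases with ⟨h, -⟩ | ⟨-, h⟩ | ⟨-, h⟩
      · exact h
      all_goals simp [h.completelySplit_iff, hL] at hi
    · rintro ⟨-, s, hs, h0, hsq⟩
      rw [Place.ord_neg] at h0
      simp [(hz.hasSignature_of_isSquare hcpos hs h0 hsq).completelySplit_iff, hL]
    · rcases hcases with ⟨-, h⟩ | ⟨-, h⟩ | ⟨-, h⟩
      · exact h
      all_goals simp [h.completelySplit_iff, hL] at hi
    · rcases hcases with ⟨-, h⟩ | ⟨h, -⟩ | ⟨-, h⟩
      · simp [h.exists_pow_mul_pow_type_iff] at hi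
      · exact h
      · simp [h.exists_pow_mul_pow_type_iff] at hi
    · rintro ⟨-, s, hs, h0, hsq⟩
      have h := (htwo s hs h0 hsq).2.2
      rw [h.exists_pow_mul_pow_type_iff]
      exact ⟨1, 2, .inl rfl⟩
    · rintro ⟨-, s, hs, h0, hsq⟩
      exact htwo s hs h0 hsq
    · rcases hcases with ⟨-, h⟩ | ⟨-, h⟩ | ⟨h, -⟩
      · simp [h.exists_pow_mul_pow_type_iff] at hi
      · simp [h.exists_pow_mul_pow_type_iff] at hi
      · exact h
    · have h := (hz.exists_above_of_odd hb hcpos ho).1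
      simp [h.exists_pow_mul_pow_type_iff]
    · obtain ⟨hsig, hfin, Q₁, Q₂, hne, hall, he₁, hf₁, he₂, hf₂, hsp, hrm⟩ :=
        hz.exists_above_of_odd hb hcpos ho
      refine ⟨hfin, fun P₁ hP₁ P₂ hP₂ hP₁₂ hext => ?_, hsig⟩
      rw [← pow_one (P₂.toIdeal k x), Place.extIdeal_eq_pow_mul_pow_iff 3 hx hxp hP₁ hP₂ hP₁₂]
        at hext
      -- The factorization prescribes `e(P₁) = 2`, and `Q₁` is the only place above `p` with that
      -- index.
      have h₁ : P₁ = Q₁ := by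
        rcases (hall P₁).1 hP₁ with h | h
        · exact h
        · rw [h] at hext; omega
      have h₂ : P₂ = Q₂ := by
        rcases (hall P₂).1 hP₂ with h | h
        · exact absurd (h₁.trans h.symm) hP₁₂
        · exact h
      subst h₁ h₂
      exact ⟨hf₁, hf₂, hsp, hrm⟩
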